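/- **Theorem ($\Gamma$-convergence of the diffuse-domain energies, Neumann case).** Let $n\ge 1$, let $\Omega=\prod_{i=1}^n(a_i,b_i)\subset\mathbb R^n$ be an open cuboid, and let $\Omega_1$ be a nonempty bounded open set with $C^3$ boundary and $\overline{\Omega_1}\subset\Omega$; put $\Omega_2=\Omega\setminus\overline{\Omega_1}$. Let $\alpha,\beta,\gamma>0$ be constants, $h,q\in L^2(\Omega)$ and $g\in H^1(\Omega)$. Let $r$ be the signed distance to $\partial\Omega_1$, positive in $\Omega_1$ and negative outside $\overline{\Omega_1}$, and for $\varepsilon\in(0,1)$ set $$\phi_\varepsilon=\tfrac12\Bigl[1+\tanh\Bigl(\frac{r}{\varepsilon}\Bigr)\Bigr],\qquad D_\varepsilon=\alpha+(1-\alpha)\phi_\varepsilon,\qquad c_\varepsilon=\beta+(\gamma-\beta)\phi_\varepsilon,\qquad f_\varepsilon=h+(q-h)\phi_\varepsilon,$$ $$D_0=\chi_{\Omega_1}+\alpha\chi_{\Omega_2},\qquad c_0=\gamma\chi_{\Omega_1}+\beta\chi_{\Omega_2},\qquad f_0=q\chi_{\Omega_1}+h\chi_{\Omega_2}.$$ Define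 $\mathcal F_\varepsilon,\mathcal F_0:L^2(\Omega)\to(-\infty,+\infty]$ by $$\mathcal F_\varepsilon[u]=\int_\Omega\Bigl[\tfrac12\bigl(D_\varepsilon|\nabla u|^2+c_\varepsilon u^2\bigr)-f_\varepsilon u+g\,u\,|\nabla\phi_\varepsilon|\Bigr]dx,$$ $$\mathcal F_0[u]=\int_\Omega\Bigl[\tfrac12\bigl(D_0|\nabla u|^2+c_0u^2\bigr)-f_0u\Bigr]dx+\int_{\partial\Omega_1}g\,u\,dS$$ for $u\in H^1(\Omega)$, and $\mathcal F_\varepsilon[u]=\mathcal F_0[u]=+\infty$ for $u\in L^2(\Omega)\setminus H^1(\Omega)$; in the surface integral ($dS$ is the $(n-1)$-dimensional Hausdorff measure) $g$ and $u$ stand for their traces on $\partial\Omega_1$. Then, as $\varepsilon\to0$, $\mathcal F_\varepsilon$ $\Gamma$-converges to $\mathcal F_0$ in the strong topology of $L^2(\Omega)$. That is, for every sequence $(\varepsilon_k)\subset(0,1)$ with $\varepsilon_k\to0$ and every $u\in L^2(\Omega)$: 1. if $u_k\to u$ in $L^2(\Omega)$, then $\mathcal F_0[u]\le\liminf_{k\to\infty}\mathcal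 F_{\varepsilon_k}[u_k]$; 2. there is a sequence $u_k\to u$ in $L^2(\Omega)$ with $\limsup_{k\to\infty}\mathcal F_{\varepsilon_k}[u_k]\le\mathcal F_0[u]$. -/

import Mathlib

open MeasureTheory Filter Topology
open scoped ContDiff

noncomputable section

namespace DiffuseDomain

/-- Euclidean space `ℝⁿ`. -/
abbrev E (n : ℕ) := EuclideanSpace ℝ (Fin n)

/-- The open cuboid `∏ᵢ (aᵢ, bᵢ)`. -/
def cuboid {n : ℕ} (a b : Fin n → ℝ) : Set (E n) :=
  {x | ∀ i, a i < x i ∧ x i < b i}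

/-- `U` has a boundary of class `C^k`: near every boundary point `p` there is a direction `ν` such
that `U` is the region lying above (in the direction `ν`) the graph of a `C^k` function of the
component of the variable orthogonal to `ν`. -/
def HasCkBoundary {n : ℕ} (k : ℕ∞) (U : Set (E n)) : Prop :=
  ∀ p ∈ frontier U, ∃ (ν : E n) (ψ : E n → ℝ) (ρ : ℝ),
    ‖ν‖ = 1 ∧ ContDiff ℝ k ψ ∧ 0 < ρ ∧
      U ∩ Metric.ball p ρ =
        {x ∈ Metric.ball p ρ | ψ (x - inner ℝ ν x • ν) < inner ℝ ν x}

/-! ### The Sobolev space `H¹` and traces -/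

/-- `G` is a weak gradient of `u` in the open set `U`. -/
def IsWeakGradient {n : ℕ} (U : Set (E n)) (u : E n → ℝ) (G : E n → E n) : Prop :=
  ∀ φ : E n → ℝ, ContDiff ℝ ∞ φ → HasCompactSupport φ → tsupport φ ⊆ U →
    ∀ v : E n, ∫ x in U, u x * fderiv ℝ φ x v = - ∫ x in U, inner ℝ (G x) v * φ x

/-- `u ∈ H¹(U)`. -/
def MemH1 {n : ℕ} (U : Set (E n)) (u : E n → ℝ) : Prop :=
  MemLp u 2 (volume.restrict U) ∧
    ∃ G : E n → E n, MemLp G 2 (volume.restrict U) ∧ IsWeakGradient U u G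

open Classical in
/-- The weak gradient `∇u` of `u ∈ H¹(U)` (unique up to null sets of `U`). -/
def weakGradient {n : ℕ} (U : Set (E n)) (u : E n → ℝ) : E n → E n :=
  if h : MemH1 U u then h.2.choose else 0

/-- The surface measure `dS` on `∂U`: the `(n-1)`-dimensional Hausdorff measure, normalised so that
it agrees with Lebesgue measure on hyperplanes. -/
def surfaceMeasure {n : ℕ} (U : Set (E n)) : Measure (E n) :=
  (Measure.euclideanHausdorffMeasure (n - 1)).restrict (frontier U)

/-- `t ∈ L²(∂U)` is the boundary trace of `u ∈ H¹(U)`: there are smooth functions on `ℝⁿ`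
converging to `u` in `H¹(U)` whose restrictions to `∂U` converge to `t` in `L²(∂U)`. -/
def IsTrace {n : ℕ} (U : Set (E n)) (u t : E n → ℝ) : Prop :=
  MemH1 U u ∧ MemLp t 2 (surfaceMeasure U) ∧
    ∃ v : ℕ → E n → ℝ, (∀ k, ContDiff ℝ ∞ (v k)) ∧
      Tendsto (fun k => eLpNorm (v k - u) 2 (volume.restrict U)) atTop (𝓝 0) ∧
      Tendsto (fun k => eLpNorm (gradient (v k) - weakGradient U u) 2 (volume.restrict U))
        atTop (𝓝 0) ∧
      Tendsto (fun k => eLpNorm (v k - t) 2 (surfaceMeasure U)) atTop (𝓝 0)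

open Classical in
/-- The trace of `u` on `∂U` (unique up to null sets of the surface measure). -/
def trace {n : ℕ} (U : Set (E n)) (u : E n → ℝ) : E n → ℝ :=
  if h : ∃ t, IsTrace U u t then h.choose else 0

/-! ### The phase field and the coefficients -/

open Classical in
/-- The signed distance to `∂U`, nonnegative in `U` and nonpositive outside. -/
def signedDist {n : ℕ} (U : Set (E n)) (x : E n) : ℝ :=
  if x ∈ U then Metric.infDist x (frontier U) else - Metric.infDist x (frontier U)

/-- The phase field `φ_ε = ½ (1 + tanh (r/ε))`. -/
def phase {n : ℕ} (Ω₁ : Set (E n)) (ε : ℝ) (x : E n) : ℝ :=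
  (1 / 2) * (1 + Real.tanh (signedDist Ω₁ x / ε))

/-- `s₂ + (s₁ - s₂) φ_ε`: with `(s₁, s₂) = (1, α), (γ, β), (q, h)` these are `D_ε, c_ε, f_ε`. -/
def diffuseCoeff {n : ℕ} (Ω₁ : Set (E n)) (ε : ℝ) (s₁ s₂ : E n → ℝ) (x : E n) : ℝ :=
  s₂ x + (s₁ x - s₂ x) * phase Ω₁ ε x

/-- `s₁ χ_{Ω₁} + s₂ χ_{Ω₂}` with `Ω₂ = Ω ∖ closure Ω₁`: with
`(s₁, s₂) = (1, α), (γ, β), (q, h)` these are `D₀, c₀, f₀`. -/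
def sharpCoeff {n : ℕ} (Ω Ω₁ : Set (E n)) (s₁ s₂ : E n → ℝ) (x : E n) : ℝ :=
  Ω₁.indicator s₁ x + (Ω \ closure Ω₁).indicator s₂ x

/-! ### The energies on `L²(Ω)` -/

open Classical in
/-- The diffuse-domain energy `F_ε`. -/
def diffuseEnergy {n : ℕ} (Ω Ω₁ : Set (E n)) (α β γ : ℝ) (h q g : E n → ℝ) (ε : ℝ)
    (u : Lp ℝ 2 (volume.restrict Ω)) : EReal :=
  if MemH1 Ω u then
    ((∫ x in Ω,
        ((1 / 2) * (diffuseCoeff Ω₁ ε (fun _ => 1) (fun _ => α) x * ‖weakGradient Ω u x‖ ^ 2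
            + diffuseCoeff Ω₁ ε (fun _ => γ) (fun _ => β) x * u x ^ 2)
          - diffuseCoeff Ω₁ ε q h x * u x
          + g x * u x * ‖gradient (phase Ω₁ ε) x‖) : ℝ) : EReal)
  else ⊤

open Classical in
/-- The sharp-interface energy `F₀`. -/
def sharpEnergy {n : ℕ} (Ω Ω₁ : Set (E n)) (α β γ : ℝ) (h q g : E n → ℝ)
    (u : Lp ℝ 2 (volume.restrict Ω)) : EReal :=
  if MemH1 Ω u then
    (((∫ x in Ω,
        ((1 / 2) * (sharpCoeff Ω Ω₁ (fun _ => 1) (fun _ => α) x * ‖weakGradient Ω u x‖ ^ 2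
            + sharpCoeff Ω Ω₁ (fun _ => γ) (fun _ => β) x * u x ^ 2)
          - sharpCoeff Ω Ω₁ q h x * u x))
      + ∫ x, trace Ω₁ g x * trace Ω₁ u x ∂(surfaceMeasure Ω₁) : ℝ) : EReal)
  else ⊤

/-! ### Γ-convergence -/

/-- `Γ`-convergence of a sequence of functionals on a metric space. -/
def GammaConvergesSeq {X : Type*} [PseudoMetricSpace X] (F : ℕ → X → EReal) (F₀ : X → EReal) :
    Prop :=
  (∀ (u : X) (v : ℕ → X), Tendsto v atTop (𝓝 u) →
      F₀ u ≤ liminf (fun k => F k (v k)) atTop) ∧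
  (∀ u : X, ∃ v : ℕ → X, Tendsto v atTop (𝓝 u) ∧
      limsup (fun k => F k (v k)) atTop ≤ F₀ u)

/-- `Γ`-convergence, as `ε → 0`, of a family indexed by `ε ∈ (0,1)`. -/
def GammaConverges {X : Type*} [PseudoMetricSpace X] (F : ℝ → X → EReal) (F₀ : X → EReal) :
    Prop :=
  ∀ ε : ℕ → ℝ, (∀ k, ε k ∈ Set.Ioo (0 : ℝ) 1) → Tendsto ε atTop (𝓝 0) →
    GammaConvergesSeq (fun k => F (ε k)) F₀

end DiffuseDomain

end

open MeasureTheory Filter Topology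
open scoped ContDiff

namespace DiffuseDomain

/-! The core of the proof is that the diffuse surface measures `|∇φ_ε| dx` converge to `dS`,
together with a trace inequality for them that is uniform in `ε`. Both come from one local
comparison, made without the coarea or area formula and without a tubular neighbourhood.

Fix `c < 1`. Near a boundary point, strict differentiability of a defining function gives a wide
cone condition with unit axis `N` (`HasCkBoundary.exists_coneCondition`). It forces the signed
distance to grow at rate at least `c` along `N` (`signedDist_add_le`), so that `c |∇φ_ε| ≤ ∂_N φ_ε ≤
|∇φ_ε|` almost everywhere. Tested against a localized `F ≥ 0` and integrated by parts, this places
`-∫ φ_ε ∂_N F` between `c ∫ F |∇φ_ε|` and `∫ F |∇φ_ε|`. As `ε → 0` the pivot tends to `-∫_U ∂_N F`.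
By Fubini along lines parallel to `N` this is an integral over a hyperplane, and since projection is
1-Lipschitz and the boundary is a `c⁻¹`-Lipschitz graph, it agrees with `∫ F dS` up to a factor `c⁻¹
^ (n - 1)` (`IsConeAt.lintegral_surface`). A partition of unity followed by `c → 1` yields
`tendsto_integral_mul_norm_gradient_phase`.

With `F = χ_i v²` the same comparison bounds `∫ v² |∇φ_ε|` near the boundary, and also `∫ v² dS`, by
a constant times `∫ (v² + |v| |∇v|)`, uniformly in `ε`. Density of smooth functions carries the
boundary limit over to `g, u ∈ H¹` and their traces (`tendsto_integral_boundary`). The product form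
of the bound also shows that the boundary term of `v_k - u` vanishes when `v_k → u` in `L²` with
bounded gradients (`exists_boundary_bound`, `tendsto_integral_boundary_seq`).

For the lower bound, an energy bound controls gradients because the boundary and load terms grow at
most linearly in the gradient norm (`exists_gradient_bound`). Along an ultrafilter the gradients
converge weakly, to the weak gradient of the limit. The gradient term is handled by the convexity
inequality `D|W|² ≥ 2 D W·G - D|G|²`, in which `D_ε G → D_0 G` strongly, and the other terms
converge (`sharpIntegral_le`). For the upper bound the constant sequence suffices, since the energy
of a fixed `H¹` function converges (`tendsto_diffuseIntegral`). -/

/-! ### Cone condition at boundary points -/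

/-- `U` contains, near `p`, the cone with axis `N` and slope `δ` issuing from each of its closure
points. -/
def ConeCondition {n : ℕ} (U : Set (E n)) (p N : E n) (ρ δ : ℝ) : Prop :=
  ∀ x ∈ closure U, ∀ y, x ∈ Metric.ball p ρ → y ∈ Metric.ball p ρ → x ≠ y →
    δ * ‖y - x‖ ≤ inner ℝ N (y - x) → y ∈ U

/-- The function `G` with `U = {G > 0}` near `p` has nonzero gradient there, and the axis is the
normalized gradient. Strict differentiability compares `G` at two nearby points uniformly, so every
positive slope is admissible at a small enough scale. -/
theorem HasCkBoundary.exists_coneCondition {n : ℕ} {k : ℕ∞} (hk : 1 ≤ k) {U : Set (E n)}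
    (hU : HasCkBoundary k U) {p : E n} (hp : p ∈ frontier U) {δ : ℝ} (hδ : 0 < δ) :
    ∃ (N : E n) (ρ : ℝ), ‖N‖ = 1 ∧ 0 < ρ ∧ ConeCondition U p N ρ δ := by
  obtain ⟨ν, ψ, ρ₀, hν, hψ, hρ₀, hUeq⟩ := hU p hp
  set G : E n → ℝ := fun x => inner ℝ ν x - ψ (x - inner ℝ ν x • ν) with hG
  have hGc : ContDiff ℝ 1 G := by
    have hψ1 : ContDiff ℝ 1 ψ := hψ.of_le (by exact_mod_cast hk)
    have h1 : ContDiff ℝ 1 (fun x : E n => inner ℝ ν x) := contDiff_const.inner ℝ contDiff_id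
    exact h1.sub (hψ1.comp (contDiff_id.sub (h1.smul contDiff_const)))
  have hst : HasStrictFDerivAt G (fderiv ℝ G p) p :=
    hGc.contDiffAt.hasStrictFDerivAt (by norm_num)
  set g : E n := (InnerProductSpace.toDual ℝ (E n)).symm (fderiv ℝ G p) with hg
  have hgi : ∀ v, fderiv ℝ G p v = inner ℝ g v := fun v => by
    rw [hg, InnerProductSpace.toDual_symm_apply]
  have hνν : inner ℝ ν ν = (1 : ℝ) := by rw [real_inner_self_eq_norm_sq, hν]; norm_num
  -- The argument of `ψ` does not see the `ν`-component, so `G` grows at exactly unit speed along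
  -- `ν` and its gradient cannot vanish.
  have hline : ∀ t : ℝ, G (p + t • ν) = G p + t := fun t => by
    simp only [hG, inner_add_right, inner_smul_right, hνν]
    have : p + t • ν - (inner ℝ ν p + t * 1) • ν = p - inner ℝ ν p • ν := by
      rw [mul_one, add_smul]; abel
    rw [this]; ring
  have hgν : fderiv ℝ G p ν = 1 := by
    have h1 : HasDerivAt (fun t : ℝ => G (p + t • ν)) (fderiv ℝ G p ν) 0 := by
      have := (hst.hasFDerivAt.hasLineDerivAt ν)
      simpa [HasLineDerivAt] using this
    have h2 : HasDerivAt (fun t : ℝ => G (p + t • ν)) 1 0 := by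
      simp only [hline]
      simpa using (hasDerivAt_id (0 : ℝ)).const_add (G p)
    exact h1.unique h2
  have hg0 : 0 < ‖g‖ := by
    rw [norm_pos_iff]
    rintro h0
    rw [hgi, h0, inner_zero_left] at hgν
    exact zero_ne_one hgν
  -- Half of the growth `δ ‖g‖ ‖y - x‖` is given to the linearization error; the other half keeps `G
  -- y` positive.
  have hc : 0 < δ * ‖g‖ / 2 := by positivity
  have hev := hst.isLittleO.def hc
  obtain ⟨r₁, hr₁, hball⟩ := Metric.eventually_nhds_iff_ball.1 hev
  refine ⟨‖g‖⁻¹ • g, min ρ₀ r₁, ?_, lt_min hρ₀ hr₁, ?_⟩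
  · rw [norm_smul, norm_inv, norm_norm, inv_mul_cancel₀ hg0.ne']
  intro x hx y hxb hyb hxy hcone
  have hxρ : x ∈ Metric.ball p ρ₀ := Metric.ball_subset_ball (min_le_left _ _) hxb
  have hyρ : y ∈ Metric.ball p ρ₀ := Metric.ball_subset_ball (min_le_left _ _) hyb
  have hGx : 0 ≤ G x := by
    have hx' : x ∈ closure (U ∩ Metric.ball p ρ₀) := by
      rw [Set.inter_comm]
      exact Metric.isOpen_ball.inter_closure ⟨hxρ, hx⟩
    have hcl : IsClosed {z | 0 ≤ G z} := isClosed_le continuous_const hGc.continuous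
    refine closure_minimal ?_ hcl hx'
    rw [hUeq]
    rintro z ⟨-, hz⟩
    simp only [hG, Set.mem_ofPred_eq]; linarith
  have hle := hball (y, x) (by
    rw [← ball_prod_same]
    exact ⟨Metric.ball_subset_ball (min_le_right _ _) hyb,
      Metric.ball_subset_ball (min_le_right _ _) hxb⟩)
  simp only [Real.norm_eq_abs] at hle
  have h1 := (abs_le.1 hle).1
  rw [hgi] at h1
  rw [real_inner_smul_left] at hcone
  have h2 : δ * ‖g‖ * ‖y - x‖ ≤ inner ℝ g (y - x) := by
    have := mul_le_mul_of_nonneg_left hcone hg0.le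
    rw [← mul_assoc, mul_inv_cancel_left₀ hg0.ne'] at this
    linarith
  have h3 : 0 < ‖y - x‖ := norm_pos_iff.2 (sub_ne_zero.2 hxy.symm)
  have h4 : 0 < δ * ‖g‖ / 2 * ‖y - x‖ := by positivity
  have hGy : 0 < G y := by linarith
  have : y ∈ U ∩ Metric.ball p ρ₀ := by
    rw [hUeq]
    refine ⟨hyρ, ?_⟩
    simp only [hG] at hGy; linarith
  exact this.1

/-! ### Signed distance: Lipschitz bound and sides of the frontier -/

theorem signedDist_of_mem {n : ℕ} {U : Set (E n)} {x : E n} (hx : x ∈ U) :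
    signedDist U x = Metric.infDist x (frontier U) := if_pos hx

theorem signedDist_of_notMem {n : ℕ} {U : Set (E n)} {x : E n} (hx : x ∉ U) :
    signedDist U x = - Metric.infDist x (frontier U) := if_neg hx

theorem abs_signedDist {n : ℕ} (U : Set (E n)) (x : E n) :
    |signedDist U x| = Metric.infDist x (frontier U) := by
  unfold signedDist
  split_ifs <;> simp [abs_of_nonneg Metric.infDist_nonneg]

/-- A segment joining a point of `U` to a point outside `U` meets the frontier. -/
theorem exists_mem_segment_frontier {n : ℕ} {U : Set (E n)} {x y : E n} (hx : x ∈ U) (hy : y ∉ U) :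
    ∃ z ∈ segment ℝ x y, z ∈ frontier U := by
  have hpre : IsPreconnected (segment ℝ x y) := (convex_segment x y).isPreconnected
  by_contra! hno
  have hcover : segment ℝ x y ⊆ interior U ∪ (closure U)ᶜ := fun z hz => by
    by_contra hz'
    simp only [Set.mem_union, Set.mem_compl_iff, not_or, not_not] at hz'
    exact hno z hz ⟨hz'.2, hz'.1⟩
  have hyc : y ∈ (closure U)ᶜ := by
    rcases hcover (right_mem_segment ℝ x y) with h | h
    · exact absurd (interior_subset h) hy
    · exact h
  have hxi : x ∈ interior U := by
    rcases hcover (left_mem_segment ℝ x y) with h | h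
    · exact h
    · exact absurd (subset_closure hx) h
  obtain ⟨z, -, hz1, hz2⟩ := hpre _ _ isOpen_interior isClosed_closure.isOpen_compl hcover
    ⟨x, left_mem_segment ℝ x y, hxi⟩ ⟨y, right_mem_segment ℝ x y, hyc⟩
  exact hz2 (subset_closure (interior_subset hz1))

/-- For points on opposite sides, the joining segment meets the frontier at some `z`, and the two
distances to the frontier add up to at most `|x - z| + |z - y| = |x - y|`. -/
theorem signedDist_lipschitz {n : ℕ} (U : Set (E n)) : LipschitzWith 1 (signedDist U) := by
  refine LipschitzWith.of_le_add fun x y => ?_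
  have hd : ∀ a b : E n, Metric.infDist a (frontier U) ≤ Metric.infDist b (frontier U) + dist a b :=
    fun a b => Metric.infDist_le_infDist_add_dist
  by_cases hx : x ∈ U
  · by_cases hy : y ∈ U
    · rw [signedDist_of_mem hx, signedDist_of_mem hy]; exact hd x y
    · obtain ⟨z, hz, hzf⟩ := exists_mem_segment_frontier hx hy
      rw [signedDist_of_mem hx, signedDist_of_notMem hy]
      have h1 := Metric.infDist_le_dist_of_mem (x := x) hzf
      have h2 := Metric.infDist_le_dist_of_mem (x := y) hzf
      have h3 := dist_add_dist_of_mem_segment hz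
      rw [dist_comm y z] at h2
      linarith
  · by_cases hy : y ∈ U
    · rw [signedDist_of_notMem hx, signedDist_of_mem hy]
      have h1 : 0 ≤ Metric.infDist x (frontier U) := Metric.infDist_nonneg
      have h2 : 0 ≤ Metric.infDist y (frontier U) := Metric.infDist_nonneg
      have := dist_nonneg (x := x) (y := y)
      linarith
    · rw [signedDist_of_notMem hx, signedDist_of_notMem hy]
      have := hd y x
      rw [dist_comm] at this
      linarith

/-- A point whose distance to `x` is less than the distance from `x` to the frontier lies on the
same side of the frontier as `x`. -/
theorem mem_iff_mem_of_dist_lt_infDist {n : ℕ} {U : Set (E n)} {x z : E n}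
    (h : dist z x < Metric.infDist x (frontier U)) : z ∈ U ↔ x ∈ U := by
  have key : ∀ a b : E n, a ∈ U → b ∉ U → (∀ w ∈ segment ℝ a b, dist w x ≤ dist z x) → False := by
    intro a b ha hb hw
    obtain ⟨w, hws, hwf⟩ := exists_mem_segment_frontier ha hb
    have := Metric.infDist_le_dist_of_mem (x := x) hwf
    have h2 := hw w hws
    rw [dist_comm] at this
    linarith
  have hconv : ∀ w ∈ segment ℝ x z, dist w x ≤ dist z x := by
    intro w hw
    have := (convex_closedBall x (dist z x)).segment_subset
      (Metric.mem_closedBall_self dist_nonneg) (Metric.mem_closedBall.2 le_rfl) hw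
    exact Metric.mem_closedBall.1 this
  constructor
  · intro hz
    by_contra hx
    exact key z x hz hx (by rw [segment_symm]; exact hconv)
  · intro hx
    by_contra hz
    exact key x z hx hz hconv

/-- The cut is proportional along `w`. The alternative `w₁ = 0` keeps the case `d = 0` usable, where
no strict inequality is available. -/
theorem exists_split {n : ℕ} {w : E n} {d t : ℝ} (hd : 0 ≤ d) (ht : 0 < t) (hw : ‖w‖ < d + t) :
    ∃ w₁ w₂ : E n, w = w₁ + w₂ ∧ (w₁ = 0 ∨ ‖w₁‖ < d) ∧ ‖w₁‖ ≤ d ∧ ‖w₂‖ ≤ t := by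
  have hdt : 0 < d + t := by linarith
  refine ⟨(d / (d + t)) • w, (t / (d + t)) • w, ?_, ?_, ?_, ?_⟩
  · rw [← add_smul, ← add_div, div_self hdt.ne', one_smul]
  · rcases hd.eq_or_lt with h | h
    · left; simp [← h]
    · right
      rw [norm_smul, Real.norm_of_nonneg (by positivity), div_mul_eq_mul_div, div_lt_iff₀ hdt]
      gcongr
  · rw [norm_smul, Real.norm_of_nonneg (by positivity), div_mul_eq_mul_div, div_le_iff₀ hdt]
    gcongr
  · rw [norm_smul, Real.norm_of_nonneg (by positivity), div_mul_eq_mul_div, div_le_iff₀ hdt]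
    gcongr

/-! ### Growth of the signed distance along the cone axis -/

section Monotone

variable {n : ℕ} {U : Set (E n)} {p N : E n} {ρ δ c : ℝ}

/-- The vector `s N + w` has length at most `s (1 + c)` and axial component at least `s (1 - c)`.
Hence the slope `(1 - c) / (1 + c)` is the one that tolerates perturbations of size `c s`. -/
theorem cone_perturbation (hN : ‖N‖ = 1) (hδ : 0 ≤ δ) (hcδ : δ * (1 + c) ≤ 1 - c)
    {s : ℝ} (hs : 0 < s) {w : E n} (hw : ‖w‖ ≤ c * s) :
    δ * ‖s • N + w‖ ≤ inner ℝ N (s • N + w) := by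
  have h1 : ‖s • N + w‖ ≤ s * (1 + c) := by
    have := norm_add_le (s • N) w
    rw [norm_smul, hN, Real.norm_of_nonneg hs.le] at this
    linarith
  have h2 : s * (1 - c) ≤ inner ℝ N (s • N + w) := by
    rw [inner_add_right, inner_smul_right, real_inner_self_eq_norm_sq, hN]
    have := abs_le.1 (abs_real_inner_le_norm N w)
    rw [hN] at this
    linarith [this.1]
  calc δ * ‖s • N + w‖ ≤ δ * (s * (1 + c)) := by gcongr
    _ = s * (δ * (1 + c)) := by ring
    _ ≤ s * (1 - c) := by gcongr
    _ ≤ _ := h2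

theorem perturbation_ne_zero (hN : ‖N‖ = 1) (hc1 : c < 1) {s : ℝ} (hs : 0 < s) {w : E n}
    (hw : ‖w‖ ≤ c * s) : s • N + w ≠ 0 := by
  intro h0
  have : w = -(s • N) := by rw [eq_neg_iff_add_eq_zero, add_comm]; exact h0
  rw [this, norm_neg, norm_smul, hN, Real.norm_of_nonneg hs.le] at hw
  nlinarith

/-- The open set `U` satisfies near its boundary point `p` the cone condition with unit axis `N`
and slope `(1 - c) / (1 + c)`. -/
structure IsConeAt (U : Set (E n)) (p N : E n) (ρ c : ℝ) : Prop where
  isOpen : IsOpen U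
  mem_frontier : p ∈ frontier U
  norm_eq : ‖N‖ = 1
  radius_pos : 0 < ρ
  c_pos : 0 < c
  c_lt : c < 1
  cone : ConeCondition U p N ρ ((1 - c) / (1 + c))

theorem IsConeAt.slope_nonneg (h : IsConeAt U p N ρ c) : 0 ≤ (1 - c) / (1 + c) :=
  div_nonneg (by linarith [h.c_lt]) (by linarith [h.c_pos])

theorem IsConeAt.slope_le (h : IsConeAt U p N ρ c) : (1 - c) / (1 + c) ≤ 1 - c := by
  have h1 := h.c_pos
  have h2 := h.c_lt
  exact div_le_self (by linarith) (by linarith)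

theorem HasCkBoundary.exists_isConeAt {k : ℕ∞} (hk : 1 ≤ k) (hU : HasCkBoundary k U)
    (hUo : IsOpen U) (hp : p ∈ frontier U) (hc : 0 < c) (hc1 : c < 1) :
    ∃ (N : E n) (ρ : ℝ), IsConeAt U p N ρ c := by
  obtain ⟨N, ρ, hN, hρ, h⟩ := hU.exists_coneCondition hk hp
    (δ := (1 - c) / (1 + c)) (div_pos (by linarith) (by linarith))
  exact ⟨N, ρ, hUo, hp, hN, hρ, hc, hc1, h⟩

/-- A point within `d + c s` of `x + s N` is `x + w₁ + (s N + w₂)` with `‖w₁‖ ≤ d` and `‖w₂‖ ≤ c s`.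
The shift `w₁` does not leave the closure of `U`, and the cone at `x + w₁` absorbs the rest. The
radius `ρ / 6` keeps all these points in the ball of radius `ρ`. -/
theorem infDist_add_le_of_mem_closure (hcn : IsConeAt U p N ρ c) {x : E n} (hxU : x ∈ closure U)
    {s : ℝ} (hs : 0 < s) (hxb : x ∈ Metric.ball p (ρ / 6)) (hyb : x + s • N ∈ Metric.ball p (ρ / 6)) :
    x + s • N ∈ U ∧
      Metric.infDist x (frontier U) + c * s ≤ Metric.infDist (x + s • N) (frontier U) := by
  obtain ⟨hU, hp, hN, -, hc, hc1, hcone⟩ := id hcn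
  have hδ := hcn.slope_nonneg
  have hcδ : (1 - c) / (1 + c) * (1 + c) ≤ 1 - c := by rw [div_mul_cancel₀ _ (by linarith)]
  set d := Metric.infDist x (frontier U) with hd
  have hd0 : 0 ≤ d := Metric.infDist_nonneg
  have hdρ : d ≤ dist x p := Metric.infDist_le_dist_of_mem hp
  rw [Metric.mem_ball] at hxb hyb
  have hsρ : s < ρ / 3 := by
    have h1 : dist (x + s • N) x = s := by
      rw [dist_eq_norm, add_sub_cancel_left, norm_smul, hN, Real.norm_of_nonneg hs.le, mul_one]
    have := dist_triangle (x + s • N) p x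
    rw [dist_comm p x] at this
    linarith
  have hcs : c * s < s := by nlinarith
  have key : ∀ z, dist z (x + s • N) < d + c * s → z ∈ U := by
    intro z hz
    rw [dist_eq_norm] at hz
    obtain ⟨w₁, w₂, hw, hw1, hw1d, hw2⟩ := exists_split hd0 (mul_pos hc hs) hz
    have hz1 : x + w₁ ∈ closure U := by
      rcases hw1 with h | h
      · rw [h, add_zero]; exact hxU
      · have h2 : dist (x + w₁) x < d := by rwa [dist_eq_norm, add_sub_cancel_left]
        have hx : x ∈ U := by
          by_contra hx
          have : x ∈ frontier U := by
            rw [hU.frontier_eq]; exact ⟨hxU, hx⟩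
          have := Metric.infDist_zero_of_mem this
          linarith [dist_nonneg (x := x + w₁) (y := x)]
        exact subset_closure ((mem_iff_mem_of_dist_lt_infDist h2).2 hx)
    have hzeq : z = (x + w₁) + (s • N + w₂) := by
      have : z = x + s • N + (w₁ + w₂) := by rw [← hw]; abel
      rw [this]; abel
    have hdiff : z - (x + w₁) = s • N + w₂ := by rw [hzeq]; abel
    have hne := perturbation_ne_zero hN hc1 hs hw2
    refine hcone _ hz1 z ?_ ?_ ?_ ?_
    · rw [Metric.mem_ball]
      have h1 : dist (x + w₁) x ≤ d := by rwa [dist_eq_norm, add_sub_cancel_left]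
      have := dist_triangle (x + w₁) x p
      linarith [dist_nonneg (x := x) (y := p)]
    · rw [Metric.mem_ball]
      rw [← dist_eq_norm] at hz
      have := dist_triangle z (x + s • N) p
      linarith [dist_nonneg (x := x) (y := p)]
    · intro h; rw [← h] at hdiff; rw [sub_self] at hdiff; exact hne hdiff.symm
    · rw [hdiff]; exact cone_perturbation hN hδ hcδ hs hw2
  refine ⟨key _ (by rw [dist_self]; positivity), ?_⟩
  refine (Metric.le_infDist ⟨p, hp⟩).2 fun z hz => ?_
  by_contra! hlt
  rw [dist_comm] at hlt
  have hzU := key z hlt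
  rw [hU.frontier_eq] at hz
  exact hz.2 hzU

/-- The mirror argument: a frontier point `z` closer than `d + c s` to `x` would have a cone
containing some point within `d` of `x + s N`, and such a point lies outside `U`. -/
theorem infDist_add_le_of_notMem (hcn : IsConeAt U p N ρ c) {x : E n} {s : ℝ} (hs : 0 < s) (hyU : x + s • N ∉ U)
    (hxb : x ∈ Metric.ball p (ρ / 6)) (hyb : x + s • N ∈ Metric.ball p (ρ / 6)) :
    Metric.infDist (x + s • N) (frontier U) + c * s ≤ Metric.infDist x (frontier U) := by
  obtain ⟨hU, hp, hN, -, hc, hc1, hcone⟩ := id hcn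
  have hδ := hcn.slope_nonneg
  have hcδ : (1 - c) / (1 + c) * (1 + c) ≤ 1 - c := by rw [div_mul_cancel₀ _ (by linarith)]
  set d := Metric.infDist (x + s • N) (frontier U) with hd
  have hd0 : 0 ≤ d := Metric.infDist_nonneg
  have hdρ : d ≤ dist (x + s • N) p := Metric.infDist_le_dist_of_mem hp
  rw [Metric.mem_ball] at hxb hyb
  have hsρ : s < ρ / 3 := by
    have h1 : dist (x + s • N) x = s := by
      rw [dist_eq_norm, add_sub_cancel_left, norm_smul, hN, Real.norm_of_nonneg hs.le, mul_one]
    have := dist_triangle (x + s • N) p x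
    rw [dist_comm p x] at this
    linarith
  have hcs : c * s < s := by nlinarith
  refine (Metric.le_infDist ⟨p, hp⟩).2 fun z hzf => ?_
  by_contra! hz
  rw [dist_comm, dist_eq_norm] at hz
  rw [← norm_neg] at hz
  obtain ⟨w₁, w₂, hw, hw1, hw1d, hw2⟩ := exists_split hd0 (mul_pos hc hs) hz
  have hz1 : x + s • N - w₁ ∉ U := by
    rcases hw1 with h | h
    · rw [h, sub_zero]; exact hyU
    · have h2 : dist (x + s • N - w₁) (x + s • N) < d := by
        rw [dist_eq_norm, sub_sub_cancel_left, norm_neg]; exact h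
      exact fun h3 => hyU ((mem_iff_mem_of_dist_lt_infDist h2).1 h3)
  have hdiff : x + s • N - w₁ - z = s • N + w₂ := by
    have : w₂ = -(z - x) - w₁ := by rw [hw]; abel
    rw [this]; abel
  have hne := perturbation_ne_zero hN hc1 hs hw2
  refine hz1 (hcone z (frontier_subset_closure hzf) _ ?_ ?_ ?_ ?_)
  · rw [Metric.mem_ball]
    rw [norm_neg, ← dist_eq_norm] at hz
    have := dist_triangle z x p
    linarith [dist_nonneg (x := x) (y := p)]
  · rw [Metric.mem_ball]
    have h1 : dist (x + s • N - w₁) (x + s • N) ≤ d := by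
      rw [dist_eq_norm, sub_sub_cancel_left, norm_neg]; exact hw1d
    have := dist_triangle (x + s • N - w₁) (x + s • N) p
    linarith [dist_nonneg (x := x) (y := p)]
  · intro h; rw [← h, sub_self] at hdiff; exact hne hdiff.symm
  · rw [hdiff]; exact cone_perturbation hN hδ hcδ hs hw2

/-- The signed distance increases at rate at least `c` in the direction of the axis of the cone. -/
theorem signedDist_add_le (hcn : IsConeAt U p N ρ c) {x : E n} {s : ℝ} (hs : 0 < s) (hxb : x ∈ Metric.ball p (ρ / 6))
    (hyb : x + s • N ∈ Metric.ball p (ρ / 6)) :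
    signedDist U x + c * s ≤ signedDist U (x + s • N) := by
  have hU := hcn.isOpen
  have hc := hcn.c_pos
  by_cases hx : x ∈ U
  · obtain ⟨h1, h2⟩ := infDist_add_le_of_mem_closure hcn
      (subset_closure hx) hs hxb hyb
    rwa [signedDist_of_mem hx, signedDist_of_mem h1]
  by_cases hy : x + s • N ∈ U
  -- The segment crosses the frontier; the growth before and after the crossing, where the signed
  -- distance is zero, is added up.
  · obtain ⟨z, hzs, hzf⟩ := exists_mem_segment_frontier hy hx
    have hzb : z ∈ Metric.ball p (ρ / 6) := (convex_ball p (ρ / 6)).segment_subset hyb hxb hzs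
    rw [segment_symm, segment_eq_image'] at hzs
    obtain ⟨t, ⟨ht0, ht1⟩, rfl⟩ := hzs
    simp only [add_sub_cancel_left, smul_smul] at hzf hzb
    have hzU : x + (t * s) • N ∉ U := by
      rw [hU.frontier_eq] at hzf; exact hzf.2
    have e1 : signedDist U x + c * (t * s) ≤ 0 := by
      rcases ht0.eq_or_lt with h | h
      · rw [← h, signedDist_of_notMem hx]
        have : 0 ≤ Metric.infDist x (frontier U) := Metric.infDist_nonneg
        linarith
      · have := infDist_add_le_of_notMem hcn (mul_pos h hs) hzU hxb hzb
        rw [Metric.infDist_zero_of_mem hzf] at this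
        rw [signedDist_of_notMem hx]; linarith
    have hlt : t * s < s := by
      rcases ht1.eq_or_lt with h | h
      · rw [h, one_mul] at hzU; exact absurd hy hzU
      · nlinarith
    have heq : x + (t * s) • N + (s - t * s) • N = x + s • N := by
      rw [add_assoc, ← add_smul]; congr 2; ring
    have := (infDist_add_le_of_mem_closure hcn
      (frontier_subset_closure hzf) (sub_pos.2 hlt) hzb (by rwa [heq])).2
    rw [heq, Metric.infDist_zero_of_mem hzf] at this
    rw [signedDist_of_mem hy]
    linarith
  · have := infDist_add_le_of_notMem hcn hs hy hxb hyb
    rw [signedDist_of_notMem hx, signedDist_of_notMem hy]; linarith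

end Monotone

/-! ### Estimates for the hyperbolic tangent -/

theorem hasDerivAt_tanh (t : ℝ) : HasDerivAt Real.tanh (1 / Real.cosh t ^ 2) t := by
  have h : Real.tanh = fun t => Real.sinh t / Real.cosh t := by
    funext t; exact Real.tanh_eq_sinh_div_cosh t
  rw [h]
  have h1 : Real.cosh t * Real.cosh t - Real.sinh t * Real.sinh t = 1 := by
    nlinarith [Real.cosh_sq t]
  have h2 := (Real.hasDerivAt_sinh t).div (Real.hasDerivAt_cosh t) (Real.cosh_pos t).ne'
  rw [h1] at h2
  exact h2

theorem one_sub_tanh_sq (t : ℝ) : 1 - Real.tanh t ^ 2 = 1 / Real.cosh t ^ 2 := by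
  rw [Real.tanh_eq_sinh_div_cosh, div_pow, eq_div_iff (by have := Real.cosh_pos t; positivity),
    sub_mul, div_mul_cancel₀ _ (by have := Real.cosh_pos t; positivity), Real.cosh_sq]
  ring

theorem inv_cosh_sq_le_one (t : ℝ) : 1 / Real.cosh t ^ 2 ≤ 1 := by
  have := one_sub_tanh_sq t
  nlinarith [sq_nonneg (Real.tanh t)]

/-- Quadratic decay is enough: divided by `ε`, it leaves a factor `ε` at positive distance from the
interface. -/
theorem inv_cosh_sq_le {t : ℝ} (ht : t ≠ 0) : 1 / Real.cosh t ^ 2 ≤ 1 / t ^ 2 := by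
  have h0 : 0 < t ^ 2 := by positivity
  refine one_div_le_one_div_of_le h0 ?_
  rw [Real.cosh_sq]
  have : |t| ≤ |Real.sinh t| := by
    rw [Real.abs_sinh]
    exact Real.self_le_sinh_iff.2 (abs_nonneg t)
  have := sq_le_sq.2 this
  linarith

theorem lipschitzWith_tanh : LipschitzWith 1 Real.tanh := by
  refine lipschitzWith_of_nnnorm_deriv_le (fun t => (hasDerivAt_tanh t).differentiableAt)
    fun t => ?_
  rw [(hasDerivAt_tanh t).deriv, ← NNReal.coe_le_coe, coe_nnnorm, Real.norm_of_nonneg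
    (by have := Real.cosh_pos t; positivity)]
  exact inv_cosh_sq_le_one t

/-! ### The phase field and its gradient -/

section Phase

variable {n : ℕ} {U : Set (E n)} {ε : ℝ}

theorem phase_nonneg (x : E n) : 0 ≤ phase U ε x := by
  have := (abs_lt.1 (Real.abs_tanh_lt_one (signedDist U x / ε))).1
  unfold phase; linarith

theorem phase_le_one (x : E n) : phase U ε x ≤ 1 := by
  have := (abs_lt.1 (Real.abs_tanh_lt_one (signedDist U x / ε))).2
  unfold phase; linarith

theorem abs_phase_le_one (x : E n) : |phase U ε x| ≤ 1 :=
  abs_le.2 ⟨by linarith [phase_nonneg (U := U) (ε := ε) x], phase_le_one x⟩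

theorem exists_lipschitzWith_phase (U : Set (E n)) (ε : ℝ) :
    ∃ C, LipschitzWith C (phase U ε) := by
  have h1 : LipschitzWith (‖(1 / 2 : ℝ)‖₊ * (1 * (‖ε⁻¹‖₊ * 1)))
      (fun x => (1 / 2 : ℝ) * Real.tanh (ε⁻¹ * signedDist U x)) :=
    (lipschitzWith_smul (1 / 2 : ℝ)).comp
      (lipschitzWith_tanh.comp ((lipschitzWith_smul ε⁻¹).comp (signedDist_lipschitz U)))
  have h2 : phase U ε = fun x => (1 / 2 : ℝ) + (1 / 2 : ℝ) * Real.tanh (ε⁻¹ * signedDist U x) := by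
    funext x
    rw [phase, div_eq_inv_mul (signedDist U x)]
    ring
  rw [h2]
  exact ⟨_, (LipschitzWith.const (1 / 2 : ℝ)).add h1⟩

theorem continuous_phase (U : Set (E n)) (ε : ℝ) : Continuous (phase U ε) :=
  (exists_lipschitzWith_phase U ε).choose_spec.continuous

theorem norm_gradient_signedDist_le (x : E n) : ‖gradient (signedDist U) x‖ ≤ 1 := by
  unfold gradient
  rw [LinearIsometryEquiv.norm_map]
  simpa using norm_fderiv_le_of_lipschitz ℝ (signedDist_lipschitz U) (x₀ := x)

theorem gradient_phase (x : E n) (hx : DifferentiableAt ℝ (signedDist U) x) :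
    DifferentiableAt ℝ (phase U ε) x ∧
    gradient (phase U ε) x =
      (1 / 2 * (1 / Real.cosh (signedDist U x / ε) ^ 2 * ε⁻¹)) • gradient (signedDist U) x := by
  have h1 : HasDerivAt (fun t : ℝ => (1 / 2) * (1 + Real.tanh (t / ε)))
      (1 / 2 * (1 / Real.cosh (signedDist U x / ε) ^ 2 * ε⁻¹)) (signedDist U x) := by
    have h2 : HasDerivAt (fun t : ℝ => t / ε) ε⁻¹ (signedDist U x) := by
      simpa [div_eq_mul_inv] using (hasDerivAt_id (signedDist U x)).mul_const ε⁻¹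
    exact (((hasDerivAt_tanh _).comp (signedDist U x) h2).const_add 1).const_mul (1 / 2)
  have h3 := h1.comp_hasFDerivAt x hx.hasFDerivAt
  have h4 : HasFDerivAt (phase U ε)
      ((1 / 2 * (1 / Real.cosh (signedDist U x / ε) ^ 2 * ε⁻¹)) • fderiv ℝ (signedDist U) x) x := h3
  refine ⟨h4.differentiableAt, ?_⟩
  unfold gradient
  rw [h4.fderiv]
  simp

theorem ae_differentiableAt_signedDist (U : Set (E n)) :
    ∀ᵐ x : E n, DifferentiableAt ℝ (signedDist U) x :=
  (signedDist_lipschitz U).ae_differentiableAt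

/-- The prefactor `ε⁻¹` meets the decay `(ε / d)²`. Rademacher's theorem supplies differentiability
of the distance almost everywhere. -/
theorem norm_gradient_phase_le (hε : 0 < ε) {d : ℝ} (hd : 0 < d) :
    ∀ᵐ x : E n, d ≤ Metric.infDist x (frontier U) →
      ‖gradient (phase U ε) x‖ ≤ ε / (2 * d ^ 2) := by
  filter_upwards [ae_differentiableAt_signedDist U] with x hx hdx
  rw [(gradient_phase x hx).2, norm_smul]
  rw [← abs_signedDist] at hdx
  have hr : signedDist U x ≠ 0 := fun h => by rw [h, abs_zero] at hdx; linarith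
  have hcosh := Real.cosh_pos (signedDist U x / ε)
  have h1 := inv_cosh_sq_le (t := signedDist U x / ε) (div_ne_zero hr hε.ne')
  have h2 : 1 / (signedDist U x / ε) ^ 2 ≤ ε ^ 2 / d ^ 2 := by
    rw [div_pow, one_div_div]
    have : d ^ 2 ≤ signedDist U x ^ 2 := by
      rw [← sq_abs (signedDist U x)]; gcongr
    gcongr
  rw [Real.norm_of_nonneg (by positivity)]
  calc _ ≤ 1 / 2 * (ε ^ 2 / d ^ 2 * ε⁻¹) * 1 := by
        refine mul_le_mul ?_ (norm_gradient_signedDist_le x) (norm_nonneg _) (by positivity)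
        refine mul_le_mul_of_nonneg_left ?_ (by norm_num)
        exact mul_le_mul_of_nonneg_right (h1.trans h2) (by positivity)
    _ = ε / (2 * d ^ 2) := by field_simp

/-- A crude bound, meant for integrability and limits at fixed `ε`; uniform estimates come from the
cone comparison. -/
theorem norm_gradient_phase_le_inv (hε : 0 < ε) :
    ∀ᵐ x : E n, ‖gradient (phase U ε) x‖ ≤ ε⁻¹ := by
  filter_upwards [ae_differentiableAt_signedDist U] with x hx
  rw [(gradient_phase x hx).2, norm_smul]
  have hcosh := Real.cosh_pos (signedDist U x / ε)
  rw [Real.norm_of_nonneg (by positivity)]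
  calc _ ≤ 1 / 2 * (1 * ε⁻¹) * 1 := by
        gcongr
        · exact inv_cosh_sq_le_one _
        · exact norm_gradient_signedDist_le x
    _ ≤ ε⁻¹ := by have : 0 < ε⁻¹ := by positivity
                  linarith

theorem measurable_norm_gradient (f : E n → ℝ) : Measurable fun x => ‖gradient f x‖ := by
  have : (fun x => ‖gradient f x‖) = fun x => ‖fderiv ℝ f x‖ := by
    funext x; unfold gradient; rw [LinearIsometryEquiv.norm_map]
  rw [this]
  exact (measurable_fderiv ℝ f).norm

theorem tendsto_phase (hne : (frontier U).Nonempty) {x : E n} (hx : x ∉ frontier U)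
    {ι : Type*} {l : Filter ι} {e : ι → ℝ} (he : Tendsto e l (𝓝 0)) (hpos : ∀ k, 0 < e k) :
    Tendsto (fun k => phase U (e k) x) l (𝓝 (U.indicator (fun _ => 1) x)) := by
  have hd : 0 < Metric.infDist x (frontier U) :=
    (isClosed_frontier.notMem_iff_infDist_pos hne).1 hx
  set d := Metric.infDist x (frontier U) with hdd
  have hlim : Tendsto (fun k => (e k / d) ^ 2) l (𝓝 0) := by
    simpa using (he.div_const d).pow 2
  have key : ∀ k, |phase U (e k) x - U.indicator (fun _ => (1 : ℝ)) x| ≤ (e k / d) ^ 2 := by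
    intro k
    have hk := hpos k
    have h0 : 0 < d / e k := by positivity
    have h1 := inv_cosh_sq_le h0.ne'
    rw [← one_sub_tanh_sq, ← one_div_pow, one_div_div] at h1
    have h2 := abs_lt.1 (Real.abs_tanh_lt_one (d / e k))
    have h3 : 0 ≤ Real.tanh (d / e k) := by
      rw [Real.tanh_eq_sinh_div_cosh]
      exact div_nonneg (Real.sinh_nonneg_iff.2 h0.le) (Real.cosh_pos _).le
    -- For `0 ≤ τ < 1` one has `1 - τ ≤ 1 - τ²`, which is the square of the hyperbolic secant.
    have h4 : 1 - Real.tanh (d / e k) ≤ (e k / d) ^ 2 := by nlinarith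
    by_cases hxU : x ∈ U
    · rw [Set.indicator_of_mem hxU]
      unfold phase
      rw [signedDist_of_mem hxU, ← hdd, abs_le]
      constructor <;> linarith
    · rw [Set.indicator_of_notMem hxU]
      unfold phase
      rw [signedDist_of_notMem hxU, ← hdd, neg_div, Real.tanh_neg, abs_le]
      constructor <;> linarith
  rw [tendsto_iff_norm_sub_tendsto_zero]
  exact squeeze_zero (fun _ => norm_nonneg _) key hlim

theorem IsConeAt.le_inner_gradient_signedDist {p N : E n} {ρ c : ℝ} (h : IsConeAt U p N ρ c)
    {x : E n} (hx : x ∈ Metric.ball p (ρ / 6)) (hd : DifferentiableAt ℝ (signedDist U) x) :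
    c ≤ inner ℝ (gradient (signedDist U) x) N := by
  have h1 : HasDerivAt (fun t : ℝ => signedDist U (x + t • N))
      (fderiv ℝ (signedDist U) x N) 0 := by
    simpa [HasLineDerivAt] using hd.hasFDerivAt.hasLineDerivAt N
  have h2 := h1.tendsto_slope_zero_right
  have h3 : fderiv ℝ (signedDist U) x N = inner ℝ (gradient (signedDist U) x) N := by
    unfold gradient; rw [InnerProductSpace.toDual_symm_apply]
  rw [← h3]
  refine ge_of_tendsto h2 ?_
  have hcont : Tendsto (fun t : ℝ => x + t • N) (𝓝[>] 0) (𝓝 x) := by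
    have : Continuous fun t : ℝ => x + t • N := by fun_prop
    have := this.tendsto 0
    simp only [zero_smul, add_zero] at this
    exact this.mono_left nhdsWithin_le_nhds
  filter_upwards [self_mem_nhdsWithin, hcont (Metric.isOpen_ball.mem_nhds hx)] with t ht htb
  have ht' : (0 : ℝ) < t := ht
  have := signedDist_add_le h ht' hx htb
  simp only [zero_add, zero_smul, add_zero, smul_eq_mul]
  rw [inv_mul_eq_div, le_div_iff₀ ht']
  linarith

/-- The phase is an increasing function of the signed distance `r`. The upper bound is
Cauchy–Schwarz with `‖N‖ = 1`; the lower one follows from `∂_N r ≥ c ≥ c |∇r|`. -/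
theorem IsConeAt.ae_gradient_phase {p N : E n} {ρ c : ℝ} (h : IsConeAt U p N ρ c) (hε : 0 < ε) :
    ∀ᵐ x : E n, lineDeriv ℝ (phase U ε) x N ≤ ‖gradient (phase U ε) x‖ ∧
      (x ∈ Metric.ball p (ρ / 6) →
        c * ‖gradient (phase U ε) x‖ ≤ lineDeriv ℝ (phase U ε) x N) := by
  filter_upwards [ae_differentiableAt_signedDist U] with x hx
  obtain ⟨hd, hgrad⟩ := gradient_phase (ε := ε) x hx
  have h1 : lineDeriv ℝ (phase U ε) x N = inner ℝ (gradient (phase U ε) x) N := by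
    rw [hd.lineDeriv_eq_fderiv]
    unfold gradient
    rw [InnerProductSpace.toDual_symm_apply]
  rw [h1]
  constructor
  · have := real_inner_le_norm (gradient (phase U ε) x) N
    rwa [h.norm_eq, mul_one] at this
  · intro hxb
    have hcosh := Real.cosh_pos (signedDist U x / ε)
    have h2 := h.le_inner_gradient_signedDist hxb hx
    have h3 := norm_gradient_signedDist_le (U := U) x
    rw [hgrad, norm_smul, real_inner_smul_left, Real.norm_of_nonneg (by positivity)]
    have hA : 0 ≤ (1 / 2 * (1 / Real.cosh (signedDist U x / ε) ^ 2 * ε⁻¹)) := by positivity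
    have hc := h.c_pos
    have h4 : c * ‖gradient (signedDist U) x‖ ≤ inner ℝ (gradient (signedDist U) x) N := by
      nlinarith
    nlinarith

theorem integral_lineDeriv_phase_mul (U : Set (E n)) (ε : ℝ) {F : E n → ℝ} (hF : ContDiff ℝ 1 F)
    (hFc : HasCompactSupport F) (N : E n) :
    ∫ x, lineDeriv ℝ (phase U ε) x N * F x = - ∫ x, phase U ε x * fderiv ℝ F x N := by
  obtain ⟨C, hC⟩ := exists_lipschitzWith_phase U ε
  obtain ⟨D, hD⟩ := hF.lipschitzWith_of_hasCompactSupport hFc one_ne_zero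
  rw [hC.integral_lineDeriv_mul_eq hD hFc N, ← integral_neg]
  congr 1
  funext x
  rw [((hF.differentiable one_ne_zero) x).lineDeriv_eq_fderiv, map_neg]
  ring

theorem ae_norm_gradient_bound (hε : 0 < ε) :
    ∀ᵐ x : E n, ‖(‖gradient (phase U ε) x‖ : ℝ)‖ ≤ ε⁻¹ := by
  filter_upwards [norm_gradient_phase_le_inv (U := U) hε] with x hx
  rwa [norm_norm]

theorem integrable_mul_norm_gradient_phase (hε : 0 < ε) {F : E n → ℝ} {μ : Measure (E n)}
    (hμ : μ ≪ volume) (hF : Integrable F μ) :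
    Integrable (fun x => F x * ‖gradient (phase U ε) x‖) μ :=
  hF.mul_bdd (measurable_norm_gradient _).aestronglyMeasurable
    (hμ.ae_le (ae_norm_gradient_bound hε))

/-- Near a boundary point, the diffuse surface integral of `F ≥ 0` is comparable with the integral
of the phase field against the derivative of `F` in the direction of the axis of the cone. -/
theorem IsConeAt.integral_norm_gradient_phase {p N : E n} {ρ c : ℝ} (h : IsConeAt U p N ρ c)
    (hε : 0 < ε) {F : E n → ℝ} (hF : ContDiff ℝ 1 F) (hFc : HasCompactSupport F)
    (hF0 : ∀ x, 0 ≤ F x) (hFs : tsupport F ⊆ Metric.ball p (ρ / 6)) :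
    c * ∫ x, F x * ‖gradient (phase U ε) x‖ ≤ - ∫ x, phase U ε x * fderiv ℝ F x N ∧
      - ∫ x, phase U ε x * fderiv ℝ F x N ≤ ∫ x, F x * ‖gradient (phase U ε) x‖ := by
  obtain ⟨C, hC⟩ := exists_lipschitzWith_phase U ε
  rw [← integral_lineDeriv_phase_mul U ε hF hFc N, ← integral_const_mul]
  have hFi : Integrable F := hF.continuous.integrable_of_hasCompactSupport hFc
  have i1 := integrable_mul_norm_gradient_phase (U := U) hε (Measure.AbsolutelyContinuous.refl _) hFi
  have i2 : Integrable (fun x => lineDeriv ℝ (phase U ε) x N * F x) := by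
    refine hFi.bdd_mul (c := C * ‖N‖) (hC.memLp_lineDeriv (μ := volume) N).1 ?_
    exact .of_forall fun x => norm_lineDeriv_le_of_lipschitz ℝ hC
  constructor
  · refine integral_mono_ae (i1.const_mul c) i2 ?_
    filter_upwards [h.ae_gradient_phase hε] with x hx
    by_cases hxs : x ∈ tsupport F
    · have h1 := hx.2 (hFs hxs)
      have := mul_le_mul_of_nonneg_right h1 (hF0 x)
      linarith
    · simp [image_eq_zero_of_notMem_tsupport hxs]
  · refine integral_mono_ae i2 i1 ?_
    filter_upwards [h.ae_gradient_phase hε] with x hx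
    rw [mul_comm]
    exact mul_le_mul_of_nonneg_left hx.1 (hF0 x)

end Phase

/-! ### Lipschitz images and integrals of derivatives on a line -/

theorem euclideanHausdorffMeasure_image_le {X Y : Type*} [EMetricSpace X] [EMetricSpace Y]
    [MeasurableSpace X] [BorelSpace X] [MeasurableSpace Y] [BorelSpace Y] {K : NNReal} {f : X → Y}
    (hf : LipschitzWith K f) (d : ℕ) (s : Set X) :
    Measure.euclideanHausdorffMeasure d (f '' s) ≤
      (K : ENNReal) ^ d * Measure.euclideanHausdorffMeasure d s := by
  simp_rw [Measure.euclideanHausdorffMeasure_def, Measure.smul_apply, ENNReal.smul_def, smul_eq_mul]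
  have := hf.hausdorffMeasure_image_le (d := d) (Nat.cast_nonneg d) s
  rw [ENNReal.rpow_natCast] at this
  calc _ ≤ _ * ((K : ENNReal) ^ d * μH[(d : ℝ)] s) := by gcongr
    _ = _ := by ring

theorem setIntegral_deriv_of_mem_iff {f : ℝ → ℝ} (hf : ContDiff ℝ 1 f) (hfc : HasCompactSupport f)
    {S : Set ℝ} {a : ℝ} (hS : ∀ s ∈ tsupport f, s ∈ S ↔ a < s) :
    ∫ s, S.indicator (deriv f) s = - f a := by
  rw [← hfc.integral_Ioi_deriv_eq hf a, ← integral_indicator measurableSet_Ioi]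
  congr 1
  funext s
  by_cases hs : s ∈ tsupport f
  · by_cases h : a < s
    · rw [Set.indicator_of_mem ((hS s hs).2 h), Set.indicator_of_mem (Set.mem_Ioi.2 h)]
    · rw [Set.indicator_of_notMem (fun h' => h ((hS s hs).1 h')), Set.indicator_of_notMem (fun h' => h (Set.mem_Ioi.1 h'))]
  · have : deriv f s = 0 := by
      by_contra h
      exact hs (support_deriv_subset h)
    simp [Set.indicator_apply, this]

/-- On the support, `S` is everything or nothing, so it can be replaced by a half-line whose
endpoint lies below or above the support, where `f` vanishes. -/
theorem setIntegral_deriv_of_mem_of_mem {f : ℝ → ℝ} (hf : ContDiff ℝ 1 f)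
    (hfc : HasCompactSupport f) {S : Set ℝ}
    (hS : ∀ s ∈ tsupport f, ∀ t ∈ tsupport f, s ∈ S → t ∈ S) :
    ∫ s, S.indicator (deriv f) s = 0 := by
  obtain ⟨b, hb⟩ := hfc.isCompact.bddAbove
  obtain ⟨a, ha⟩ := hfc.isCompact.bddBelow
  have hout : ∀ t, t ∉ tsupport f → f t = 0 := fun t => image_eq_zero_of_notMem_tsupport
  by_cases h : ∃ s ∈ tsupport f, s ∈ S
  · obtain ⟨s, hs, hsS⟩ := h
    rw [setIntegral_deriv_of_mem_iff hf hfc (a := a - 1), hout, neg_zero]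
    · intro h
      linarith [ha h]
    · intro t ht
      exact ⟨fun _ => by linarith [ha ht], fun _ => hS s hs t ht hsS⟩
  · push Not at h
    rw [setIntegral_deriv_of_mem_iff hf hfc (a := b + 1), hout, neg_zero]
    · intro h
      linarith [hb h]
    · intro t ht
      exact ⟨fun h' => absurd h' (h t ht), fun h' => by linarith [hb ht]⟩

/-! ### Orthogonal coordinates along the cone axis -/

section Coordinates

variable {n : ℕ} {N : E n}

/-- The hyperplane orthogonal to `N`. -/
noncomputable abbrev hyperplane (N : E n) : Submodule ℝ (E n) := (Submodule.span ℝ {N})ᗮ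

/-- Coordinates along `N` and along the hyperplane orthogonal to `N`. -/
noncomputable def lineCoord (N : E n) (q : ℝ × hyperplane N) : E n := q.2 + q.1 • N

theorem measurableEmbedding_lineCoord_measurePreserving (hN : ‖N‖ = 1) :
    MeasurableEmbedding (lineCoord N) ∧
      MeasurePreserving (lineCoord N) (volume.prod volume) volume := by
  let e₁ : ℝ ≃ₗᵢ[ℝ] (Submodule.span ℝ {N}) := LinearIsometryEquiv.toSpanUnitSingleton N hN
  let m₁ : ℝ ≃ᵐ (Submodule.span ℝ {N}) := e₁.toHomeomorph.toMeasurableEquiv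
  let m₂ : ℝ × hyperplane N ≃ᵐ (Submodule.span ℝ {N}) × hyperplane N :=
    m₁.prodCongr (MeasurableEquiv.refl _)
  let m₃ : ℝ × hyperplane N ≃ᵐ E n :=
    m₂.trans ((Submodule.span ℝ {N}).measurableEquivProd (0 : E n)).symm
  have hm : lineCoord N = m₃ := by
    funext q
    simp only [m₃, MeasurableEquiv.trans_apply, Submodule.measurableEquivProd_symm_apply,
      vadd_eq_add, add_zero, lineCoord]
    rw [add_comm]
    rfl
  rw [hm]
  refine ⟨m₃.measurableEmbedding, ?_⟩
  have h1 : MeasurePreserving m₂ (volume.prod volume) (volume.prod volume) :=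
    (e₁.measurePreserving).prod (MeasurePreserving.id _)
  have h2 := ((Submodule.span ℝ {N}).measurePreserving_measurableEquivProd (0 : E n)).symm
  have h3 : (Measure.euclideanHausdorffMeasure (Module.finrank ℝ (E n)) : Measure (E n)) = volume :=
    InnerProductSpace.euclideanHausdorffMeasure_eq_volume
  rw [h3] at h2
  exact h2.comp h1

/-- The orthogonal projection onto the hyperplane orthogonal to `N`. -/
noncomputable def hyperplaneProj (N : E n) : E n →L[ℝ] hyperplane N :=
  (hyperplane N).orthogonalProjectionOnto

theorem hyperplaneProj_add (hN : ‖N‖ = 1) (x : E n) :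
    (hyperplaneProj N x : E n) + inner ℝ N x • N = x := by
  have h1 := Submodule.starProjection_add_starProjection_orthogonal (K := Submodule.span ℝ {N}) x
  have h2 := Submodule.starProjection_unit_singleton ℝ hN x
  rw [h2] at h1
  rw [add_comm]
  exact h1

theorem hyperplaneProj_lineCoord (s : ℝ) (y : hyperplane N) :
    hyperplaneProj N (lineCoord N (s, y)) = y := by
  unfold lineCoord hyperplaneProj
  rw [map_add, map_smul, Submodule.orthogonalProjectionOnto_orthogonalComplement_singleton_eq_zero,
    smul_zero, add_zero, Submodule.orthogonalProjectionOnto_mem_subspace_eq_self]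

theorem lipschitzWith_hyperplaneProj (N : E n) : LipschitzWith 1 (hyperplaneProj N) :=
  Submodule.lipschitzWith_orthogonalProjectionOnto _

/-- The hyperplane has dimension `n - 1`, so the normalization of the Hausdorff measure makes it
Lebesgue measure there. This links the surface measure to Fubini's theorem. -/
theorem hausdorffMeasure_hyperplane (hN : ‖N‖ = 1) :
    (Measure.euclideanHausdorffMeasure (n - 1) : Measure (hyperplane N)) = volume := by
  have hr : Module.finrank ℝ (hyperplane N) = n - 1 := by
    have h1 := (Submodule.span ℝ {N}).finrank_add_finrank_orthogonal
    have h2 : Module.finrank ℝ (Submodule.span ℝ {N}) = 1 :=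
      finrank_span_singleton (by rintro rfl; simp at hN)
    rw [h2, finrank_euclideanSpace_fin] at h1
    have h3 : 1 + Module.finrank ℝ (hyperplane N) = n := h1
    omega
  rw [← hr]
  exact InnerProductSpace.euclideanHausdorffMeasure_eq_volume

/-- The surface `{y + ψ(y) N}` over the hyperplane orthogonal to `N`. -/
noncomputable def graphMap (N : E n) (ψ : hyperplane N → ℝ) (y : hyperplane N) : E n := lineCoord N (ψ y, y)

end Coordinates

/-! ### The boundary as a Lipschitz graph, and the surface integral -/

section Graph

variable {n : ℕ} {U : Set (E n)} {p N : E n} {ρ c : ℝ}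

/-- The boundary of `U` near `p` lies in a Lipschitz graph over the hyperplane orthogonal to the
axis of the cone. -/
theorem IsConeAt.exists_graph (h : IsConeAt U p N ρ c) :
    ∃ ψ : hyperplane N → ℝ, LipschitzWith (Real.toNNReal c⁻¹) (graphMap N ψ) ∧
      ∀ x ∈ frontier U ∩ Metric.ball p ρ, graphMap N ψ (hyperplaneProj N x) = x := by
  obtain ⟨hU, hp, hN, hρ, hc, hc1, hcone⟩ := id h
  set δ := (1 - c) / (1 + c) with hδ
  have hδ0 : 0 ≤ δ := h.slope_nonneg
  have hδ1 : δ ≤ 1 - c := h.slope_le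
  set A := frontier U ∩ Metric.ball p ρ with hA
  -- Otherwise `x'` would lie in the cone at `x`, hence in the open set `U`, which is disjoint from
  -- its frontier.
  have hflat1 : ∀ x ∈ A, ∀ x' ∈ A, inner ℝ N (x' - x) ≤ δ * ‖x' - x‖ := by
    intro x hx x' hx'
    by_contra! hlt
    have hne : x ≠ x' := by rintro rfl; simp at hlt
    have := hcone x (frontier_subset_closure hx.1) x' hx.2 hx'.2 hne hlt.le
    have h2 := hx'.1
    rw [hU.frontier_eq] at h2
    exact h2.2 this
  have hflat : ∀ x ∈ A, ∀ x' ∈ A, |inner ℝ N x - inner ℝ N x'| ≤ δ * ‖x - x'‖ := by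
    intro x hx x' hx'
    rw [abs_le]
    have h1 := hflat1 x hx x' hx'
    have h2 := hflat1 x' hx' x hx
    rw [norm_sub_rev, inner_sub_right] at h1
    rw [inner_sub_right] at h2
    constructor <;> linarith
  have hdist : ∀ x ∈ A, ∀ x' ∈ A, ‖x - x'‖ ≤ (1 - δ)⁻¹ * ‖hyperplaneProj N x - hyperplaneProj N x'‖ := by
    intro x hx x' hx'
    have h1 : x - x' = ((hyperplaneProj N x - hyperplaneProj N x' : hyperplane N) : E n)
        + (inner ℝ N x - inner ℝ N x') • N := by
      conv_lhs => rw [← hyperplaneProj_add hN x, ← hyperplaneProj_add hN x']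
      rw [sub_smul]; push_cast; abel
    have h2 : ‖x - x'‖ ≤ ‖hyperplaneProj N x - hyperplaneProj N x'‖ + δ * ‖x - x'‖ := by
      conv_lhs => rw [h1]
      refine (norm_add_le _ _).trans ?_
      rw [norm_smul, hN, mul_one, Submodule.coe_norm, Real.norm_eq_abs]
      have := hflat x hx x' hx'
      linarith
    have h3 : 0 < 1 - δ := by linarith
    rw [inv_mul_eq_div, le_div_iff₀ h3]
    linarith
  let inv : hyperplane N → E n := Function.invFunOn (hyperplaneProj N) A
  have hinv : ∀ y ∈ hyperplaneProj N '' A, inv y ∈ A ∧ hyperplaneProj N (inv y) = y :=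
    fun y hy => ⟨Function.invFunOn_mem hy, Function.invFunOn_eq hy⟩
  have hd1 : 0 < 1 - δ := by linarith
  have hL : LipschitzOnWith (Real.toNNReal (δ * (1 - δ)⁻¹)) (fun y => inner ℝ N (inv y))
      (hyperplaneProj N '' A) := by
    refine LipschitzOnWith.of_dist_le_mul fun y hy y' hy' => ?_
    rw [Real.coe_toNNReal _ (by positivity), Real.dist_eq, dist_eq_norm]
    have h1 := hflat _ (hinv y hy).1 _ (hinv y' hy').1
    have h2 := hdist _ (hinv y hy).1 _ (hinv y' hy').1
    rw [(hinv y hy).2, (hinv y' hy').2] at h2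
    calc _ ≤ _ := h1
      _ ≤ δ * ((1 - δ)⁻¹ * ‖y - y'‖) := by gcongr
      _ = _ := by ring
  -- The height is so far defined only on the projection of the boundary piece; the Lipschitz
  -- extension gives a graph over the whole hyperplane.
  obtain ⟨ψ, hψ, hψeq⟩ := hL.extend_real
  refine ⟨ψ, ?_, ?_⟩
  · refine LipschitzWith.of_dist_le_mul fun y y' => ?_
    have h1 := hψ.dist_le_mul y y'
    rw [Real.coe_toNNReal _ (by positivity), Real.dist_eq, dist_eq_norm] at h1
    rw [Real.coe_toNNReal _ (by positivity), dist_eq_norm, dist_eq_norm]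
    have h2 : graphMap N ψ y - graphMap N ψ y' = ((y - y' : hyperplane N) : E n)
        + (ψ y - ψ y') • N := by
      simp only [graphMap, lineCoord]
      rw [sub_smul]; push_cast; abel
    rw [h2]
    refine (norm_add_le _ _).trans ?_
    rw [norm_smul, hN, mul_one, Real.norm_eq_abs, ← Submodule.coe_norm]
    -- The left side equals `(1 - δ)⁻¹`, and `δ ≤ 1 - c`.
    have h3 : 1 + δ * (1 - δ)⁻¹ ≤ c⁻¹ := by
      have : 1 + δ * (1 - δ)⁻¹ = (1 - δ)⁻¹ := by field_simp; ring
      rw [this]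
      exact inv_anti₀ hc (by linarith)
    calc _ ≤ ‖y - y'‖ + δ * (1 - δ)⁻¹ * ‖y - y'‖ := by gcongr
      _ = (1 + δ * (1 - δ)⁻¹) * ‖y - y'‖ := by ring
      _ ≤ _ := by gcongr
  · intro x hx
    have hxA : hyperplaneProj N x ∈ hyperplaneProj N '' A := ⟨x, hx, rfl⟩
    have h1 := hinv _ hxA
    have h2 : inv (hyperplaneProj N x) = x := by
      have := hdist _ h1.1 _ hx
      rw [h1.2, sub_self, norm_zero, mul_zero] at this
      exact sub_eq_zero.1 (norm_le_zero_iff.1 this)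
    have h3 := hψeq hxA
    simp only [h2] at h3
    rw [graphMap, lineCoord, ← h3]
    exact hyperplaneProj_add hN x

theorem lineCoord_mem_segment {s t : ℝ} {y : hyperplane N} {z : E n}
    (hz : z ∈ segment ℝ (lineCoord N (s, y)) (lineCoord N (t, y))) :
    ∃ a, z = lineCoord N (a, y) := by
  obtain ⟨a, b, -, -, hab, rfl⟩ := hz
  refine ⟨a * s + b * t, ?_⟩
  simp only [lineCoord, smul_add, smul_smul, add_smul]
  rw [add_add_add_comm, ← add_smul, hab, one_smul]

/-- The integral over `U` of the derivative of `F` along a line parallel to the axis of the cone. -/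
theorem IsConeAt.integral_line (h : IsConeAt U p N ρ c) {ψ : hyperplane N → ℝ}
    (hψ : ∀ x ∈ frontier U ∩ Metric.ball p ρ, graphMap N ψ (hyperplaneProj N x) = x)
    {F : E n → ℝ} (hF : ContDiff ℝ 1 F) (hFc : HasCompactSupport F)
    (hFs : tsupport F ⊆ Metric.ball p ρ) (y : hyperplane N) :
    ∫ s, U.indicator (fun x => fderiv ℝ F x N) (lineCoord N (s, y)) =
      - (frontier U ∩ Metric.ball p ρ).indicator F (graphMap N ψ y) := by
  obtain ⟨hU, hp, hN, hρ, hc, hc1, hcone⟩ := id h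
  have hδ1 : (1 - c) / (1 + c) ≤ 1 := h.slope_le.trans (by linarith)
  set A := frontier U ∩ Metric.ball p ρ with hA
  let f : ℝ → ℝ := fun s => F (lineCoord N (s, y))
  have hline : ContDiff ℝ 1 (fun s : ℝ => lineCoord N (s, y)) := by
    have h1 : ContDiff ℝ 1 (fun s : ℝ => s • N) := contDiff_id.smul contDiff_const
    have h2 : ContDiff ℝ 1 (fun s : ℝ => (y : E n) + s • N) := contDiff_const.add h1
    exact h2
  have hiso : Isometry (fun s : ℝ => lineCoord N (s, y)) := by
    refine Isometry.of_dist_eq fun s t => ?_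
    simp only [lineCoord]
    rw [dist_eq_norm, add_sub_add_left_eq_sub, ← sub_smul, norm_smul, hN, mul_one, Real.dist_eq,
      Real.norm_eq_abs]
  have hf : ContDiff ℝ 1 f := hF.comp hline
  have hfc : HasCompactSupport f := hFc.comp_isClosedEmbedding hiso.isClosedEmbedding
  have hfs : ∀ s ∈ tsupport f, lineCoord N (s, y) ∈ Metric.ball p ρ := fun s hs =>
    hFs (tsupport_comp_subset_preimage F hline.continuous hs)
  have hderiv : ∀ s, deriv f s = fderiv ℝ F (lineCoord N (s, y)) N := fun s => by
    have h1 : HasDerivAt (fun s : ℝ => lineCoord N (s, y)) N s := by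
      unfold lineCoord
      simpa using ((hasDerivAt_id s).smul_const N).const_add (y : E n)
    exact ((hF.differentiable one_ne_zero _).hasFDerivAt.comp_hasDerivAt s h1).deriv
  let S : Set ℝ := {s | lineCoord N (s, y) ∈ U}
  have hint : (fun s => U.indicator (fun x => fderiv ℝ F x N) (lineCoord N (s, y))) =
      S.indicator (deriv f) := by
    classical
    funext s
    simp only [Set.indicator_apply, hderiv]
    rfl
  rw [hint]
  -- Moving along the axis stays inside every cone, so within the ball a line that has touched the
  -- closure of `U` remains in `U`.
  have hmono : ∀ s t, s < t → lineCoord N (s, y) ∈ closure U → lineCoord N (s, y) ∈ Metric.ball p ρ →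
      lineCoord N (t, y) ∈ Metric.ball p ρ → lineCoord N (t, y) ∈ U := by
    intro s t hst hs hsb htb
    have hd : lineCoord N (t, y) - lineCoord N (s, y) = (t - s) • N := by
      simp only [lineCoord]; rw [sub_smul]; abel
    refine hcone _ hs _ hsb htb (fun he => ?_) ?_
    · exact hst.ne (hiso.injective he)
    · rw [hd, norm_smul, hN, inner_smul_right, real_inner_self_eq_norm_sq, hN, mul_one,
        Real.norm_of_nonneg (by linarith)]
      nlinarith
  -- If the graph point is a genuine boundary point, the line enters `U` exactly there. If not, the
  -- line meets no frontier inside the ball, and the support of `f` lies on one side.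
  by_cases hy : graphMap N ψ y ∈ A
  · rw [Set.indicator_of_mem hy]
    refine setIntegral_deriv_of_mem_iff hf hfc fun s hs => ?_
    have hsb := hfs s hs
    have hnot : lineCoord N (ψ y, y) ∉ U := by
      have := hy.1; rw [hU.frontier_eq] at this; exact this.2
    constructor
    · intro hsU
      by_contra! hle
      rcases hle.eq_or_lt with he | hlt
      · subst he; exact hnot hsU
      · exact hnot (hmono _ _ hlt (subset_closure hsU) hsb hy.2)
    · intro hlt
      exact hmono _ _ hlt (frontier_subset_closure hy.1) hy.2 hsb
  · rw [Set.indicator_of_notMem hy, neg_zero]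
    refine setIntegral_deriv_of_mem_of_mem hf hfc fun s hs t ht hsS => ?_
    by_contra htS
    obtain ⟨z, hz, hzf⟩ := exists_mem_segment_frontier (U := U) hsS htS
    have hzb := (convex_ball p ρ).segment_subset (hfs s hs) (hfs t ht) hz
    obtain ⟨a, rfl⟩ := lineCoord_mem_segment hz
    have := hψ _ ⟨hzf, hzb⟩
    rw [hyperplaneProj_lineCoord] at this
    exact hy (this ▸ ⟨hzf, hzb⟩)

/-- Comparison, near a boundary point, of the surface integral with the volume integral of a
derivative. -/
theorem IsConeAt.lintegral_surface (h : IsConeAt U p N ρ c)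
    {F : E n → ℝ} (hF : ContDiff ℝ 1 F) (hFc : HasCompactSupport F) (hF0 : ∀ x, 0 ≤ F x)
    (hFs : tsupport F ⊆ Metric.ball p ρ) :
    0 ≤ - ∫ x in U, fderiv ℝ F x N ∧
    ENNReal.ofReal (- ∫ x in U, fderiv ℝ F x N) ≤ ∫⁻ x, ENNReal.ofReal (F x) ∂surfaceMeasure U ∧
    ∫⁻ x, ENNReal.ofReal (F x) ∂surfaceMeasure U ≤
      ENNReal.ofReal (c⁻¹ ^ (n - 1)) * ENNReal.ofReal (- ∫ x in U, fderiv ℝ F x N) := by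
  obtain ⟨ψ, hlip, hψ⟩ := h.exists_graph
  obtain ⟨hemb, hmp⟩ := measurableEmbedding_lineCoord_measurePreserving h.norm_eq
  set A := frontier U ∩ Metric.ball p ρ with hA
  have hAm : MeasurableSet A := isClosed_frontier.measurableSet.inter measurableSet_ball
  set σ := graphMap N ψ with hσ
  have hσm : Measurable σ := hlip.continuous.measurable
  have hfd : Continuous fun x => fderiv ℝ F x N :=
    (hF.continuous_fderiv one_ne_zero).clm_apply continuous_const
  have hint : Integrable (U.indicator fun x => fderiv ℝ F x N) :=
    (hfd.integrable_of_hasCompactSupport (hFc.fderiv_apply ℝ N)).indicator h.isOpen.measurableSet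
  have hint2 : Integrable (fun q => U.indicator (fun x => fderiv ℝ F x N) (lineCoord N q))
      (volume.prod volume) := (hmp.integrable_comp_emb hemb).2 hint
  -- Fubini: each line contributes the value of `F` at its entry point, or zero if there is none.
  have e1 : - ∫ x in U, fderiv ℝ F x N = ∫ y, A.indicator F (σ y) := by
    rw [← integral_indicator h.isOpen.measurableSet, ← hmp.integral_comp hemb,
      integral_prod_symm _ hint2, ← integral_neg]
    congr 1
    funext y
    rw [h.integral_line hψ hF hFc hFs y, neg_neg]
  have hi3 : Integrable (fun y => A.indicator F (σ y)) := by
    have := hint2.integral_prod_right.neg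
    refine this.congr (.of_forall fun y => ?_)
    simp only [Pi.neg_apply]
    rw [h.integral_line hψ hF hFc hFs y, neg_neg]
  have hnn : ∀ y, 0 ≤ A.indicator F (σ y) := fun y => Set.indicator_nonneg (fun x _ => hF0 x) _
  have hE : ENNReal.ofReal (- ∫ x in U, fderiv ℝ F x N) =
      ∫⁻ x, ENNReal.ofReal (F x) ∂((volume.restrict (σ ⁻¹' A)).map σ) := by
    rw [e1, ofReal_integral_eq_lintegral_ofReal hi3 (.of_forall hnn),
      lintegral_map (hF.continuous.measurable.ennreal_ofReal) hσm,
      ← lintegral_indicator (hσm hAm)]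
    congr 1
    funext y
    by_cases hy : σ y ∈ A
    · rw [Set.indicator_of_mem hy, Set.indicator_of_mem (by exact hy)]
    · rw [Set.indicator_of_notMem hy, Set.indicator_of_notMem (by exact hy), ENNReal.ofReal_zero]
  have hS : ∫⁻ x, ENNReal.ofReal (F x) ∂surfaceMeasure U =
      ∫⁻ x, ENNReal.ofReal (F x) ∂((Measure.euclideanHausdorffMeasure (n - 1)).restrict A) := by
    rw [surfaceMeasure, hA, ← lintegral_indicator isClosed_frontier.measurableSet,
      ← lintegral_indicator hAm]
    congr 1
    funext x
    by_cases hx : x ∈ Metric.ball p ρ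
    · by_cases hxf : x ∈ frontier U
      · rw [Set.indicator_of_mem hxf, Set.indicator_of_mem (show x ∈ frontier U ∩ Metric.ball p ρ from ⟨hxf, hx⟩)]
      · rw [Set.indicator_of_notMem hxf, Set.indicator_of_notMem fun h => hxf h.1]
    · have : F x = 0 := image_eq_zero_of_notMem_tsupport fun h => hx (hFs h)
      classical
      simp [Set.indicator_apply, this]
  refine ⟨by rw [e1]; exact integral_nonneg hnn, ?_, ?_⟩
  -- Orthogonal projection is 1-Lipschitz, so the pushed-forward Lebesgue measure is at most the
  -- surface measure.
  · rw [hE, hS]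
    refine lintegral_mono' (Measure.le_iff.2 fun S hSm => ?_) le_rfl
    rw [Measure.map_apply hσm hSm, Measure.restrict_apply (hσm hSm), Measure.restrict_apply hSm,
      ← hausdorffMeasure_hyperplane h.norm_eq]
    have hsub : σ ⁻¹' S ∩ σ ⁻¹' A ⊆ hyperplaneProj N '' (S ∩ A) := fun y hy =>
      ⟨σ y, hy, hyperplaneProj_lineCoord _ _⟩
    refine (measure_mono hsub).trans ?_
    have := euclideanHausdorffMeasure_image_le (lipschitzWith_hyperplaneProj N) (n - 1) (S ∩ A)
    simpa using this
  -- Conversely the graph map has Lipschitz constant `c⁻¹`, which costs `c⁻¹ ^ (n - 1)` in dimension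
  -- `n - 1`.
  · have hle : (Measure.euclideanHausdorffMeasure (n - 1)).restrict A ≤
        ENNReal.ofReal (c⁻¹ ^ (n - 1)) • ((volume.restrict (σ ⁻¹' A)).map σ) := by
      refine Measure.le_iff.2 fun S hSm => ?_
      rw [Measure.smul_apply, Measure.map_apply hσm hSm, Measure.restrict_apply (hσm hSm),
        Measure.restrict_apply hSm, ← hausdorffMeasure_hyperplane h.norm_eq, smul_eq_mul]
      have hsub : S ∩ A ⊆ σ '' (σ ⁻¹' S ∩ σ ⁻¹' A) := fun x hx =>
        ⟨hyperplaneProj N x, by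
          rw [Set.mem_inter_iff, Set.mem_preimage, Set.mem_preimage, hψ x hx.2]; exact hx,
          hψ x hx.2⟩
      refine (measure_mono hsub).trans ?_
      refine (euclideanHausdorffMeasure_image_le hlip (n - 1) _).trans_eq ?_
      rw [ENNReal.ofReal_pow (by have := h.c_pos; positivity)]
      rfl
    rw [hE, hS, ← smul_eq_mul, ← lintegral_smul_measure]
    exact lintegral_mono' hle le_rfl

end Graph

/-! ### Partition of unity near the boundary -/

/-- A finite smooth partition of unity near the boundary of `U`, subordinate to `O` and to balls in
which `U` satisfies a cone condition. -/
structure BoundaryPartition {n : ℕ} (U O : Set (E n)) (c : ℝ) where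
  ι : Type
  fintype : Fintype ι
  p : ι → E n
  N : ι → E n
  ρ : ι → ℝ
  χ : ι → E n → ℝ
  d : ℝ
  isConeAt : ∀ i, IsConeAt U (p i) (N i) (ρ i) c
  contDiff : ∀ i, ContDiff ℝ ∞ (χ i)
  compact : ∀ i, HasCompactSupport (χ i)
  nonneg : ∀ i x, 0 ≤ χ i x
  tsupport_subset : ∀ i, tsupport (χ i) ⊆ O
  tsupport_subset_ball : ∀ i, tsupport (χ i) ⊆ Metric.ball (p i) (ρ i / 6)
  d_pos : 0 < d
  sum_le_one : ∀ x, ∑ i, χ i x ≤ 1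
  sum_eq_one : ∀ x, Metric.infDist x (frontier U) ≤ d → ∑ i, χ i x = 1

attribute [instance] BoundaryPartition.fintype

-- Finitely many balls cover the compact frontier together with a closed thickening of some radius
-- `d`. Imposing sum one on the thickening, and not just on the frontier, is what later leaves only
-- points at distance at least `d`.
open scoped Manifold in
theorem exists_boundaryPartition {n : ℕ} {U O : Set (E n)} {k : ℕ∞} (hk : 1 ≤ k)
    (hU : HasCkBoundary k U) (hUo : IsOpen U) (hcpt : IsCompact (frontier U))
    (hne : (frontier U).Nonempty) (hO : IsOpen O)
    (hUO : frontier U ⊆ O) {c : ℝ} (hc : 0 < c) (hc1 : c < 1) :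
    Nonempty (BoundaryPartition U O c) := by
  have hex : ∀ p : frontier U, ∃ (N : E n) (ρ : ℝ), IsConeAt U p N ρ c := fun p =>
    hU.exists_isConeAt hk hUo p.2 hc hc1
  choose N ρ hcone using hex
  let V : frontier U → Set (E n) := fun p => Metric.ball (p : E n) (ρ p / 6) ∩ O
  have hVo : ∀ p, IsOpen (V p) := fun p => Metric.isOpen_ball.inter hO
  obtain ⟨t, ht⟩ := hcpt.elim_finite_subcover V hVo (fun x hx => Set.mem_iUnion.2
    ⟨⟨x, hx⟩, Metric.mem_ball_self (by have := (hcone ⟨x, hx⟩).radius_pos; positivity), hUO hx⟩)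
  obtain ⟨d, hd, hdsub⟩ := hcpt.exists_cthickening_subset_open
    (isOpen_biUnion fun p (_ : p ∈ t) => hVo p) ht
  obtain ⟨f, hf⟩ := SmoothPartitionOfUnity.exists_isSubordinate 𝓘(ℝ, E n)
    (s := Metric.cthickening d (frontier U)) Metric.isClosed_cthickening (fun i : t => V i)
    (fun i => hVo i) (fun x hx => by
      obtain ⟨p, hp, hxp⟩ := Set.mem_iUnion₂.1 (hdsub hx)
      exact Set.mem_iUnion.2 ⟨⟨p, hp⟩, hxp⟩)
  refine ⟨⟨t, inferInstance, fun i => i.1, fun i => N i, fun i => ρ i, fun i => f i, d,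
    fun i => hcone i, fun i => (f i).contMDiff.contDiff, fun i => ?_, fun i x => f.nonneg i x,
    fun i => (hf i).trans Set.inter_subset_right, fun i => (hf i).trans Set.inter_subset_left, hd,
    fun x => ?_, fun x hx => ?_⟩⟩
  · exact Metric.isCompact_of_isClosed_isBounded (isClosed_tsupport _)
      (Metric.isBounded_ball.subset ((hf i).trans Set.inter_subset_left))
  · rw [← finsum_eq_sum_of_fintype]
    exact f.sum_le_one x
  · rw [← finsum_eq_sum_of_fintype]
    refine f.sum_eq_one ?_
    rw [Metric.mem_cthickening_iff,
      ENNReal.le_ofReal_iff_toReal_le (Metric.infEDist_ne_top hne) hd.le]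
    exact hx

namespace BoundaryPartition

variable {n : ℕ} {U O : Set (E n)} {c : ℝ} (P : BoundaryPartition U O c)

theorem ball_subset (i : P.ι) : tsupport (P.χ i) ⊆ Metric.ball (P.p i) (P.ρ i) :=
  (P.tsupport_subset_ball i).trans
    (Metric.ball_subset_ball (by have := (P.isConeAt i).radius_pos; linarith))

/-- The sum of the partition functions. -/
def cutoff (x : E n) : ℝ := ∑ i, P.χ i x

theorem cutoff_nonneg (x : E n) : 0 ≤ P.cutoff x := Finset.sum_nonneg fun i _ => P.nonneg i x

theorem cutoff_le_one (x : E n) : P.cutoff x ≤ 1 := P.sum_le_one x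

theorem χ_le_one (i : P.ι) (x : E n) : P.χ i x ≤ 1 :=
  (Finset.single_le_sum (fun j _ => P.nonneg j x) (Finset.mem_univ i)).trans (P.sum_le_one x)

theorem continuous_cutoff : Continuous P.cutoff :=
  continuous_finsetSum _ fun i _ => (P.contDiff i).continuous

theorem cutoff_eq_one_of_mem_frontier {x : E n} (hx : x ∈ frontier U) : P.cutoff x = 1 :=
  P.sum_eq_one x (by rw [Metric.infDist_zero_of_mem hx]; exact P.d_pos.le)

end BoundaryPartition

theorem ae_surfaceMeasure_mem_frontier {n : ℕ} (U : Set (E n)) :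
    ∀ᵐ x ∂surfaceMeasure U, x ∈ frontier U := by
  unfold surfaceMeasure
  exact ae_restrict_mem isClosed_frontier.measurableSet

/-- On the frontier the `χ_i` sum to one, and each `∫ χ_i dS` is dominated by a volume integral of a
derivative of `χ_i`. -/
theorem BoundaryPartition.isFiniteMeasure_surfaceMeasure {n : ℕ} {U O : Set (E n)} {c : ℝ}
    (P : BoundaryPartition U O c) : IsFiniteMeasure (surfaceMeasure U) := by
  refine ⟨?_⟩
  have h1 : surfaceMeasure U Set.univ = ∫⁻ x, ∑ i, ENNReal.ofReal (P.χ i x) ∂surfaceMeasure U := by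
    rw [← lintegral_one]
    refine lintegral_congr_ae ?_
    filter_upwards [ae_surfaceMeasure_mem_frontier U] with x hx
    rw [← ENNReal.ofReal_sum_of_nonneg fun i _ => P.nonneg i x]
    have := P.cutoff_eq_one_of_mem_frontier hx
    unfold BoundaryPartition.cutoff at this
    rw [this, ENNReal.ofReal_one]
  rw [h1, lintegral_finsetSum _ fun i _ =>
    (P.contDiff i).continuous.measurable.ennreal_ofReal]
  refine ENNReal.sum_lt_top.2 fun i _ => ?_
  refine ((P.isConeAt i).lintegral_surface ((P.contDiff i).of_le (by exact_mod_cast le_top))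
    (P.compact i) (P.nonneg i) (P.ball_subset i)).2.2.trans_lt ?_
  exact ENNReal.mul_lt_top ENNReal.ofReal_lt_top ENNReal.ofReal_lt_top

/-- A set of positive `n`-dimensional measure has infinite `(n - 1)`-dimensional measure. -/
theorem volume_frontier_eq_zero {n : ℕ} (hn : 1 ≤ n) {U : Set (E n)}
    (h : IsFiniteMeasure (surfaceMeasure U)) : volume (frontier U) = 0 := by
  rcases Measure.euclideanHausdorffMeasure_zero_or_top (show n - 1 < n by omega) (frontier U)
    with h1 | h1
  · rwa [EuclideanSpace.euclideanHausdorffMeasure_eq_volume] at h1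
  · exfalso
    have := h.measure_univ_lt_top
    rw [surfaceMeasure, Measure.restrict_apply MeasurableSet.univ, Set.univ_inter, h1] at this
    exact lt_irrefl _ this

theorem IsConeAt.integral_surface {n : ℕ} {U : Set (E n)} {p N : E n} {ρ c : ℝ}
    (h : IsConeAt U p N ρ c) {F : E n → ℝ} (hF : ContDiff ℝ 1 F) (hFc : HasCompactSupport F)
    (hF0 : ∀ x, 0 ≤ F x) (hFs : tsupport F ⊆ Metric.ball p ρ) :
    - ∫ x in U, fderiv ℝ F x N ≤ ∫ x, F x ∂surfaceMeasure U ∧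
    ∫ x, F x ∂surfaceMeasure U ≤ c⁻¹ ^ (n - 1) * (- ∫ x in U, fderiv ℝ F x N) := by
  obtain ⟨h0, h1, h2⟩ := h.lintegral_surface hF hFc hF0 hFs
  have hc := h.c_pos
  rw [integral_eq_lintegral_of_nonneg_ae (.of_forall hF0) hF.continuous.aestronglyMeasurable]
  rw [← ENNReal.ofReal_mul (by positivity)] at h2
  constructor
  · rw [← ENNReal.ofReal_le_iff_le_toReal (h2.trans_lt ENNReal.ofReal_lt_top).ne]
    exact h1
  · exact ENNReal.toReal_le_of_le_ofReal (by positivity) h2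

/-! ### Weak convergence of the diffuse surface measures -/

section Limits

variable {n : ℕ} {U O : Set (E n)}

theorem tendsto_integral_phase_mul (hUo : IsOpen U) (hne : (frontier U).Nonempty)
    (hnull : volume (frontier U) = 0)
    {f : E n → ℝ} (hf : Integrable f) {e : ℕ → ℝ} (he : Tendsto e atTop (𝓝 0))
    (hpos : ∀ k, 0 < e k) :
    Tendsto (fun k => ∫ x, phase U (e k) x * f x) atTop (𝓝 (∫ x in U, f x)) := by
  rw [← integral_indicator hUo.measurableSet]
  refine tendsto_integral_of_dominated_convergence (fun x => ‖f x‖) (fun k => ?_) hf.norm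
    (fun k => .of_forall fun x => ?_) ?_
  · exact (continuous_phase U (e k)).aestronglyMeasurable.mul hf.1
  · rw [norm_mul]
    exact mul_le_of_le_one_left (norm_nonneg _) (abs_phase_le_one x)
  · have : ∀ᵐ x : E n, x ∉ frontier U := measure_eq_zero_iff_ae_notMem.1 hnull
    filter_upwards [this] with x hx
    have h1 := (tendsto_phase hne hx he hpos).mul_const (f x)
    convert h1 using 2
    by_cases hxU : x ∈ U
    · rw [Set.indicator_of_mem hxU, Set.indicator_of_mem hxU, one_mul]
    · rw [Set.indicator_of_notMem hxU, Set.indicator_of_notMem hxU, zero_mul]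

/-- Away from the boundary the diffuse surface density is negligible. -/
theorem BoundaryPartition.norm_integral_one_sub_cutoff_le {c : ℝ} (P : BoundaryPartition U O c)
    {μ : Measure (E n)} (hμ : μ ≪ volume) {ε : ℝ} (hε : 0 < ε) {F : E n → ℝ} (hF : Integrable F μ) :
    |∫ x, (1 - P.cutoff x) * (F x * ‖gradient (phase U ε) x‖) ∂μ| ≤
      ε * ((2 * P.d ^ 2)⁻¹ * ∫ x, |F x| ∂μ) := by
  have hd := P.d_pos
  rw [← integral_const_mul, ← integral_const_mul, ← Real.norm_eq_abs]
  refine norm_integral_le_of_norm_le ((hF.abs.const_mul _).const_mul _) ?_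
  filter_upwards [hμ.ae_le (norm_gradient_phase_le (U := U) hε P.d_pos)] with x hx
  rw [norm_mul, norm_mul, norm_norm, Real.norm_eq_abs, Real.norm_eq_abs,
    abs_of_nonneg (by linarith [P.cutoff_le_one x])]
  by_cases h : P.d ≤ Metric.infDist x (frontier U)
  · have h1 := hx h
    have h2 : 1 - P.cutoff x ≤ 1 := by linarith [P.cutoff_nonneg x]
    calc (1 - P.cutoff x) * (|F x| * ‖gradient (phase U ε) x‖)
        ≤ 1 * (|F x| * (ε / (2 * P.d ^ 2))) := by
          refine mul_le_mul h2 ?_ (by positivity) zero_le_one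
          exact mul_le_mul_of_nonneg_left h1 (abs_nonneg _)
      _ = _ := by rw [div_eq_mul_inv]; ring
  · have : P.cutoff x = 1 := P.sum_eq_one x (not_le.1 h).le
    rw [this, sub_self, zero_mul]
    positivity

theorem BoundaryPartition.contDiff_mul {c : ℝ} (P : BoundaryPartition U O c) (i : P.ι)
    {F : E n → ℝ} (hF : ContDiff ℝ 1 F) : ContDiff ℝ 1 (fun x => P.χ i x * F x) :=
  ((P.contDiff i).of_le (by exact_mod_cast le_top)).mul hF

theorem BoundaryPartition.tsupport_mul {c : ℝ} (P : BoundaryPartition U O c) (i : P.ι)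
    (F : E n → ℝ) : tsupport (fun x => P.χ i x * F x) ⊆ tsupport (P.χ i) :=
  tsupport_mul_subset_left

/-- Two-sided bounds for the diffuse surface integral and for the surface integral. -/
theorem BoundaryPartition.diffuse_bounds {c : ℝ} (P : BoundaryPartition U O c) {F : E n → ℝ}
    (hF : ContDiff ℝ 1 F) (hF0 : ∀ x, 0 ≤ F x) {ε : ℝ} (hε : 0 < ε) :
    c * ∫ x, P.cutoff x * (F x * ‖gradient (phase U ε) x‖) ≤
        ∑ i, - ∫ x, phase U ε x * fderiv ℝ (fun x => P.χ i x * F x) x (P.N i) ∧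
      ∑ i, - ∫ x, phase U ε x * fderiv ℝ (fun x => P.χ i x * F x) x (P.N i) ≤
        ∫ x, P.cutoff x * (F x * ‖gradient (phase U ε) x‖) := by
  have hi : ∀ i, HasCompactSupport fun x => P.χ i x * F x := fun i => (P.compact i).mul_right
  have hint : ∀ i, Integrable fun x => P.χ i x * F x * ‖gradient (phase U ε) x‖ := fun i =>
    integrable_mul_norm_gradient_phase hε (Measure.AbsolutelyContinuous.refl _)
      ((P.contDiff_mul i hF).continuous.integrable_of_hasCompactSupport (hi i))
  have hsum : ∫ x, P.cutoff x * (F x * ‖gradient (phase U ε) x‖) =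
      ∑ i, ∫ x, P.χ i x * F x * ‖gradient (phase U ε) x‖ := by
    rw [← integral_finsetSum _ fun i _ => hint i]
    congr 1
    funext x
    rw [BoundaryPartition.cutoff, Finset.sum_mul]
    exact Finset.sum_congr rfl fun i _ => by ring
  have hloc := fun i => (P.isConeAt i).integral_norm_gradient_phase hε (P.contDiff_mul i hF) (hi i)
    (fun x => mul_nonneg (P.nonneg i x) (hF0 x))
    ((P.tsupport_mul i F).trans (P.tsupport_subset_ball i))
  rw [hsum, Finset.mul_sum]
  exact ⟨Finset.sum_le_sum fun i _ => (hloc i).1, Finset.sum_le_sum fun i _ => (hloc i).2⟩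

theorem BoundaryPartition.surface_bounds {c : ℝ} (P : BoundaryPartition U O c) {F : E n → ℝ}
    (hF : ContDiff ℝ 1 F) (hF0 : ∀ x, 0 ≤ F x) :
    ∑ i, - ∫ x in U, fderiv ℝ (fun x => P.χ i x * F x) x (P.N i) ≤ ∫ x, F x ∂surfaceMeasure U ∧
    ∫ x, F x ∂surfaceMeasure U ≤
      c⁻¹ ^ (n - 1) * ∑ i, - ∫ x in U, fderiv ℝ (fun x => P.χ i x * F x) x (P.N i) := by
  have hfin := P.isFiniteMeasure_surfaceMeasure
  have hi : ∀ i, HasCompactSupport fun x => P.χ i x * F x := fun i => (P.compact i).mul_right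
  have hint : ∀ i, Integrable (fun x => P.χ i x * F x) (surfaceMeasure U) := fun i =>
    (P.contDiff_mul i hF).continuous.integrable_of_hasCompactSupport (hi i)
  have hsum : ∫ x, F x ∂surfaceMeasure U = ∑ i, ∫ x, P.χ i x * F x ∂surfaceMeasure U := by
    rw [← integral_finsetSum _ fun i _ => hint i]
    refine integral_congr_ae ?_
    filter_upwards [ae_surfaceMeasure_mem_frontier U] with x hx
    rw [← Finset.sum_mul]
    have := P.cutoff_eq_one_of_mem_frontier hx
    unfold BoundaryPartition.cutoff at this
    rw [this, one_mul]
  have hloc := fun i => (P.isConeAt i).integral_surface (P.contDiff_mul i hF) (hi i)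
    (fun x => mul_nonneg (P.nonneg i x) (hF0 x))
    ((P.tsupport_mul i F).trans (P.ball_subset i))
  rw [hsum, Finset.mul_sum]
  exact ⟨Finset.sum_le_sum fun i _ => (hloc i).1, Finset.sum_le_sum fun i _ => (hloc i).2⟩

/-- The diffuse surface measures converge weakly to the surface measure. -/
theorem tendsto_integral_mul_norm_gradient_phase {k : ℕ∞} (hk : 1 ≤ k) (hn : 1 ≤ n)
    (hU : HasCkBoundary k U) (hUo : IsOpen U) (hcpt : IsCompact (frontier U))
    (hne : (frontier U).Nonempty) {F : E n → ℝ}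
    (hF : ContDiff ℝ 1 F) (hFc : HasCompactSupport F) (hF0 : ∀ x, 0 ≤ F x)
    {e : ℕ → ℝ} (he : Tendsto e atTop (𝓝 0)) (hpos : ∀ k, 0 < e k) :
    Tendsto (fun k => ∫ x, F x * ‖gradient (phase U (e k)) x‖) atTop
      (𝓝 (∫ x, F x ∂surfaceMeasure U)) := by
  set S := ∫ x, F x ∂surfaceMeasure U with hS
  have hS0 : 0 ≤ S := integral_nonneg hF0
  have hFi : Integrable F := hF.continuous.integrable_of_hasCompactSupport hFc
  -- For fixed `c`, both `S` and the diffuse integrals are compared with the same number `A`, a sum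
  -- of volume integrals over `U`. The resulting factors `c ^ (n - 1)` and `c⁻¹` disappear as `c →
  -- 1`; a new partition is used for each `c`.
  have key : ∀ c : ℝ, 0 < c → c < 1 → ∀ θ > 0, ∀ᶠ k in atTop,
      c ^ (n - 1) * S - θ < ∫ x, F x * ‖gradient (phase U (e k)) x‖ ∧
        ∫ x, F x * ‖gradient (phase U (e k)) x‖ < c⁻¹ * S + θ := by
    intro c hc hc1 θ hθ
    obtain ⟨P⟩ := exists_boundaryPartition hk hU hUo hcpt hne isOpen_univ (Set.subset_univ _) hc hc1
    have hnull := volume_frontier_eq_zero hn P.isFiniteMeasure_surfaceMeasure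
    obtain ⟨s1, s2⟩ := P.surface_bounds hF hF0
    set A := ∑ i, - ∫ x in U, fderiv ℝ (fun x => P.χ i x * F x) x (P.N i) with hA
    have hlim : Tendsto (fun k => ∑ i, - ∫ x, phase U (e k) x *
        fderiv ℝ (fun x => P.χ i x * F x) x (P.N i)) atTop (𝓝 A) := by
      refine tendsto_finsetSum _ fun i _ => (tendsto_integral_phase_mul hUo hne hnull ?_ he hpos).neg
      have hcs : HasCompactSupport fun x => P.χ i x * F x := (P.compact i).mul_right
      exact (((P.contDiff_mul i hF).continuous_fderiv one_ne_zero).clm_apply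
        continuous_const).integrable_of_hasCompactSupport (hcs.fderiv_apply ℝ _)
    have hR : Tendsto (fun k => e k * ((2 * P.d ^ 2)⁻¹ * ∫ x, |F x|)) atTop (𝓝 0) := by
      have := he.mul_const ((2 * P.d ^ 2)⁻¹ * ∫ x, |F x|)
      rwa [zero_mul] at this
    have hsplit : ∀ k, ∫ x, F x * ‖gradient (phase U (e k)) x‖ =
        (∫ x, P.cutoff x * (F x * ‖gradient (phase U (e k)) x‖)) +
        ∫ x, (1 - P.cutoff x) * (F x * ‖gradient (phase U (e k)) x‖) := fun k => by
      have hI := integrable_mul_norm_gradient_phase (U := U) (hpos k)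
        (Measure.AbsolutelyContinuous.refl _) hFi
      rw [← integral_add]
      · congr 1; funext x; ring
      · refine hI.bdd_mul (c := 1) P.continuous_cutoff.aestronglyMeasurable (.of_forall fun x => ?_)
        rw [Real.norm_of_nonneg (P.cutoff_nonneg x)]; exact P.cutoff_le_one x
      · refine hI.bdd_mul (c := 1) (continuous_const.sub
          P.continuous_cutoff).aestronglyMeasurable (.of_forall fun x => ?_)
        rw [Real.norm_of_nonneg (by linarith [P.cutoff_le_one x])]
        linarith [P.cutoff_nonneg x]
    have hcθ : 0 < c * (θ / 2) := by positivity
    have hcp : 0 < c ^ (n - 1) := by positivity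
    rw [inv_pow, inv_mul_eq_div, le_div_iff₀ hcp, mul_comm S] at s2
    filter_upwards [hlim.eventually_lt_const (show A < A + c * (θ / 2) by linarith),
      hlim.eventually_const_lt (show A - θ / 2 < A by linarith),
      hR.eventually_lt_const (show 0 < θ / 2 by positivity)] with k h1 h2 h3
    obtain ⟨b1, b2⟩ := P.diffuse_bounds hF hF0 (hpos k)
    have h4 := abs_le.1 (P.norm_integral_one_sub_cutoff_le (U := U)
      (Measure.AbsolutelyContinuous.refl _) (hpos k) hFi)
    rw [hsplit k]
    refine ⟨by linarith [h4.1], ?_⟩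
    have h5 : ∫ x, P.cutoff x * (F x * ‖gradient (phase U (e k)) x‖) < c⁻¹ * S + θ / 2 := by
      have : c * ∫ x, P.cutoff x * (F x * ‖gradient (phase U (e k)) x‖) < S + c * (θ / 2) := by
        linarith
      rw [← lt_div_iff₀' hc] at this
      refine this.trans_eq ?_
      field_simp
    linarith [h4.2]
  rw [Metric.tendsto_atTop']
  intro θ hθ
  have hc1 : Tendsto (fun c : ℝ => c ^ (n - 1) * S) (𝓝[<] 1) (𝓝 S) := by
    have : Continuous fun c : ℝ => c ^ (n - 1) * S := by fun_prop
    have := this.tendsto 1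
    simp only [one_pow, one_mul] at this
    exact this.mono_left nhdsWithin_le_nhds
  have hc2 : Tendsto (fun c : ℝ => c⁻¹ * S) (𝓝[<] 1) (𝓝 S) := by
    have : ContinuousAt (fun c : ℝ => c⁻¹ * S) 1 :=
      (continuousAt_inv₀ one_ne_zero).mul continuousAt_const
    have := this.tendsto
    simp only [inv_one, one_mul] at this
    exact this.mono_left nhdsWithin_le_nhds
  have h0 : ∀ᶠ c : ℝ in 𝓝[<] 1, 0 < c ∧ c < 1 := by
    filter_upwards [self_mem_nhdsWithin,
      nhdsWithin_le_nhds (lt_mem_nhds (zero_lt_one (α := ℝ)))] with c h1 h2 using ⟨h2, h1⟩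
  obtain ⟨c, h1, h2, h3, h4⟩ := ((hc1.eventually_const_lt (show S - θ / 2 < S by linarith)).and
    ((hc2.eventually_lt_const (show S < S + θ / 2 by linarith)).and h0)).exists
  obtain ⟨k₀, hk₀⟩ := eventually_atTop.1 (key c h3 h4 (θ / 2) (by positivity))
  refine ⟨k₀, fun k hk => ?_⟩
  obtain ⟨h5, h6⟩ := hk₀ k hk.le
  rw [Real.dist_eq, abs_lt]
  constructor <;> linarith

end Limits

/-! ### Trace inequalities for diffuse and sharp surface measures -/

section TraceInequalities

variable {n : ℕ} {U O : Set (E n)} {c : ℝ}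

theorem norm_gradient_eq (f : E n → ℝ) (x : E n) : ‖gradient f x‖ = ‖fderiv ℝ f x‖ := by
  unfold gradient; rw [LinearIsometryEquiv.norm_map]

theorem BoundaryPartition.exists_fderiv_bound (P : BoundaryPartition U O c) :
    ∃ B : ℝ, 0 ≤ B ∧ ∀ i x, ‖fderiv ℝ (P.χ i) x‖ ≤ B := by
  have h : ∀ i, ∃ B : ℝ, ∀ x, ‖fderiv ℝ (P.χ i) x‖ ≤ B := fun i => by
    have hc := (P.compact i).fderiv ℝ
    exact hc.exists_bound_of_continuous ((P.contDiff i).continuous_fderiv (by simp))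
  choose B hB using h
  refine ⟨∑ i, |B i|, Finset.sum_nonneg fun i _ => abs_nonneg _, fun i x => ?_⟩
  exact (hB i x).trans ((le_abs_self _).trans
    (Finset.single_le_sum (fun j _ => abs_nonneg (B j)) (Finset.mem_univ i)))

/-- The product rule gives `B v² + 2 |v| |∇v|`. Keeping the product `|v| |∇v|` unsplit is essential:
it is small when `v` is small in `L²` and `∇v` is merely bounded. -/
theorem BoundaryPartition.abs_fderiv_mul_sq_le (P : BoundaryPartition U O c) {B : ℝ}
    (hB : ∀ i x, ‖fderiv ℝ (P.χ i) x‖ ≤ B) (hB0 : 0 ≤ B) {v : E n → ℝ} (hv : ContDiff ℝ 1 v)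
    (i : P.ι) (x : E n) :
    |fderiv ℝ (fun x => P.χ i x * v x ^ 2) x (P.N i)| ≤
      (B + 2) * (v x ^ 2 + |v x| * ‖gradient v x‖) := by
  have h1 : HasFDerivAt (P.χ i) (fderiv ℝ (P.χ i) x) x :=
    ((P.contDiff i).differentiable (by simp) x).hasFDerivAt
  have h2 : HasFDerivAt v (fderiv ℝ v x) x := (hv.differentiable one_ne_zero x).hasFDerivAt
  have h3 := h1.mul (h2.pow 2)
  have e : fderiv ℝ (fun x => P.χ i x * v x ^ 2) x = _ := h3.fderiv
  rw [e]
  have hN := (P.isConeAt i).norm_eq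
  have b1 : |fderiv ℝ (P.χ i) x (P.N i)| ≤ B := by
    have := (fderiv ℝ (P.χ i) x).le_opNorm (P.N i)
    rw [hN, mul_one] at this
    exact this.trans (hB i x)
  have b2 : |fderiv ℝ v x (P.N i)| ≤ ‖gradient v x‖ := by
    have := (fderiv ℝ v x).le_opNorm (P.N i)
    rw [hN, mul_one] at this
    rwa [norm_gradient_eq]
  have b3 : |P.χ i x| ≤ 1 := by
    rw [abs_of_nonneg (P.nonneg i x)]; exact P.χ_le_one i x
  simp only [add_apply, smul_apply, smul_eq_mul, pow_one,
    Nat.add_one_sub_one, nsmul_eq_mul, Nat.cast_ofNat]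
  have hg := norm_nonneg (gradient v x)
  have ha := abs_nonneg (v x)
  calc _ ≤ |P.χ i x * (2 * v x * fderiv ℝ v x (P.N i))| + |v x ^ 2 * fderiv ℝ (P.χ i) x (P.N i)| :=
        abs_add_le _ _
    _ = |P.χ i x| * (2 * |v x| * |fderiv ℝ v x (P.N i)|) +
        v x ^ 2 * |fderiv ℝ (P.χ i) x (P.N i)| := by
      simp only [abs_mul, abs_two, abs_pow, sq_abs]
    _ ≤ 1 * (2 * |v x| * ‖gradient v x‖) + v x ^ 2 * B := by gcongr
    _ ≤ _ := by nlinarith [sq_nonneg (v x), mul_nonneg ha hg, mul_nonneg hB0 (mul_nonneg ha hg)]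

/-- The union of the supports of the partition functions. -/
def BoundaryPartition.carrier (P : BoundaryPartition U O c) : Set (E n) := ⋃ i, tsupport (P.χ i)

theorem BoundaryPartition.isCompact_carrier (P : BoundaryPartition U O c) : IsCompact P.carrier :=
  isCompact_iUnion fun i => P.compact i

theorem BoundaryPartition.carrier_subset (P : BoundaryPartition U O c) : P.carrier ⊆ O :=
  Set.iUnion_subset P.tsupport_subset

theorem BoundaryPartition.cutoff_eq_zero (P : BoundaryPartition U O c) {x : E n}
    (hx : x ∉ P.carrier) : P.cutoff x = 0 :=
  Finset.sum_eq_zero fun i _ => image_eq_zero_of_notMem_tsupport fun h =>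
    hx (Set.mem_iUnion.2 ⟨i, h⟩)

theorem continuous_sq_add_mul_norm_gradient {v : E n → ℝ} (hv : ContDiff ℝ 1 v) :
    Continuous fun x => v x ^ 2 + |v x| * ‖gradient v x‖ := by
  simp_rw [norm_gradient_eq]
  exact (hv.continuous.pow 2).add
    (hv.continuous.abs.mul (hv.continuous_fderiv one_ne_zero).norm)

/-- Uniform trace inequality for the diffuse surface measures. -/
theorem BoundaryPartition.exists_diffuse_trace_bound (P : BoundaryPartition U O c) :
    ∃ C : ℝ, 0 ≤ C ∧ ∀ ε > 0, ∀ v : E n → ℝ, ContDiff ℝ 1 v →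
      ∫ x, P.cutoff x * (v x ^ 2 * ‖gradient (phase U ε) x‖) ≤
        C * ∫ x in P.carrier, (v x ^ 2 + |v x| * ‖gradient v x‖) := by
  obtain ⟨B, hB0, hB⟩ := P.exists_fderiv_bound
  -- Positivity of `c` is recorded only in the cones, so a partition with no members is treated
  -- apart; its cutoff is zero.
  rcases isEmpty_or_nonempty P.ι with hem | ⟨⟨i₀⟩⟩
  · refine ⟨0, le_rfl, fun ε _ v _ => ?_⟩
    have : ∀ x, P.cutoff x = 0 := fun x => by simp [BoundaryPartition.cutoff]
    simp [this]
  have hc := (P.isConeAt i₀).c_pos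
  refine ⟨c⁻¹ * (Fintype.card P.ι * (B + 2)), by positivity, fun ε hε v hv => ?_⟩
  have h1 := (P.diffuse_bounds (hv.pow 2) (fun x => sq_nonneg _) hε).1
  set I := ∫ x in P.carrier, (v x ^ 2 + |v x| * ‖gradient v x‖) with hI
  have hIint : IntegrableOn (fun x => v x ^ 2 + |v x| * ‖gradient v x‖) P.carrier :=
    (continuous_sq_add_mul_norm_gradient hv).continuousOn.integrableOn_compact P.isCompact_carrier
  have hK := P.isCompact_carrier.measurableSet
  have h2 : ∀ i, - ∫ x, phase U ε x * fderiv ℝ (fun x => P.χ i x * v x ^ 2) x (P.N i) ≤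
      (B + 2) * I := fun i => by
    refine (neg_le_abs _).trans ?_
    rw [hI, ← integral_const_mul, ← integral_indicator hK, ← Real.norm_eq_abs]
    refine norm_integral_le_of_norm_le
      ((integrable_indicator_iff hK).2 (hIint.const_mul (B + 2)))
      (.of_forall fun x => ?_)
    by_cases hx : x ∈ P.carrier
    · rw [Set.indicator_of_mem hx, norm_mul]
      refine (mul_le_of_le_one_left (norm_nonneg _) (abs_phase_le_one x)).trans ?_
      exact P.abs_fderiv_mul_sq_le hB hB0 hv i x
    · rw [Set.indicator_of_notMem hx]
      have : fderiv ℝ (fun x => P.χ i x * v x ^ 2) x = 0 := by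
        by_contra h
        exact hx (Set.mem_iUnion.2 ⟨i, P.tsupport_mul i _ (support_fderiv_subset ℝ h)⟩)
      simp [this]
  have h3 := h1.trans (Finset.sum_le_sum fun i _ => h2 i)
  rw [Finset.sum_const, Finset.card_univ, nsmul_eq_mul] at h3
  rw [mul_assoc, mul_assoc, ← div_eq_inv_mul, le_div_iff₀' hc]
  exact h3

/-- The trace inequality. -/
theorem BoundaryPartition.exists_trace_bound (P : BoundaryPartition U O c)
    (hbdd : Bornology.IsBounded U) :
    ∃ C : ℝ, 0 ≤ C ∧ ∀ v : E n → ℝ, ContDiff ℝ 1 v →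
      ∫ x, v x ^ 2 ∂surfaceMeasure U ≤
        C * ∫ x in U, (v x ^ 2 + |v x| * ‖gradient v x‖) := by
  obtain ⟨B, hB0, hB⟩ := P.exists_fderiv_bound
  rcases isEmpty_or_nonempty P.ι with hem | ⟨⟨i₀⟩⟩
  · refine ⟨0, le_rfl, fun v hv => ?_⟩
    have := (P.surface_bounds (hv.pow 2) (fun x => sq_nonneg _)).2
    simpa using this
  have hc := (P.isConeAt i₀).c_pos
  refine ⟨c⁻¹ ^ (n - 1) * (Fintype.card P.ι * (B + 2)), by positivity, fun v hv => ?_⟩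
  refine ((P.surface_bounds (hv.pow 2) (fun x => sq_nonneg _)).2).trans ?_
  set I := ∫ x in U, (v x ^ 2 + |v x| * ‖gradient v x‖) with hI
  have hIint : IntegrableOn (fun x => v x ^ 2 + |v x| * ‖gradient v x‖) U :=
    ((continuous_sq_add_mul_norm_gradient hv).continuousOn.integrableOn_compact
      hbdd.isCompact_closure).mono_set subset_closure
  have h2 : ∀ i, - ∫ x in U, fderiv ℝ (fun x => P.χ i x * v x ^ 2) x (P.N i) ≤
      (B + 2) * I := fun i => by
    refine (neg_le_abs _).trans ?_
    rw [hI, ← integral_const_mul, ← Real.norm_eq_abs]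
    exact norm_integral_le_of_norm_le (hIint.const_mul _)
      (.of_forall fun x => P.abs_fderiv_mul_sq_le hB hB0 hv i x)
  have h3 := (Finset.sum_le_sum fun i (_ : i ∈ Finset.univ) => h2 i)
  rw [Finset.sum_const, Finset.card_univ, nsmul_eq_mul] at h3
  rw [mul_assoc, mul_assoc]
  gcongr

end TraceInequalities

/-! ### Mollification in `L²` -/

theorem eLpNorm_two_sq {α F : Type*} [MeasurableSpace α] [NormedAddCommGroup F] (μ : Measure α)
    (f : α → F) : eLpNorm f 2 μ ^ 2 = ∫⁻ x, ‖f x‖ₑ ^ 2 ∂μ := by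
  have h := eLpNorm_nnreal_pow_eq_lintegral (μ := μ) (f := f) (p := 2) two_ne_zero
  have e : ((2 : NNReal) : ENNReal) = 2 := rfl
  rw [e] at h
  simpa only [NNReal.coe_ofNat, ENNReal.rpow_ofNat] using h

theorem aestronglyMeasurable_comp_sub_left {n : ℕ} {F : Type*} [NormedAddCommGroup F] {f : E n → F} (hf : AEStronglyMeasurable f volume)
    (x : E n) : AEStronglyMeasurable (fun t => f (x - t)) volume :=
  hf.comp_quasiMeasurePreserving (Measure.measurePreserving_sub_left volume x).quasiMeasurePreserving

section Mollify

variable {n : ℕ} {F : Type*} [NormedAddCommGroup F] [NormedSpace ℝ F]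

/-- The mollification of `f` by the bump function `φ`. -/
noncomputable def mollify (φ : ContDiffBump (0 : E n)) (f : E n → F) : E n → F :=
  convolution (φ.normed volume) f (ContinuousLinearMap.lsmul ℝ ℝ) volume

theorem mollify_apply (φ : ContDiffBump (0 : E n)) (f : E n → F) (x : E n) :
    mollify φ f x = ∫ t, φ.normed volume t • f (x - t) := convolution_lsmul

/-- The normed bump is a probability density, so the squared norm of an average is at most the
average of the squared norms. Tonelli and translation invariance then integrate this. -/
theorem eLpNorm_mollify_le (φ : ContDiffBump (0 : E n)) {f : E n → F}
    (hf : AEStronglyMeasurable f volume) :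
    eLpNorm (mollify φ f) 2 volume ≤ eLpNorm f 2 volume := by
  set ρ : E n → ENNReal := fun t => ENNReal.ofReal (φ.normed volume t) with hρ
  have hρm : Measurable ρ := φ.continuous_normed.measurable.ennreal_ofReal
  have hρ1 : ∫⁻ t, ρ t = 1 := by
    rw [hρ, ← ofReal_integral_eq_lintegral_ofReal φ.integrable_normed
      (.of_forall φ.nonneg_normed), φ.integral_normed, ENNReal.ofReal_one]
  have hprob : IsProbabilityMeasure (volume.withDensity ρ) := ⟨by
    rw [withDensity_apply _ MeasurableSet.univ, Measure.restrict_univ, hρ1]⟩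
  have hpt : ∀ x, ‖mollify φ f x‖ₑ ^ 2 ≤ ∫⁻ t, ρ t * ‖f (x - t)‖ₑ ^ 2 := by
    intro x
    have hfx := aestronglyMeasurable_comp_sub_left hf x
    have h1 : ‖mollify φ f x‖ₑ ≤ eLpNorm (fun t => f (x - t)) 1 (volume.withDensity ρ) := by
      rw [mollify_apply, eLpNorm_one_eq_lintegral_enorm,
        lintegral_withDensity_eq_lintegral_mul₀ hρm.aemeasurable hfx.enorm]
      refine (enorm_integral_le_lintegral_enorm _).trans (le_of_eq (lintegral_congr fun t => ?_))
      rw [enorm_smul, Real.enorm_of_nonneg (φ.nonneg_normed t)]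
      rfl
    -- Jensen's inequality, as monotonicity of `L^p` norms under a probability measure.
    have h2 := h1.trans (eLpNorm_le_eLpNorm_of_exponent_le (one_le_two)
      (hfx.mono_ac (withDensity_absolutelyContinuous _ _)))
    calc ‖mollify φ f x‖ₑ ^ 2 ≤ eLpNorm (fun t => f (x - t)) 2 (volume.withDensity ρ) ^ 2 := by
          gcongr
      _ = _ := by
          rw [eLpNorm_two_sq, lintegral_withDensity_eq_lintegral_mul₀ hρm.aemeasurable
            (hfx.enorm.pow_const 2)]
          rfl
  have hsq : eLpNorm (mollify φ f) 2 volume ^ 2 ≤ eLpNorm f 2 volume ^ 2 := by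
    rw [eLpNorm_two_sq, eLpNorm_two_sq]
    calc _ ≤ ∫⁻ x, ∫⁻ t, ρ t * ‖f (x - t)‖ₑ ^ 2 := lintegral_mono hpt
      _ = ∫⁻ t, ∫⁻ x, ρ t * ‖f (x - t)‖ₑ ^ 2 := by
        refine lintegral_lintegral_swap ?_
        refine AEMeasurable.mul (hρm.comp measurable_snd).aemeasurable ?_
        exact ((hf.comp_quasiMeasurePreserving
          (quasiMeasurePreserving_sub volume volume)).enorm.pow_const 2)
      _ = ∫⁻ t, ρ t * ∫⁻ x, ‖f x‖ₑ ^ 2 := by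
        refine lintegral_congr fun t => ?_
        rw [lintegral_const_mul' _ _ ENNReal.ofReal_ne_top,
          lintegral_sub_right_eq_self (fun x => ‖f x‖ₑ ^ 2) t]
      _ = _ := by rw [lintegral_mul_const _ hρm, hρ1, one_mul]
  exact (ENNReal.pow_le_pow_left_iff two_ne_zero).1 hsq

theorem integrable_normed_smul (φ : ContDiffBump (0 : E n)) {f : E n → F}
    (hf : LocallyIntegrable f volume) (x : E n) :
    Integrable (fun t => φ.normed volume t • f (x - t)) := by
  have := ((φ.hasCompactSupport_normed (μ := volume)).convolutionExists_left (ContinuousLinearMap.lsmul ℝ ℝ)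
    φ.continuous_normed hf) x
  simpa [ConvolutionExistsAt] using this

theorem mollify_sub (φ : ContDiffBump (0 : E n)) {f g : E n → F}
    (hf : LocallyIntegrable f volume) (hg : LocallyIntegrable g volume) :
    mollify φ (f - g) = mollify φ f - mollify φ g := by
  funext x
  rw [Pi.sub_apply, mollify_apply, mollify_apply, mollify_apply,
    ← integral_sub (integrable_normed_smul φ hf x) (integrable_normed_smul φ hg x)]
  congr 1
  funext t
  rw [Pi.sub_apply, smul_sub]

theorem continuous_mollify (φ : ContDiffBump (0 : E n)) {f : E n → F}
    (hf : LocallyIntegrable f volume) : Continuous (mollify φ f) :=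
  φ.hasCompactSupport_normed.continuous_convolution_left _ φ.continuous_normed hf

/-- A sequence of bump functions with radii tending to zero. -/
noncomputable def bumpSeq (n k : ℕ) : ContDiffBump (0 : E n) where
  rIn := 1 / (k + 2)
  rOut := 1 / (k + 1)
  rIn_pos := by positivity
  rIn_lt_rOut := by
    apply one_div_lt_one_div_of_lt <;> [positivity; linarith]

theorem bumpSeq_rOut (n k : ℕ) : (bumpSeq n k).rOut = 1 / (k + 1) := rfl

theorem tendsto_bumpSeq_rOut (n : ℕ) : Tendsto (fun k => (bumpSeq n k).rOut) atTop (𝓝 0) :=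
  tendsto_one_div_add_atTop_nhds_zero_nat

variable [CompleteSpace F]

/-- By uniform continuity the difference is uniformly small, and once the bump radius is at most one
it lives on a fixed compact neighbourhood of the support. -/
theorem tendsto_eLpNorm_mollify_sub_of_continuous {h : E n → F} (hc : Continuous h)
    (hs : HasCompactSupport h) :
    Tendsto (fun k => eLpNorm (mollify (bumpSeq n k) h - h) 2 volume) atTop (𝓝 0) := by
  have hK : IsCompact (Metric.cthickening 1 (tsupport h)) := hs.isCompact.cthickening
  set S := Metric.cthickening 1 (tsupport h) with hS
  have hSfin : volume S ≠ ⊤ := hK.measure_lt_top.ne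
  have hM : volume S ^ (1 / (2 : ENNReal).toReal) ≠ ⊤ :=
    ENNReal.rpow_ne_top_of_nonneg (by simp) hSfin
  have huc : UniformContinuous h := hs.uniformContinuous_of_continuous hc
  rw [ENNReal.tendsto_nhds_zero]
  intro θ hθ
  have hlim : Tendsto (fun c : ℝ => ENNReal.ofReal c * volume S ^ (1 / (2 : ENNReal).toReal))
      (𝓝[>] 0) (𝓝 0) := by
    have h1 : Tendsto (fun c : ℝ => ENNReal.ofReal c) (𝓝[>] 0) (𝓝 0) := by
      have := (ENNReal.continuous_ofReal.tendsto 0).mono_left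
        (nhdsWithin_le_nhds (s := Set.Ioi (0 : ℝ)))
      simpa using this
    have := ENNReal.Tendsto.mul_const h1 (Or.inr hM)
    simpa using this
  obtain ⟨c, hc1, hc0⟩ := ((hlim.eventually_le_const (show 0 < θ from hθ)).and
    self_mem_nhdsWithin).exists
  have hc0 : 0 < c := hc0
  obtain ⟨δ, hδ, hδh⟩ := Metric.uniformContinuous_iff.1 huc c hc0
  filter_upwards [(tendsto_bumpSeq_rOut n).eventually_lt_const hδ] with k hk
  refine le_trans ?_ hc1
  have hr1 : (bumpSeq n k).rOut ≤ 1 := by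
    rw [bumpSeq_rOut, div_le_one (by positivity)]
    linarith [(Nat.cast_nonneg k : (0 : ℝ) ≤ k)]
  refine eLpNorm_sub_le_of_dist_bdd volume (by simp) hK.measurableSet hc0.le (fun x => ?_) ?_ ?_
  · refine ContDiffBump.dist_normed_convolution_le hc.aestronglyMeasurable fun y hy => ?_
    exact (hδh ((Metric.mem_ball.1 hy).trans hk)).le
  · refine (support_convolution_subset _).trans ?_
    rw [ContDiffBump.support_normed_eq]
    rintro _ ⟨a, ha, b, hb, rfl⟩
    refine Metric.mem_cthickening_of_dist_le _ b _ _ (subset_tsupport h hb) ?_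
    rw [mem_ball_zero_iff] at ha
    rw [dist_eq_norm]
    simp only [add_sub_cancel_right]
    linarith
  · exact (subset_tsupport h).trans (Metric.self_subset_cthickening _)

/-- Approximation by continuous compactly supported functions; the contraction property controls the
mollified error. -/
theorem tendsto_eLpNorm_mollify_sub {f : E n → F} (hf : MemLp f 2 volume) :
    Tendsto (fun k => eLpNorm (mollify (bumpSeq n k) f - f) 2 volume) atTop (𝓝 0) := by
  rw [ENNReal.tendsto_nhds_zero]
  intro θ hθ
  have hθ3 : θ / 3 ≠ 0 := by simp [hθ.ne']
  obtain ⟨h, hs, hle, hc, hmem⟩ := hf.exists_hasCompactSupport_eLpNorm_sub_le (by simp) hθ3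
  filter_upwards [ENNReal.tendsto_nhds_zero.1 (tendsto_eLpNorm_mollify_sub_of_continuous hc hs)
    (θ / 3) (pos_iff_ne_zero.2 hθ3)] with k hk
  have hfl := hf.locallyIntegrable one_le_two
  have hhl := hmem.locallyIntegrable one_le_two
  have hdec : mollify (bumpSeq n k) f - f =
      mollify (bumpSeq n k) (f - h) + ((mollify (bumpSeq n k) h - h) + (h - f)) := by
    rw [mollify_sub _ hfl hhl]; abel
  have m1 : AEStronglyMeasurable (mollify (bumpSeq n k) (f - h)) volume :=
    (continuous_mollify _ (hfl.sub hhl)).aestronglyMeasurable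
  have m2 : AEStronglyMeasurable (mollify (bumpSeq n k) h - h) volume :=
    ((continuous_mollify _ hhl).sub hc).aestronglyMeasurable
  have m3 : AEStronglyMeasurable (h - f) volume := hmem.1.sub hf.1
  rw [hdec]
  calc _ ≤ eLpNorm (mollify (bumpSeq n k) (f - h)) 2 volume +
        (eLpNorm (mollify (bumpSeq n k) h - h) 2 volume + eLpNorm (h - f) 2 volume) :=
        (eLpNorm_add_le m1 (m2.add m3) one_le_two).trans
          (add_le_add le_rfl (eLpNorm_add_le m2 m3 one_le_two))
    _ ≤ θ / 3 + (θ / 3 + θ / 3) := by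
        gcongr
        · exact (eLpNorm_mollify_le _ (hf.1.sub hmem.1)).trans hle
        · rw [eLpNorm_sub_comm]; exact hle
    _ = θ := by rw [← add_assoc, ENNReal.add_thirds]

end Mollify

/-! ### Weak gradients -/

section WeakGradient

variable {n : ℕ} {Ω U : Set (E n)} {u : E n → ℝ}

theorem MemH1.memLp_weakGradient (h : MemH1 Ω u) :
    MemLp (weakGradient Ω u) 2 (volume.restrict Ω) := by
  rw [weakGradient, dif_pos h]
  exact h.2.choose_spec.1

theorem MemH1.isWeakGradient (h : MemH1 Ω u) : IsWeakGradient Ω u (weakGradient Ω u) := by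
  rw [weakGradient, dif_pos h]
  exact h.2.choose_spec.2

theorem setIntegral_eq_of_tsupport_subset {F : Type*} [NormedAddCommGroup F] [NormedSpace ℝ F]
    {V W : Set (E n)} {φ : E n → ℝ} (hφ : tsupport φ ⊆ V) (hVW : V ⊆ W) (f : E n → F)
    (hf : ∀ x, x ∉ tsupport φ → f x = 0) : ∫ x in V, f x = ∫ x in W, f x := by
  rw [setIntegral_eq_integral_of_forall_compl_eq_zero fun x hx => hf x fun h => hx (hφ h),
    setIntegral_eq_integral_of_forall_compl_eq_zero fun x hx => hf x fun h => hx (hVW (hφ h))]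

theorem IsWeakGradient.mono {G : E n → E n} (h : IsWeakGradient Ω u G) (hU : U ⊆ Ω) :
    IsWeakGradient U u G := by
  intro φ hφ hc hs v
  rw [setIntegral_eq_of_tsupport_subset hs hU, setIntegral_eq_of_tsupport_subset hs hU]
  · exact h φ hφ hc (hs.trans hU) v
  · intro x hx
    rw [image_eq_zero_of_notMem_tsupport hx, mul_zero]
  · intro x hx
    have : fderiv ℝ φ x = 0 := by
      by_contra h0; exact hx (support_fderiv_subset ℝ h0)
    simp [this]

theorem MemH1.mono (h : MemH1 Ω u) (hU : U ⊆ Ω) : MemH1 U u :=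
  ⟨h.1.mono_measure (Measure.restrict_mono hU le_rfl), weakGradient Ω u,
    h.memLp_weakGradient.mono_measure (Measure.restrict_mono hU le_rfl), h.isWeakGradient.mono hU⟩

theorem integrable_inner_mul {G : E n → E n} {μ : Measure (E n)} (hG : MemLp G 2 μ)
    {φ : E n → ℝ} (hφ : MemLp φ 2 μ) (v : E n) : Integrable (fun x => inner ℝ (G x) v * φ x) μ := by
  have h1 : MemLp (fun x => inner ℝ (G x) v) 2 μ := hG.inner_const v
  exact h1.integrable_mul hφ

theorem memLp_of_contDiff_hasCompactSupport {φ : E n → ℝ} (hφ : Continuous φ)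
    (hc : HasCompactSupport φ) (U : Set (E n)) : MemLp φ 2 (volume.restrict U) :=
  (hφ.memLp_of_hasCompactSupport hc).restrict U

/-- Weak gradients are unique up to null sets. -/
theorem IsWeakGradient.ae_eq (hU : IsOpen U) {G₁ G₂ : E n → E n} (h₁ : IsWeakGradient U u G₁)
    (h₂ : IsWeakGradient U u G₂) (hG₁ : MemLp G₁ 2 (volume.restrict U))
    (hG₂ : MemLp G₂ 2 (volume.restrict U)) : G₁ =ᵐ[volume.restrict U] G₂ := by
  have hloc : LocallyIntegrableOn (G₁ - G₂) U volume :=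
    locallyIntegrableOn_of_locallyIntegrable_restrict ((hG₁.sub hG₂).locallyIntegrable one_le_two)
  have key := hU.ae_eq_zero_of_integral_contDiff_smul_eq_zero hloc fun φ hφ hc hs => by
    have hφ2 := memLp_of_contDiff_hasCompactSupport hφ.continuous hc U
    rw [← setIntegral_eq_integral_of_forall_compl_eq_zero (s := U) fun x hx => by
      rw [image_eq_zero_of_notMem_tsupport fun h => hx (hs h), zero_smul]]
    have hint : Integrable (fun x => φ x • (G₁ - G₂) x) (volume.restrict U) := by
      have := (hG₁.sub hG₂).smul hφ2 (r := 1)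
      exact memLp_one_iff_integrable.1 this
    refine ext_inner_right ℝ fun v => ?_
    rw [inner_zero_left, real_inner_comm, ← integral_inner hint v]
    have e : ∀ x, inner ℝ v (φ x • (G₁ - G₂) x) =
        inner ℝ (G₁ x) v * φ x - inner ℝ (G₂ x) v * φ x := fun x => by
      rw [inner_smul_right, Pi.sub_apply, inner_sub_right, real_inner_comm, real_inner_comm v (G₂ x)]
      ring
    simp only [e]
    rw [integral_sub (integrable_inner_mul hG₁ hφ2 v) (integrable_inner_mul hG₂ hφ2 v)]
    have e1 := h₁ φ hφ hc hs v
    have e2 := h₂ φ hφ hc hs v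
    linarith
  rw [Filter.EventuallyEq, ae_restrict_iff' hU.measurableSet]
  filter_upwards [key] with x hx hxU
  exact sub_eq_zero.1 (hx hxU)

/-- Needed because the trace on `∂U` refers to the gradient chosen on `U`, whereas the energies use
the one chosen on `Ω`. -/
theorem MemH1.weakGradient_ae_eq (hU : IsOpen U) (h : MemH1 Ω u) (hsub : U ⊆ Ω) :
    weakGradient U u =ᵐ[volume.restrict U] weakGradient Ω u :=
  (h.mono hsub).isWeakGradient.ae_eq hU (h.isWeakGradient.mono hsub)
    (h.mono hsub).memLp_weakGradient
    (h.memLp_weakGradient.mono_measure (Measure.restrict_mono hsub le_rfl))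

theorem MemLp.indicator_of_restrict {F : Type*} [NormedAddCommGroup F] {f : E n → F}
    (hΩ : MeasurableSet Ω) (hf : MemLp f 2 (volume.restrict Ω)) :
    MemLp (Ω.indicator f) 2 volume := (memLp_indicator_iff_restrict hΩ).2 hf

theorem inner_gradient (f : E n → ℝ) (x v : E n) : inner ℝ (gradient f x) v = fderiv ℝ f x v := by
  unfold gradient
  rw [InnerProductSpace.toDual_symm_apply]

theorem contDiff_mollify (φ : ContDiffBump (0 : E n)) {f : E n → ℝ}
    (hf : LocallyIntegrable f volume) : ContDiff ℝ ∞ (mollify φ f) :=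
  φ.hasCompactSupport_normed.contDiff_convolution_left _ φ.contDiff_normed hf

theorem fderiv_mollify (φ : ContDiffBump (0 : E n)) {f : E n → ℝ}
    (hf : LocallyIntegrable f volume) (x v : E n) :
    fderiv ℝ (mollify φ f) x v = ∫ y, fderiv ℝ (φ.normed volume) (x - y) v * f y := by
  have hc : HasCompactSupport (φ.normed (volume : Measure (E n))) := φ.hasCompactSupport_normed
  have hd : ContDiff ℝ 1 (φ.normed (volume : Measure (E n))) := φ.contDiff_normed
  have h1 := hc.hasFDerivAt_convolution_left (ContinuousLinearMap.lsmul ℝ ℝ) hd hf x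
  have h2 : fderiv ℝ (mollify φ f) x = _ := h1.fderiv
  have hex := ((hc.fderiv ℝ).convolutionExists_left
    (ContinuousLinearMap.precompL (E n) (ContinuousLinearMap.lsmul ℝ ℝ))
    (hd.continuous_fderiv one_ne_zero) hf) x
  rw [h2, convolution_def, ContinuousLinearMap.integral_apply hex,
    ← integral_sub_left_eq_self _ volume x]
  congr 1
  funext y
  simp [ContinuousLinearMap.precompL_apply]

/-- Inside `Ω`, the gradient of a mollification is the mollification of the weak gradient. -/
theorem IsWeakGradient.gradient_mollify (hΩ : IsOpen Ω) {G : E n → E n}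
    (h : IsWeakGradient Ω u G) (hu : MemLp u 2 (volume.restrict Ω))
    (hG : MemLp G 2 (volume.restrict Ω)) (φ : ContDiffBump (0 : E n)) {x : E n}
    (hx : Metric.closedBall x φ.rOut ⊆ Ω) :
    gradient (mollify φ (Ω.indicator u)) x = mollify φ (Ω.indicator G) x := by
  have hum := (MemLp.indicator_of_restrict hΩ.measurableSet hu).locallyIntegrable one_le_two
  have hGm := (MemLp.indicator_of_restrict hΩ.measurableSet hG).locallyIntegrable one_le_two
  have hc : HasCompactSupport (φ.normed (volume : Measure (E n))) := φ.hasCompactSupport_normed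
  have hd : ContDiff ℝ ∞ (φ.normed (volume : Measure (E n))) := φ.contDiff_normed
  refine ext_inner_right ℝ fun v => ?_
  rw [inner_gradient, fderiv_mollify φ hum, mollify_apply]
  -- The reflected and translated kernel is an admissible test function exactly because its support
  -- lies in the ball around `x` contained in `Ω`.
  let τ : E n → ℝ := fun y => φ.normed volume (x - y)
  have hτ : ContDiff ℝ ∞ τ := hd.comp (contDiff_const.sub contDiff_id)
  have hτs : tsupport τ ⊆ Metric.closedBall x φ.rOut := by
    refine closure_minimal (fun y hy => ?_) Metric.isClosed_closedBall
    have : x - y ∈ Function.support (φ.normed (volume : Measure (E n))) := hy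
    rw [φ.support_normed_eq, mem_ball_zero_iff] at this
    rw [Metric.mem_closedBall, dist_comm, dist_eq_norm]
    exact this.le
  have hτc : HasCompactSupport τ :=
    (isCompact_closedBall x φ.rOut).of_isClosed_subset (isClosed_tsupport τ) hτs
  have hτd : ∀ y, fderiv ℝ τ y v = - fderiv ℝ (φ.normed volume) (x - y) v := fun y => by
    have h1 : HasFDerivAt (fun y : E n => x - y) (-ContinuousLinearMap.id ℝ (E n)) y :=
      (hasFDerivAt_id y).const_sub x
    have h2 := ((hd.differentiable (by simp)) (x - y)).hasFDerivAt.comp y h1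
    have h3 : fderiv ℝ τ y = _ := h2.fderiv
    rw [h3]
    simp
  have hw := h τ hτ hτc (hτs.trans hx) v
  have e1 : ∫ y, fderiv ℝ (φ.normed volume) (x - y) v * Ω.indicator u y =
      - ∫ y in Ω, u y * fderiv ℝ τ y v := by
    rw [← integral_neg, ← integral_indicator hΩ.measurableSet]
    congr 1
    funext y
    by_cases hy : y ∈ Ω
    · rw [Set.indicator_of_mem hy, Set.indicator_of_mem hy, hτd]; ring
    · rw [Set.indicator_of_notMem hy, Set.indicator_of_notMem hy, mul_zero]
  have e2 : inner ℝ (∫ t, φ.normed volume t • Ω.indicator G (x - t)) v =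
      ∫ y in Ω, inner ℝ (G y) v * τ y := by
    rw [real_inner_comm, ← integral_inner (integrable_normed_smul φ hGm x) v,
      ← integral_sub_left_eq_self _ volume x, ← integral_indicator hΩ.measurableSet]
    congr 1
    funext y
    simp only [sub_sub_cancel]
    rw [inner_smul_right, real_inner_comm]
    by_cases hy : y ∈ Ω
    · rw [Set.indicator_of_mem hy, Set.indicator_of_mem hy, mul_comm]
    · rw [Set.indicator_of_notMem hy, Set.indicator_of_notMem hy, inner_zero_left, mul_zero]
  rw [e1, e2, hw, neg_neg]

end WeakGradient

/-! ### Smooth approximation in `H¹` -/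

/-- `(v, V)` is the limit in `H¹(K)` of smooth functions and their gradients. -/
structure H1Approx {n : ℕ} (K : Set (E n)) (v : E n → ℝ) (V : E n → E n) (w : ℕ → E n → ℝ) :
    Prop where
  memLp : MemLp v 2 (volume.restrict K)
  memLp_grad : MemLp V 2 (volume.restrict K)
  contDiff : ∀ k, ContDiff ℝ ∞ (w k)
  tendsto : Tendsto (fun k => eLpNorm (w k - v) 2 (volume.restrict K)) atTop (𝓝 0)
  tendsto_grad : Tendsto (fun k => eLpNorm (gradient (w k) - V) 2 (volume.restrict K)) atTop (𝓝 0)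

section Approx

variable {n : ℕ} {Ω U K L : Set (E n)} {u v : E n → ℝ} {V W : E n → E n} {w z : ℕ → E n → ℝ}

theorem H1Approx.mono (h : H1Approx K v V w) (hLK : L ⊆ K) : H1Approx L v V w := by
  have hm : volume.restrict L ≤ volume.restrict K := Measure.restrict_mono hLK le_rfl
  exact ⟨h.memLp.mono_measure hm, h.memLp_grad.mono_measure hm, h.contDiff,
    tendsto_of_tendsto_of_tendsto_of_le_of_le tendsto_const_nhds h.tendsto (fun _ => zero_le)
      (fun k => eLpNorm_mono_measure _ hm),
    tendsto_of_tendsto_of_tendsto_of_le_of_le tendsto_const_nhds h.tendsto_grad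
      (fun _ => zero_le) (fun k => eLpNorm_mono_measure _ hm)⟩

theorem gradient_sub {f g : E n → ℝ} (hf : Differentiable ℝ f) (hg : Differentiable ℝ g) :
    gradient (f - g) = gradient f - gradient g := by
  funext x
  simp only [gradient, Pi.sub_apply]
  rw [fderiv_sub (hf x) (hg x), map_sub]

theorem continuous_gradient {f : E n → ℝ} (hf : ContDiff ℝ 1 f) : Continuous (gradient f) :=
  (LinearIsometryEquiv.continuous _).comp (hf.continuous_fderiv one_ne_zero)

theorem tendsto_eLpNorm_sub_sub {F : Type*} [NormedAddCommGroup F] {μ : Measure (E n)}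
    {f g : ℕ → E n → F} {f₀ g₀ : E n → F}
    (hf : ∀ k, AEStronglyMeasurable (f k - f₀) μ) (hg : ∀ k, AEStronglyMeasurable (g k - g₀) μ)
    (h1 : Tendsto (fun k => eLpNorm (f k - f₀) 2 μ) atTop (𝓝 0))
    (h2 : Tendsto (fun k => eLpNorm (g k - g₀) 2 μ) atTop (𝓝 0)) :
    Tendsto (fun k => eLpNorm ((f k - g k) - (f₀ - g₀)) 2 μ) atTop (𝓝 0) := by
  have h3 := h1.add h2
  rw [add_zero] at h3
  refine tendsto_of_tendsto_of_tendsto_of_le_of_le tendsto_const_nhds h3 (fun _ => zero_le)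
    fun k => ?_
  have : (f k - g k) - (f₀ - g₀) = (f k - f₀) - (g k - g₀) := by abel
  simp only [this]
  exact eLpNorm_sub_le (hf k) (hg k) one_le_two

theorem H1Approx.sub (hv : H1Approx K v V w) (hu : H1Approx K u W z) :
    H1Approx K (v - u) (V - W) (fun k => w k - z k) := by
  refine ⟨hv.memLp.sub hu.memLp, hv.memLp_grad.sub hu.memLp_grad,
    fun k => (hv.contDiff k).sub (hu.contDiff k), ?_, ?_⟩
  · exact tendsto_eLpNorm_sub_sub
      (fun k => (hv.contDiff k).continuous.aestronglyMeasurable.sub hv.memLp.1)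
      (fun k => (hu.contDiff k).continuous.aestronglyMeasurable.sub hu.memLp.1)
      hv.tendsto hu.tendsto
  · have hgr : ∀ k, gradient (w k - z k) = gradient (w k) - gradient (z k) := fun k =>
      gradient_sub ((hv.contDiff k).differentiable (by simp))
        ((hu.contDiff k).differentiable (by simp))
    simp only [hgr]
    exact tendsto_eLpNorm_sub_sub
      (fun k => (continuous_gradient ((hv.contDiff k).of_le
        (by exact_mod_cast le_top))).aestronglyMeasurable.sub hv.memLp_grad.1)
      (fun k => (continuous_gradient ((hu.contDiff k).of_le
        (by exact_mod_cast le_top))).aestronglyMeasurable.sub hu.memLp_grad.1)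
      hv.tendsto_grad hu.tendsto_grad

theorem memLp_of_continuous_of_isCompact {F : Type*} [NormedAddCommGroup F] {f : E n → F}
    (hf : Continuous f) (hK : IsCompact K) : MemLp f 2 (volume.restrict K) := by
  have : IsFiniteMeasure (volume.restrict K) := ⟨by simpa using hK.measure_lt_top⟩
  obtain ⟨C, hC⟩ := hK.exists_bound_of_continuousOn hf.continuousOn
  refine MemLp.of_bound hf.aestronglyMeasurable C ?_
  filter_upwards [ae_restrict_mem hK.measurableSet] with x hx using hC x hx

/-- Combined with `H1Approx.sub`, this makes the uniform estimates applicable to the difference of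
an `H¹` function and a smooth approximant. -/
theorem H1Approx.const (hK : IsCompact K) {f : E n → ℝ} (hf : ContDiff ℝ ∞ f) :
    H1Approx K f (gradient f) (fun _ => f) :=
  ⟨memLp_of_continuous_of_isCompact hf.continuous hK, memLp_of_continuous_of_isCompact
    (continuous_gradient (hf.of_le (by exact_mod_cast le_top))) hK, fun _ => hf, by simp, by simp⟩

/-- Functions in `H¹(Ω)` are limits of smooth functions on compact subsets of `Ω`. -/
theorem MemH1.exists_h1Approx (hΩ : IsOpen Ω) (hK : IsCompact K) (hKΩ : K ⊆ Ω) (hu : MemH1 Ω u) :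
    ∃ w : ℕ → E n → ℝ, H1Approx K u (weakGradient Ω u) w := by
  have hm : volume.restrict K ≤ volume.restrict Ω := Measure.restrict_mono hKΩ le_rfl
  have hu2 := MemLp.indicator_of_restrict hΩ.measurableSet hu.1
  have hG2 := MemLp.indicator_of_restrict hΩ.measurableSet hu.memLp_weakGradient
  refine ⟨fun k => mollify (bumpSeq n k) (Ω.indicator u), hu.1.mono_measure hm,
    hu.memLp_weakGradient.mono_measure hm,
    fun k => contDiff_mollify _ (hu2.locallyIntegrable one_le_two), ?_, ?_⟩
  · refine tendsto_of_tendsto_of_tendsto_of_le_of_le tendsto_const_nhds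
      (tendsto_eLpNorm_mollify_sub hu2) (fun _ => zero_le) fun k => ?_
    refine le_trans (le_of_eq (eLpNorm_congr_ae ?_)) (eLpNorm_mono_measure _ Measure.restrict_le_self)
    filter_upwards [ae_restrict_mem hK.measurableSet] with x hx
    rw [Pi.sub_apply, Pi.sub_apply, Set.indicator_of_mem (hKΩ hx)]
  · obtain ⟨δ, hδ, hδΩ⟩ := hK.exists_cthickening_subset_open hΩ hKΩ
    refine tendsto_of_tendsto_of_tendsto_of_le_of_le' tendsto_const_nhds
      (tendsto_eLpNorm_mollify_sub hG2) (.of_forall fun _ => zero_le) ?_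
    -- The gradient formula needs the ball of mollification around each point of `K` to fit in `Ω`,
    -- hence only holds for large `k`.
    filter_upwards [(tendsto_bumpSeq_rOut n).eventually_le_const hδ] with k hk
    refine le_trans (le_of_eq (eLpNorm_congr_ae ?_)) (eLpNorm_mono_measure _ Measure.restrict_le_self)
    filter_upwards [ae_restrict_mem hK.measurableSet] with x hx
    rw [Pi.sub_apply, Pi.sub_apply, Set.indicator_of_mem (hKΩ hx),
      hu.isWeakGradient.gradient_mollify hΩ hu.1 hu.memLp_weakGradient]
    refine subset_trans (fun y hy => ?_) hδΩ
    exact Metric.mem_cthickening_of_dist_le _ x _ _ hx ((Metric.mem_closedBall.1 hy).trans hk)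

end Approx

/-! ### The `L²` norm and limits of products -/

section L2

variable {α F : Type*} [MeasurableSpace α] {μ ν : Measure α} [NormedAddCommGroup F]

/-- The `L²` norm as a real number. -/
noncomputable def l2norm (μ : Measure α) (f : α → F) : ℝ := (eLpNorm f 2 μ).toReal

theorem l2norm_nonneg (f : α → F) : 0 ≤ l2norm μ f := ENNReal.toReal_nonneg

theorem integrable_norm_sq {f : α → F} (hf : MemLp f 2 μ) : Integrable (fun x => ‖f x‖ ^ 2) μ :=
  hf.norm.integrable_sq

theorem l2norm_sq {f : α → F} (hf : MemLp f 2 μ) : l2norm μ f ^ 2 = ∫ x, ‖f x‖ ^ 2 ∂μ := by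
  rw [l2norm, ← ENNReal.toReal_pow, eLpNorm_two_sq,
    integral_eq_lintegral_of_nonneg_ae (.of_forall fun x => by positivity)
      (integrable_norm_sq hf).1]
  congr 1
  refine lintegral_congr fun x => ?_
  rw [ENNReal.ofReal_pow (norm_nonneg _), ofReal_norm]

theorem l2norm_mono_measure {f : α → F} (hf : MemLp f 2 ν) (h : μ ≤ ν) :
    l2norm μ f ≤ l2norm ν f :=
  ENNReal.toReal_mono hf.2.ne (eLpNorm_mono_measure f h)

theorem l2norm_add_le {f g : α → F} (hf : MemLp f 2 μ) (hg : MemLp g 2 μ) :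
    l2norm μ (f + g) ≤ l2norm μ f + l2norm μ g := by
  rw [l2norm, l2norm, l2norm, ← ENNReal.toReal_add hf.2.ne hg.2.ne]
  exact ENNReal.toReal_mono (ENNReal.add_ne_top.2 ⟨hf.2.ne, hg.2.ne⟩)
    (eLpNorm_add_le hf.1 hg.1 one_le_two)

theorem l2norm_sub_comm (f g : α → F) : l2norm μ (f - g) = l2norm μ (g - f) := by
  rw [l2norm, l2norm, eLpNorm_sub_comm]

theorem l2norm_sub_le_add {f g : α → F} (hf : MemLp f 2 μ) (hg : MemLp g 2 μ) :
    l2norm μ (f - g) ≤ l2norm μ f + l2norm μ g := by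
  have h := l2norm_add_le hf hg.neg
  rwa [← sub_eq_add_neg, l2norm, l2norm, l2norm, eLpNorm_neg] at h

theorem l2norm_le_add_sub {f g : α → F} (hf : MemLp f 2 μ) (hg : MemLp g 2 μ) :
    l2norm μ f ≤ l2norm μ g + l2norm μ (f - g) := by
  have h := l2norm_add_le hg (hf.sub hg)
  rwa [add_sub_cancel] at h

theorem l2norm_sub_le {f g h : α → F} (hf : MemLp f 2 μ) (hg : MemLp g 2 μ) (hh : MemLp h 2 μ) :
    l2norm μ (f - g) ≤ l2norm μ (f - h) + l2norm μ (g - h) := by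
  have := l2norm_sub_le_add (hf.sub hh) (hg.sub hh)
  rwa [sub_sub_sub_cancel_right] at this

theorem tendsto_l2norm_iff {ι : Type*} {l : Filter ι} {f : ι → α → F} (hf : ∀ i, MemLp (f i) 2 μ) :
    Tendsto (fun i => l2norm μ (f i)) l (𝓝 0) ↔ Tendsto (fun i => eLpNorm (f i) 2 μ) l (𝓝 0) := by
  have h := ENNReal.tendsto_toReal_iff (fi := l) (f := fun i => eLpNorm (f i) 2 μ) (fun i => (hf i).2.ne) ENNReal.zero_ne_top
  rw [ENNReal.toReal_zero] at h
  exact h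

theorem integrable_norm_mul_norm {G : Type*} [NormedAddCommGroup G] {f : α → F} {g : α → G}
    (hf : MemLp f 2 μ) (hg : MemLp g 2 μ) : Integrable (fun x => ‖f x‖ * ‖g x‖) μ :=
  hf.norm.integrable_mul hg.norm

theorem integral_norm_mul_norm_le {G : Type*} [NormedAddCommGroup G] {f : α → F} {g : α → G}
    (hf : MemLp f 2 μ) (hg : MemLp g 2 μ) :
    ∫ x, ‖f x‖ * ‖g x‖ ∂μ ≤ l2norm μ f * l2norm μ g := by
  have h := integral_mul_le_Lp_mul_Lq_of_nonneg (μ := μ) (p := 2) (q := 2)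
    Real.HolderConjugate.two_two (f := fun x => ‖f x‖) (g := fun x => ‖g x‖)
    (.of_forall fun x => norm_nonneg _) (.of_forall fun x => norm_nonneg _)
    (by simpa using hf.norm) (by simpa using hg.norm)
  simp only [Real.rpow_two] at h
  rwa [← l2norm_sq hf, ← l2norm_sq hg, ← Real.sqrt_eq_rpow, ← Real.sqrt_eq_rpow,
    Real.sqrt_sq (l2norm_nonneg f), Real.sqrt_sq (l2norm_nonneg g)] at h

theorem abs_integral_mul_le {f g : α → ℝ} (hf : MemLp f 2 μ) (hg : MemLp g 2 μ) :
    |∫ x, f x * g x ∂μ| ≤ l2norm μ f * l2norm μ g := by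
  refine (abs_integral_le_integral_abs).trans ?_
  simp only [abs_mul]
  exact integral_norm_mul_norm_le hf hg

theorem memLp_bdd_mul {m f : α → ℝ} {M : ℝ} (hm : AEStronglyMeasurable m μ)
    (hM : ∀ᵐ x ∂μ, |m x| ≤ M) (hf : MemLp f 2 μ) : MemLp (fun x => m x * f x) 2 μ := by
  refine (hf.const_mul M).of_le (hm.mul hf.1) ?_
  filter_upwards [hM] with x hx
  rw [norm_mul, norm_mul]
  exact mul_le_mul_of_nonneg_right (hx.trans (le_abs_self M)) (norm_nonneg _)

theorem abs_integral_bdd_mul_mul_le {m f g : α → ℝ} {M : ℝ}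
    (hM : ∀ᵐ x ∂μ, |m x| ≤ M) (hf : MemLp f 2 μ) (hg : MemLp g 2 μ) :
    |∫ x, m x * (f x * g x) ∂μ| ≤ M * (l2norm μ f * l2norm μ g) := by
  -- The almost everywhere bound forces `M ≥ 0` only if the measure is nonzero.
  rcases eq_zero_or_neZero μ with rfl | hne
  · simp [l2norm]
  have hM0 : 0 ≤ M := by
    obtain ⟨x, hx⟩ := hM.exists
    exact (abs_nonneg _).trans hx
  have h1 := integrable_norm_mul_norm hf hg
  calc |∫ x, m x * (f x * g x) ∂μ| ≤ ∫ x, M * (‖f x‖ * ‖g x‖) ∂μ := by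
        rw [← Real.norm_eq_abs]
        refine norm_integral_le_of_norm_le (h1.const_mul M) ?_
        filter_upwards [hM] with x hx
        rw [norm_mul, norm_mul]
        exact mul_le_mul_of_nonneg_right hx (by positivity)
    _ ≤ _ := by
        rw [integral_const_mul]
        exact mul_le_mul_of_nonneg_left (integral_norm_mul_norm_le hf hg) hM0

/-- Convergence of integrals of products of two strongly convergent factors and a bounded, almost
everywhere convergent factor. -/
theorem tendsto_integral_bdd_mul_mul {m : ℕ → α → ℝ} {m₀ : α → ℝ} {M : ℝ} {f g : ℕ → α → ℝ}
    {f₀ g₀ : α → ℝ} (hm : ∀ k, AEStronglyMeasurable (m k) μ) (hM : ∀ k, ∀ᵐ x ∂μ, |m k x| ≤ M)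
    (hlim : ∀ᵐ x ∂μ, Tendsto (fun k => m k x) atTop (𝓝 (m₀ x)))
    (hf : ∀ k, MemLp (f k) 2 μ) (hf₀ : MemLp f₀ 2 μ) (hg : ∀ k, MemLp (g k) 2 μ)
    (hg₀ : MemLp g₀ 2 μ) (hfl : Tendsto (fun k => l2norm μ (f k - f₀)) atTop (𝓝 0))
    (hgl : Tendsto (fun k => l2norm μ (g k - g₀)) atTop (𝓝 0)) :
    Tendsto (fun k => ∫ x, m k x * (f k x * g k x) ∂μ) atTop
      (𝓝 (∫ x, m₀ x * (f₀ x * g₀ x) ∂μ)) := by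
  have hi : ∀ k {a b : α → ℝ}, MemLp a 2 μ → MemLp b 2 μ →
      Integrable (fun x => m k x * (a x * b x)) μ := fun k a b ha hb =>
    (ha.integrable_mul hb).bdd_mul (hm k) (hM k)
  have h1 : Tendsto (fun k => ∫ x, m k x * (f₀ x * g₀ x) ∂μ) atTop
      (𝓝 (∫ x, m₀ x * (f₀ x * g₀ x) ∂μ)) := by
    refine tendsto_integral_of_dominated_convergence (fun x => M * ‖f₀ x * g₀ x‖)
      (fun k => (hi k hf₀ hg₀).1) ((hf₀.integrable_mul hg₀).norm.const_mul M) (fun k => ?_) ?_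
    · filter_upwards [hM k] with x hx
      rw [norm_mul]
      exact mul_le_mul_of_nonneg_right hx (norm_nonneg _)
    · filter_upwards [hlim] with x hx using hx.mul_const _
  have h2 : Tendsto (fun k => ∫ x, m k x * ((f k - f₀) x * g k x) ∂μ) atTop (𝓝 0) := by
    have hb : Tendsto (fun k => M * (l2norm μ (f k - f₀) *
        (l2norm μ g₀ + l2norm μ (g k - g₀)))) atTop (𝓝 0) := by
      have := (hfl.mul (hgl.const_add (l2norm μ g₀))).const_mul M
      simpa using this
    refine squeeze_zero_norm (fun k => ?_) hb
    refine (abs_integral_bdd_mul_mul_le (hM k) ((hf k).sub hf₀) (hg k)).trans ?_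
    rcases eq_zero_or_neZero μ with rfl | hne
    · simp [l2norm]
    have hM0 : 0 ≤ M := by
      obtain ⟨x, hx⟩ := (hM k).exists
      exact (abs_nonneg _).trans hx
    exact mul_le_mul_of_nonneg_left (mul_le_mul_of_nonneg_left (l2norm_le_add_sub (hg k) hg₀)
      (l2norm_nonneg _)) hM0
  have h3 : Tendsto (fun k => ∫ x, m k x * (f₀ x * (g k - g₀) x) ∂μ) atTop (𝓝 0) := by
    have hb : Tendsto (fun k => M * (l2norm μ f₀ * l2norm μ (g k - g₀))) atTop (𝓝 0) := by
      have := (hgl.const_mul (l2norm μ f₀)).const_mul M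
      simpa using this
    exact squeeze_zero_norm (fun k => abs_integral_bdd_mul_mul_le (hM k) hf₀ ((hg k).sub hg₀)) hb
  have h4 := (h2.add h3).add h1
  rw [zero_add, zero_add] at h4
  refine h4.congr fun k => ?_
  have i1 := hi k ((hf k).sub hf₀) (hg k)
  have i2 := hi k hf₀ ((hg k).sub hg₀)
  have i3 : Integrable (fun x => m k x * ((f k - f₀) x * g k x) + m k x * (f₀ x * (g k - g₀) x)) μ :=
    i1.add i2
  rw [← integral_add i1 i2, ← integral_add i3 (hi k hf₀ hg₀)]
  congr 1
  funext x
  simp only [Pi.sub_apply]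
  ring

theorem tendsto_integral_mul {f g : ℕ → α → ℝ} {f₀ g₀ : α → ℝ}
    (hf : ∀ k, MemLp (f k) 2 μ) (hf₀ : MemLp f₀ 2 μ) (hg : ∀ k, MemLp (g k) 2 μ)
    (hg₀ : MemLp g₀ 2 μ) (hfl : Tendsto (fun k => l2norm μ (f k - f₀)) atTop (𝓝 0))
    (hgl : Tendsto (fun k => l2norm μ (g k - g₀)) atTop (𝓝 0)) :
    Tendsto (fun k => ∫ x, f k x * g k x ∂μ) atTop (𝓝 (∫ x, f₀ x * g₀ x ∂μ)) := by
  have := tendsto_integral_bdd_mul_mul (m := fun _ _ => (1 : ℝ)) (m₀ := fun _ => 1) (M := 1)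
    (fun _ => aestronglyMeasurable_const) (fun _ => .of_forall fun _ => by simp)
    (.of_forall fun _ => tendsto_const_nhds) hf hf₀ hg hg₀ hfl hgl
  simpa using this

end L2

/-! ### Approximation expressed in real `L²` norms -/

section H1ApproxNorm

variable {n : ℕ} {K : Set (E n)} {v : E n → ℝ} {V : E n → E n} {w : ℕ → E n → ℝ}

theorem contDiff_one_of_infty {f : E n → ℝ} (hf : ContDiff ℝ ∞ f) : ContDiff ℝ 1 f :=
  hf.of_le (by exact_mod_cast le_top)

theorem memLp_of_continuous_of_isBounded {F : Type*} [NormedAddCommGroup F] {f : E n → F}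
    (hf : Continuous f) (hK : Bornology.IsBounded K) : MemLp f 2 (volume.restrict K) :=
  (memLp_of_continuous_of_isCompact hf hK.isCompact_closure).mono_measure
    (Measure.restrict_mono subset_closure le_rfl)

theorem H1Approx.memLp_seq (h : H1Approx K v V w) (hK : Bornology.IsBounded K) (k : ℕ) :
    MemLp (w k) 2 (volume.restrict K) :=
  memLp_of_continuous_of_isBounded (h.contDiff k).continuous hK

theorem H1Approx.memLp_grad_seq (h : H1Approx K v V w) (hK : Bornology.IsBounded K) (k : ℕ) :
    MemLp (gradient (w k)) 2 (volume.restrict K) :=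
  memLp_of_continuous_of_isBounded (continuous_gradient (contDiff_one_of_infty (h.contDiff k))) hK

theorem H1Approx.tendsto_l2norm (h : H1Approx K v V w) (hK : Bornology.IsBounded K) :
    Tendsto (fun k => l2norm (volume.restrict K) (w k - v)) atTop (𝓝 0) :=
  (tendsto_l2norm_iff fun k => (h.memLp_seq hK k).sub h.memLp).2 h.tendsto

theorem H1Approx.tendsto_l2norm_grad (h : H1Approx K v V w) (hK : Bornology.IsBounded K) :
    Tendsto (fun k => l2norm (volume.restrict K) (gradient (w k) - V)) atTop (𝓝 0) :=
  (tendsto_l2norm_iff fun k => (h.memLp_grad_seq hK k).sub h.memLp_grad).2 h.tendsto_grad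

theorem integral_sq_add_mul_le {μ : Measure (E n)} (hv : MemLp v 2 μ) (hV : MemLp V 2 μ) :
    ∫ x, (v x ^ 2 + |v x| * ‖V x‖) ∂μ ≤ l2norm μ v * (l2norm μ v + l2norm μ V) := by
  have hi : Integrable (fun x => |v x| * ‖V x‖) μ := integrable_norm_mul_norm hv hV
  rw [integral_add hv.integrable_sq hi]
  have h1 := l2norm_sq hv
  have h2 := integral_norm_mul_norm_le hv hV
  simp only [Real.norm_eq_abs, sq_abs] at h1 h2
  nlinarith

end H1ApproxNorm

/-! ### The diffuse trace seminorm -/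

section DiffuseTrace

variable {n : ℕ} {U Ω : Set (E n)} {c : ℝ}

/-- The density, weighted by the cutoff, of the diffuse surface measure. -/
noncomputable def BoundaryPartition.weight (P : BoundaryPartition U Ω c) (ε : ℝ) (x : E n) : ℝ :=
  P.cutoff x * ‖gradient (phase U ε) x‖

variable (P : BoundaryPartition U Ω c)

theorem BoundaryPartition.weight_nonneg (ε : ℝ) (x : E n) : 0 ≤ P.weight ε x :=
  mul_nonneg (P.cutoff_nonneg x) (norm_nonneg _)

theorem BoundaryPartition.measurable_weight (ε : ℝ) : Measurable (P.weight ε) :=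
  P.continuous_cutoff.measurable.mul (measurable_norm_gradient _)

theorem BoundaryPartition.ae_weight_le {ε : ℝ} (hε : 0 < ε) :
    ∀ᵐ x : E n, |P.weight ε x| ≤ ε⁻¹ := by
  filter_upwards [norm_gradient_phase_le_inv (U := U) hε] with x hx
  rw [abs_of_nonneg (P.weight_nonneg ε x)]
  exact (mul_le_of_le_one_left (norm_nonneg _) (P.cutoff_le_one x)).trans hx

/-- The seminorm `(∫ cutoff v² |∇φ_ε|)^{1/2}`. -/
noncomputable def BoundaryPartition.diffuseNorm (ε : ℝ) (v : E n → ℝ) : ℝ :=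
  l2norm (volume.restrict P.carrier) (fun x => √(P.weight ε x) * v x)

theorem BoundaryPartition.memLp_sqrt_weight_mul {ε : ℝ} (hε : 0 < ε) {v : E n → ℝ}
    (hv : MemLp v 2 (volume.restrict P.carrier)) :
    MemLp (fun x => √(P.weight ε x) * v x) 2 (volume.restrict P.carrier) := by
  refine memLp_bdd_mul (M := √ε⁻¹) (P.measurable_weight ε).sqrt.aestronglyMeasurable ?_ hv
  filter_upwards [ae_restrict_of_ae (P.ae_weight_le hε)] with x hx
  rw [abs_of_nonneg (Real.sqrt_nonneg _)]
  exact Real.sqrt_le_sqrt ((le_abs_self _).trans hx)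

theorem BoundaryPartition.diffuseNorm_nonneg (ε : ℝ) (v : E n → ℝ) : 0 ≤ P.diffuseNorm ε v :=
  l2norm_nonneg _

theorem BoundaryPartition.diffuseNorm_sq {ε : ℝ} (hε : 0 < ε) {v : E n → ℝ}
    (hv : MemLp v 2 (volume.restrict P.carrier)) :
    P.diffuseNorm ε v ^ 2 = ∫ x in P.carrier, P.weight ε x * (v x * v x) := by
  rw [BoundaryPartition.diffuseNorm, l2norm_sq (P.memLp_sqrt_weight_mul hε hv)]
  congr 1
  funext x
  rw [Real.norm_eq_abs, sq_abs, mul_pow, Real.sq_sqrt (P.weight_nonneg ε x), sq]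

theorem BoundaryPartition.abs_integral_weight_le {ε : ℝ} (hε : 0 < ε) {v w : E n → ℝ}
    (hv : MemLp v 2 (volume.restrict P.carrier)) (hw : MemLp w 2 (volume.restrict P.carrier)) :
    |∫ x in P.carrier, P.weight ε x * (v x * w x)| ≤ P.diffuseNorm ε v * P.diffuseNorm ε w := by
  have h := abs_integral_mul_le (P.memLp_sqrt_weight_mul hε hv) (P.memLp_sqrt_weight_mul hε hw)
  have e : ∀ x, √(P.weight ε x) * v x * (√(P.weight ε x) * w x) = P.weight ε x * (v x * w x) :=
    fun x => by
      rw [mul_mul_mul_comm, Real.mul_self_sqrt (P.weight_nonneg ε x)]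
  simp only [e] at h
  exact h

theorem BoundaryPartition.setIntegral_carrier {W : Set (E n)} (hW : P.carrier ⊆ W) (ε : ℝ)
    (f : E n → ℝ) : ∫ x in P.carrier, P.weight ε x * f x = ∫ x in W, P.weight ε x * f x := by
  have h0 : ∀ x, x ∉ P.carrier → P.weight ε x * f x = 0 := fun x hx => by
    rw [BoundaryPartition.weight, P.cutoff_eq_zero hx, zero_mul, zero_mul]
  rw [setIntegral_eq_integral_of_forall_compl_eq_zero h0,
    setIntegral_eq_integral_of_forall_compl_eq_zero fun x hx => h0 x fun h => hx (hW h)]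

theorem BoundaryPartition.integral_weight_eq (ε : ℝ) (f : E n → ℝ) :
    ∫ x in P.carrier, P.weight ε x * f x = ∫ x, P.cutoff x * (f x * ‖gradient (phase U ε) x‖) := by
  rw [P.setIntegral_carrier (Set.subset_univ _), Measure.restrict_univ]
  congr 1
  funext x
  rw [BoundaryPartition.weight]; ring

/-- The smooth estimate passes to the limit at fixed `ε`, where the weight is bounded by `ε⁻¹`. The
constant `C` does not depend on `ε` and survives. -/
theorem BoundaryPartition.exists_diffuseNorm_bound :
    ∃ C : ℝ, 0 ≤ C ∧ ∀ ε > 0, ∀ v V w, H1Approx P.carrier v V w →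
      P.diffuseNorm ε v ^ 2 ≤ C * (l2norm (volume.restrict P.carrier) v *
        (l2norm (volume.restrict P.carrier) v + l2norm (volume.restrict P.carrier) V)) := by
  obtain ⟨C, hC0, hC⟩ := P.exists_diffuse_trace_bound
  refine ⟨C, hC0, fun ε hε v V w h => ?_⟩
  have hb := P.isCompact_carrier.isBounded
  set μ := volume.restrict P.carrier with hμ
  have hw := h.memLp_seq hb
  have hgw := h.memLp_grad_seq hb
  have hl := h.tendsto_l2norm hb
  have hlg := h.tendsto_l2norm_grad hb
  have lim1 : Tendsto (fun k => ∫ x, P.weight ε x * (w k x * w k x) ∂μ) atTop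
      (𝓝 (∫ x, P.weight ε x * (v x * v x) ∂μ)) :=
    tendsto_integral_bdd_mul_mul (m := fun _ => P.weight ε) (M := ε⁻¹)
      (fun _ => (P.measurable_weight ε).aestronglyMeasurable)
      (fun _ => ae_restrict_of_ae (P.ae_weight_le hε))
      (.of_forall fun _ => tendsto_const_nhds) hw h.memLp hw h.memLp hl hl
  have lim2 : Tendsto (fun k => C * ((l2norm μ v + l2norm μ (w k - v)) *
      ((l2norm μ v + l2norm μ (w k - v)) + (l2norm μ V + l2norm μ (gradient (w k) - V))))) atTop
      (𝓝 (C * ((l2norm μ v + 0) * ((l2norm μ v + 0) + (l2norm μ V + 0))))) :=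
    ((hl.const_add _).mul ((hl.const_add _).add (hlg.const_add _))).const_mul C
  rw [P.diffuseNorm_sq hε h.memLp]
  have := le_of_tendsto_of_tendsto' lim1 lim2 fun k => by
    have h1 := hC ε hε (w k) (contDiff_one_of_infty (h.contDiff k))
    have h2 : ∫ x, P.weight ε x * (w k x * w k x) ∂μ =
        ∫ x, P.cutoff x * (w k x ^ 2 * ‖gradient (phase U ε) x‖) := by
      rw [hμ, P.integral_weight_eq]
      simp only [sq]
    rw [h2]
    refine h1.trans (mul_le_mul_of_nonneg_left ?_ hC0)
    refine (integral_sq_add_mul_le (hw k) (hgw k)).trans ?_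
    have a1 := l2norm_le_add_sub (hw k) h.memLp
    have a2 := l2norm_le_add_sub (hgw k) h.memLp_grad
    have b1 := l2norm_nonneg (μ := μ) (w k)
    have b2 := l2norm_nonneg (μ := μ) (gradient (w k))
    exact mul_le_mul a1 (add_le_add a1 a2) (by positivity) (b1.trans a1)
  simpa using this

end DiffuseTrace

/-! ### Existence and characterization of traces -/

section Trace

variable {n : ℕ} {U Ω : Set (E n)} {c : ℝ} {u v : E n → ℝ} {V : E n → E n} {w z : ℕ → E n → ℝ}

theorem memLp_surfaceMeasure (hbdd : Bornology.IsBounded U) [IsFiniteMeasure (surfaceMeasure U)]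
    {f : E n → ℝ} (hf : Continuous f) : MemLp f 2 (surfaceMeasure U) := by
  have hc : IsCompact (frontier U) :=
    hbdd.isCompact_closure.of_isClosed_subset isClosed_frontier frontier_subset_closure
  obtain ⟨C, hC⟩ := hc.exists_bound_of_continuousOn hf.continuousOn
  refine MemLp.of_bound hf.aestronglyMeasurable C ?_
  filter_upwards [ae_surfaceMeasure_mem_frontier U] with x hx using hC x hx

/-- The trace inequality in terms of norms. -/
theorem BoundaryPartition.exists_trace_norm_bound (P : BoundaryPartition U Ω c)
    (hbdd : Bornology.IsBounded U) :
    ∃ C : ℝ, 0 ≤ C ∧ ∀ v : E n → ℝ, ContDiff ℝ 1 v →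
      l2norm (surfaceMeasure U) v ≤ C * (l2norm (volume.restrict U) v +
        l2norm (volume.restrict U) (gradient v)) := by
  have := P.isFiniteMeasure_surfaceMeasure
  obtain ⟨C, hC0, hC⟩ := P.exists_trace_bound hbdd
  refine ⟨√C, Real.sqrt_nonneg _, fun v hv => ?_⟩
  have h1 := hC v hv
  have hm := memLp_of_continuous_of_isBounded hv.continuous hbdd
  have hg := memLp_of_continuous_of_isBounded (continuous_gradient hv) hbdd
  have h2 := integral_sq_add_mul_le hm hg
  have h3 := l2norm_sq (memLp_surfaceMeasure hbdd hv.continuous)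
  simp only [Real.norm_eq_abs, sq_abs] at h3
  set a := l2norm (volume.restrict U) v
  set b := l2norm (volume.restrict U) (gradient v)
  have ha : 0 ≤ a := l2norm_nonneg _
  have hb : 0 ≤ b := l2norm_nonneg _
  refine abs_le_of_sq_le_sq' ?_ (by positivity) |>.2
  rw [h3, mul_pow, Real.sq_sqrt hC0]
  refine h1.trans (mul_le_mul_of_nonneg_left (h2.trans ?_) hC0)
  nlinarith

/-- The trace inequality applied to differences. With `w = z` it gives the Cauchy property, hence
existence of traces; with two sequences it gives independence of the approximation. -/
theorem BoundaryPartition.tendsto_l2norm_surface_sub (P : BoundaryPartition U Ω c)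
    (hbdd : Bornology.IsBounded U) (hw : H1Approx U v V w) (hz : H1Approx U v V z) :
    Tendsto (fun q : ℕ × ℕ => l2norm (surfaceMeasure U) (w q.1 - z q.2)) (atTop ×ˢ atTop)
      (𝓝 0) := by
  obtain ⟨C, hC0, hC⟩ := P.exists_trace_norm_bound hbdd
  have l1 := (hw.tendsto_l2norm hbdd).comp (tendsto_fst (f := (atTop : Filter ℕ)) (g := (atTop : Filter ℕ)))
  have l2 := (hz.tendsto_l2norm hbdd).comp (tendsto_snd (f := (atTop : Filter ℕ)) (g := (atTop : Filter ℕ)))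
  have l3 := (hw.tendsto_l2norm_grad hbdd).comp
    (tendsto_fst (f := (atTop : Filter ℕ)) (g := (atTop : Filter ℕ)))
  have l4 := (hz.tendsto_l2norm_grad hbdd).comp
    (tendsto_snd (f := (atTop : Filter ℕ)) (g := (atTop : Filter ℕ)))
  have l5 := ((l1.add l2).add (l3.add l4)).const_mul C
  simp only [add_zero, mul_zero] at l5
  refine squeeze_zero (fun _ => l2norm_nonneg _) (fun q => ?_) l5
  have hd := (hw.contDiff q.1).sub (hz.contDiff q.2)
  refine (hC _ (contDiff_one_of_infty hd)).trans (mul_le_mul_of_nonneg_left (add_le_add ?_ ?_) hC0)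
  · exact l2norm_sub_le (hw.memLp_seq hbdd _) (hz.memLp_seq hbdd _) hw.memLp
  · have := gradient_sub ((hw.contDiff q.1).differentiable (by simp))
      ((hz.contDiff q.2).differentiable (by simp))
    have e : gradient (fun x => w q.1 x - z q.2 x) = gradient (w q.1) - gradient (z q.2) := this
    rw [e]
    exact l2norm_sub_le (hw.memLp_grad_seq hbdd _) (hz.memLp_grad_seq hbdd _) hw.memLp_grad

theorem BoundaryPartition.exists_boundary_limit (P : BoundaryPartition U Ω c)
    (hbdd : Bornology.IsBounded U) (hw : H1Approx U v V w) :
    ∃ t, MemLp t 2 (surfaceMeasure U) ∧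
      Tendsto (fun k => l2norm (surfaceMeasure U) (w k - t)) atTop (𝓝 0) := by
  have := P.isFiniteMeasure_surfaceMeasure
  have hm : ∀ k, MemLp (w k) 2 (surfaceMeasure U) := fun k =>
    memLp_surfaceMeasure hbdd (hw.contDiff k).continuous
  have hcau : CauchySeq fun k => (hm k).toLp (w k) := by
    rw [Lp.cauchySeq_Lp_iff_cauchySeq_eLpNorm, ← prod_atTop_atTop_eq]
    have h1 := (tendsto_l2norm_iff fun q : ℕ × ℕ => (hm q.1).sub (hm q.2)).1
      (P.tendsto_l2norm_surface_sub hbdd hw hw)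
    refine h1.congr fun q => eLpNorm_congr_ae ?_
    exact ((hm q.1).coeFn_toLp.sub (hm q.2).coeFn_toLp).symm
  obtain ⟨t, ht⟩ := cauchySeq_tendsto_of_complete hcau
  refine ⟨t, Lp.memLp t, ?_⟩
  rw [tendsto_l2norm_iff fun k => (hm k).sub (Lp.memLp t)]
  rw [Lp.tendsto_Lp_iff_tendsto_eLpNorm'] at ht
  refine ht.congr fun k => eLpNorm_congr_ae ?_
  exact (hm k).coeFn_toLp.sub (ae_eq_refl _)

theorem tendsto_diag_of_prod {F : ℕ × ℕ → ℝ} {y : ℝ}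
    (h : Tendsto F (atTop ×ˢ atTop) (𝓝 y)) : Tendsto (fun k => F (k, k)) atTop (𝓝 y) := by
  have hk : Tendsto (fun k : ℕ => (k, k)) atTop (atTop ×ˢ atTop) := tendsto_id.prodMk tendsto_id
  exact h.comp hk

theorem BoundaryPartition.tendsto_l2norm_surface_sub_diag (P : BoundaryPartition U Ω c)
    (hbdd : Bornology.IsBounded U) (hw : H1Approx U v V w) (hz : H1Approx U v V z) :
    Tendsto (fun k => l2norm (surfaceMeasure U) (w k - z k)) atTop (𝓝 0) := by
  have h : Tendsto (fun q : ℕ × ℕ => l2norm (surfaceMeasure U) (w q.1 - z q.2))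
      (atTop ×ˢ atTop) (𝓝 0) := P.tendsto_l2norm_surface_sub hbdd hw hz
  exact tendsto_diag_of_prod h

theorem isTrace_trace (h : ∃ t, IsTrace U u t) : IsTrace U u (trace U u) := by
  rw [trace, dif_pos h]
  exact h.choose_spec

/-- The trace is the limit in `L²(∂U)` of every sequence of smooth functions converging in
`H¹(U)`. -/
theorem BoundaryPartition.trace_spec (P : BoundaryPartition U Ω c) (hUo : IsOpen U)
    (hbdd : Bornology.IsBounded U) (hsub : U ⊆ Ω) (hu : MemH1 Ω u)
    (hw : H1Approx U u (weakGradient Ω u) w) :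
    MemLp (trace U u) 2 (surfaceMeasure U) ∧
      Tendsto (fun k => l2norm (surfaceMeasure U) (w k - trace U u)) atTop (𝓝 0) := by
  have := P.isFiniteMeasure_surfaceMeasure
  have hae := hu.weakGradient_ae_eq hUo hsub
  have hm : ∀ {z : ℕ → E n → ℝ}, (∀ k, ContDiff ℝ ∞ (z k)) → ∀ k, MemLp (z k) 2 (surfaceMeasure U) :=
    fun hz k => memLp_surfaceMeasure hbdd (hz k).continuous
  have hgrad : ∀ z : ℕ → E n → ℝ, (fun k => eLpNorm (gradient (z k) - weakGradient U u) 2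
      (volume.restrict U)) = fun k => eLpNorm (gradient (z k) - weakGradient Ω u) 2
      (volume.restrict U) := fun z => by
    funext k
    refine eLpNorm_congr_ae ?_
    filter_upwards [hae] with x hx
    rw [Pi.sub_apply, Pi.sub_apply, hx]
  have hex : ∃ t, IsTrace U u t := by
    obtain ⟨t, ht, htl⟩ := P.exists_boundary_limit hbdd hw
    refine ⟨t, hu.mono hsub, ht, w, hw.contDiff, hw.tendsto, ?_, ?_⟩
    · rw [hgrad]; exact hw.tendsto_grad
    · exact (tendsto_l2norm_iff fun k => (hm hw.contDiff k).sub ht).1 htl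
  -- The chosen trace comes with its own approximating sequence `z`, which is then compared with
  -- `w`.
  obtain ⟨-, ht, z, hz, hz1, hz2, hz3⟩ := isTrace_trace hex
  refine ⟨ht, ?_⟩
  rw [hgrad] at hz2
  have hzA : H1Approx U u (weakGradient Ω u) z := ⟨hw.memLp, hw.memLp_grad, hz, hz1, hz2⟩
  have h3 := (tendsto_l2norm_iff fun k => (hm hz k).sub ht).2 hz3
  have hdiag := P.tendsto_l2norm_surface_sub_diag hbdd hw hzA
  have h5 := hdiag.add h3
  rw [add_zero] at h5
  refine squeeze_zero (fun _ => l2norm_nonneg _) (fun k => ?_) h5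
  have := l2norm_add_le ((hm hw.contDiff k).sub (hm hz k)) ((hm hz k).sub ht)
  rwa [sub_add_sub_cancel] at this

end Trace

/-- Interchange of limits: the error `δ j` does not depend on `k`. -/
theorem tendsto_of_uniform_approx {a : ℕ → ℝ} {b : ℕ → ℕ → ℝ} {l δ : ℕ → ℝ} {L : ℝ}
    (hδ : Tendsto δ atTop (𝓝 0)) (h : ∀ j k, |a k - b j k| ≤ δ j)
    (hb : ∀ j, Tendsto (b j) atTop (𝓝 (l j))) (hl : Tendsto l atTop (𝓝 L)) :
    Tendsto a atTop (𝓝 L) := by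
  rw [Metric.tendsto_atTop']
  intro η hη
  have h1 := (tendsto_order.1 hδ).2 (η / 3) (by positivity)
  have h2 := (Metric.tendsto_nhds.1 hl) (η / 3) (by positivity)
  obtain ⟨j, hj1, hj2⟩ := (h1.and h2).exists
  have h3 := (Metric.tendsto_nhds.1 (hb j)) (η / 3) (by positivity)
  obtain ⟨K, hK⟩ := eventually_atTop.1 h3
  refine ⟨K, fun k hk => ?_⟩
  have h4 := hK k hk.le
  have h5 := h j k
  rw [Real.dist_eq] at *
  have e : a k - L = (a k - b j k) + (b j k - l j) + (l j - L) := by ring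
  rw [e]
  refine (abs_add_three _ _ _).trans_lt ?_
  linarith

/-! ### Convergence and bounds for the diffuse boundary term -/

section BoundaryTerm

variable {n : ℕ} {U Ω : Set (E n)} {c : ℝ} {u v g : E n → ℝ} {V G : E n → E n}
  {w gs : ℕ → E n → ℝ}

theorem BoundaryPartition.contDiff_cutoff (P : BoundaryPartition U Ω c) : ContDiff ℝ ∞ P.cutoff :=
  ContDiff.sum fun i _ => P.contDiff i

theorem BoundaryPartition.hasCompactSupport_cutoff (P : BoundaryPartition U Ω c) :
    HasCompactSupport P.cutoff :=
  HasCompactSupport.intro P.isCompact_carrier fun _ hx => P.cutoff_eq_zero hx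

theorem BoundaryPartition.integrable_weight_mul (P : BoundaryPartition U Ω c) {ε : ℝ} (hε : 0 < ε)
    (hu : MemLp u 2 (volume.restrict P.carrier)) (hv : MemLp v 2 (volume.restrict P.carrier)) :
    Integrable (fun x => P.weight ε x * (u x * v x)) (volume.restrict P.carrier) :=
  (hu.integrable_mul hv).bdd_mul (P.measurable_weight ε).aestronglyMeasurable
    (ae_restrict_of_ae (P.ae_weight_le hε))

/-- The diffuse seminorm is bounded by the `H¹` norm, uniformly in `ε`. -/
theorem BoundaryPartition.exists_diffuseNorm_le (P : BoundaryPartition U Ω c) :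
    ∃ A : ℝ, 0 ≤ A ∧ ∀ ε > 0, ∀ v V w, H1Approx P.carrier v V w → P.diffuseNorm ε v ≤
      A * (l2norm (volume.restrict P.carrier) v + l2norm (volume.restrict P.carrier) V) := by
  obtain ⟨C, hC0, hC⟩ := P.exists_diffuseNorm_bound
  refine ⟨√C, Real.sqrt_nonneg _, fun ε hε v V w h => ?_⟩
  have h1 := hC ε hε v V w h
  have hN := l2norm_nonneg (μ := volume.restrict P.carrier) v
  have hD := l2norm_nonneg (μ := volume.restrict P.carrier) V
  refine abs_le_of_sq_le_sq' ?_ (by positivity) |>.2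
  rw [mul_pow, Real.sq_sqrt hC0]
  refine h1.trans (mul_le_mul_of_nonneg_left ?_ hC0)
  rw [sq]
  exact mul_le_mul_of_nonneg_right (by linarith) (by positivity)

/-- Weak convergence applied to the nonnegative, compactly supported function `cutoff · u²`; the
cutoff is one on the frontier. -/
theorem BoundaryPartition.tendsto_integral_weight_sq (P : BoundaryPartition U Ω c) {k : ℕ∞}
    (hk : 1 ≤ k) (hn : 1 ≤ n) (hU : HasCkBoundary k U) (hUo : IsOpen U)
    (hcpt : IsCompact (frontier U)) (hne : (frontier U).Nonempty) (hu : ContDiff ℝ ∞ u)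
    {e : ℕ → ℝ} (he : Tendsto e atTop (𝓝 0)) (hpos : ∀ k, 0 < e k) :
    Tendsto (fun k => ∫ x in P.carrier, P.weight (e k) x * (u x * u x)) atTop
      (𝓝 (∫ x, u x * u x ∂surfaceMeasure U)) := by
  have hc : ContDiff ℝ ∞ fun x => P.cutoff x * (u x * u x) := P.contDiff_cutoff.mul (hu.mul hu)
  have h := tendsto_integral_mul_norm_gradient_phase hk hn hU hUo hcpt hne
    (contDiff_one_of_infty hc) (P.hasCompactSupport_cutoff.mul_right)
    (fun x => mul_nonneg (P.cutoff_nonneg x) (mul_self_nonneg _)) he hpos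
  have e1 : ∫ x, P.cutoff x * (u x * u x) ∂surfaceMeasure U =
      ∫ x, u x * u x ∂surfaceMeasure U := by
    refine integral_congr_ae ?_
    filter_upwards [ae_surfaceMeasure_mem_frontier U] with x hx
    rw [P.cutoff_eq_one_of_mem_frontier hx, one_mul]
  rw [e1] at h
  refine h.congr fun k => ?_
  rw [P.integral_weight_eq]
  simp only [mul_assoc]

/-- Polarization, since the weak convergence is stated for nonnegative functions. -/
theorem BoundaryPartition.tendsto_integral_weight_mul (P : BoundaryPartition U Ω c) {k : ℕ∞}
    (hk : 1 ≤ k) (hn : 1 ≤ n) (hU : HasCkBoundary k U) (hUo : IsOpen U)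
    (hbdd : Bornology.IsBounded U) (hne : (frontier U).Nonempty) (hu : ContDiff ℝ ∞ u)
    (hv : ContDiff ℝ ∞ v) {e : ℕ → ℝ} (he : Tendsto e atTop (𝓝 0)) (hpos : ∀ k, 0 < e k) :
    Tendsto (fun k => ∫ x in P.carrier, P.weight (e k) x * (u x * v x)) atTop
      (𝓝 (∫ x, u x * v x ∂surfaceMeasure U)) := by
  have := P.isFiniteMeasure_surfaceMeasure
  have hcpt : IsCompact (frontier U) :=
    hbdd.isCompact_closure.of_isClosed_subset isClosed_frontier frontier_subset_closure
  have h1 := P.tendsto_integral_weight_sq hk hn hU hUo hcpt hne (hu.add hv) he hpos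
  have h2 := P.tendsto_integral_weight_sq hk hn hU hUo hcpt hne (hu.sub hv) he hpos
  have h3 := (h1.sub h2).const_mul (1 / 4)
  have hm := fun {f : E n → ℝ} (hf : ContDiff ℝ ∞ f) =>
    memLp_of_continuous_of_isCompact hf.continuous P.isCompact_carrier
  have hs := fun {f : E n → ℝ} (hf : ContDiff ℝ ∞ f) => memLp_surfaceMeasure hbdd hf.continuous
  convert h3 using 2
  · rw [← integral_sub (P.integrable_weight_mul (hpos _) (hm (hu.add hv)) (hm (hu.add hv)))
      (P.integrable_weight_mul (hpos _) (hm (hu.sub hv)) (hm (hu.sub hv))), ← integral_const_mul]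
    congr 1
    funext x
    ring
  · have hi := fun {f : E n → ℝ} (hf : ContDiff ℝ ∞ f) =>
      show Integrable (fun x => f x * f x) (surfaceMeasure U) from (hs hf).integrable_mul (hs hf)
    rw [← integral_sub (hi (hu.add hv)) (hi (hu.sub hv)), ← integral_const_mul]
    congr 1
    funext x
    ring

theorem BoundaryPartition.abs_integral_weight_sub_le (P : BoundaryPartition U Ω c) {ε : ℝ}
    (hε : 0 < ε) {u' v' : E n → ℝ}
    (hu : MemLp u 2 (volume.restrict P.carrier)) (hv : MemLp v 2 (volume.restrict P.carrier))
    (hu' : MemLp u' 2 (volume.restrict P.carrier))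
    (hv' : MemLp v' 2 (volume.restrict P.carrier)) :
    |(∫ x in P.carrier, P.weight ε x * (u x * v x)) -
      ∫ x in P.carrier, P.weight ε x * (u' x * v' x)| ≤
    P.diffuseNorm ε (u - u') * P.diffuseNorm ε v + P.diffuseNorm ε u' * P.diffuseNorm ε (v - v') := by
  have e : (∫ x in P.carrier, P.weight ε x * (u x * v x)) -
      ∫ x in P.carrier, P.weight ε x * (u' x * v' x) =
      (∫ x in P.carrier, P.weight ε x * ((u - u') x * v x)) +
      ∫ x in P.carrier, P.weight ε x * (u' x * (v - v') x) := by
    rw [← integral_sub (P.integrable_weight_mul hε hu hv) (P.integrable_weight_mul hε hu' hv'),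
      ← integral_add (P.integrable_weight_mul hε (hu.sub hu') hv)
        (P.integrable_weight_mul hε hu' (hv.sub hv'))]
    congr 1
    funext x
    simp only [Pi.sub_apply]
    ring
  rw [e]
  exact (abs_add_le _ _).trans (add_le_add (P.abs_integral_weight_le hε (hu.sub hu') hv)
    (P.abs_integral_weight_le hε hu' (hv.sub hv')))

/-- Replacing `g` and `u` by smooth approximants costs an error controlled uniformly in `ε` by the
diffuse trace bound. The approximation is on `P.carrier ∪ closure U`, so that one sequence serves
both the diffuse integrals and the trace. -/
theorem BoundaryPartition.tendsto_integral_weight_trace (P : BoundaryPartition U Ω c) {k : ℕ∞}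
    (hk : 1 ≤ k) (hn : 1 ≤ n) (hU : HasCkBoundary k U) (hUo : IsOpen U) (hΩ : IsOpen Ω)
    (hbdd : Bornology.IsBounded U) (hne : (frontier U).Nonempty) (hsub : closure U ⊆ Ω)
    (hg : MemH1 Ω g) (hu : MemH1 Ω u)
    {e : ℕ → ℝ} (he : Tendsto e atTop (𝓝 0)) (hpos : ∀ k, 0 < e k) :
    Tendsto (fun k => ∫ x in P.carrier, P.weight (e k) x * (g x * u x)) atTop
      (𝓝 (∫ x, trace U g x * trace U u x ∂surfaceMeasure U)) := by
  have := P.isFiniteMeasure_surfaceMeasure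
  have hKc : IsCompact (P.carrier ∪ closure U) := P.isCompact_carrier.union hbdd.isCompact_closure
  have hKΩ : P.carrier ∪ closure U ⊆ Ω := Set.union_subset P.carrier_subset hsub
  obtain ⟨gs, hgs⟩ := hg.exists_h1Approx hΩ hKc hKΩ
  obtain ⟨us, hus⟩ := hu.exists_h1Approx hΩ hKc hKΩ
  have hUsub : U ⊆ P.carrier ∪ closure U := subset_closure.trans Set.subset_union_right
  obtain ⟨htg, hlg⟩ := P.trace_spec hUo hbdd (subset_closure.trans hsub) hg (hgs.mono hUsub)
  obtain ⟨htu, hlu⟩ := P.trace_spec hUo hbdd (subset_closure.trans hsub) hu (hus.mono hUsub)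
  have hgP := hgs.mono (Set.subset_union_left (t := closure U))
  have huP := hus.mono (Set.subset_union_left (t := closure U))
  have hb := P.isCompact_carrier.isBounded
  obtain ⟨A, hA0, hA⟩ := P.exists_diffuseNorm_le
  set μ := volume.restrict P.carrier
  let dg : ℕ → ℝ := fun j => l2norm μ (gs j - g) + l2norm μ (gradient (gs j) - weakGradient Ω g)
  let du : ℕ → ℝ := fun j => l2norm μ (us j - u) + l2norm μ (gradient (us j) - weakGradient Ω u)
  have hdg : Tendsto dg atTop (𝓝 0) := by
    simpa using (hgP.tendsto_l2norm hb).add (hgP.tendsto_l2norm_grad hb)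
  have hdu : Tendsto du atTop (𝓝 0) := by
    simpa using (huP.tendsto_l2norm hb).add (huP.tendsto_l2norm_grad hb)
  let ng := l2norm μ g + l2norm μ (weakGradient Ω g)
  let nu := l2norm μ u + l2norm μ (weakGradient Ω u)
  have hδ : Tendsto (fun j => A * dg j * (A * nu) + A * (ng + dg j) * (A * du j)) atTop (𝓝 0) := by
    have := ((hdg.const_mul A).mul_const (A * nu)).add
      (((hdg.const_add ng).const_mul A).mul (hdu.const_mul A))
    simpa using this
  refine tendsto_of_uniform_approx (l := fun j => ∫ x, gs j x * us j x ∂surfaceMeasure U) hδ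
    (b := fun j k => ∫ x in P.carrier, P.weight (e k) x * (gs j x * us j x)) (fun j k => ?_)
    (fun j => P.tendsto_integral_weight_mul hk hn hU hUo hbdd hne (hgs.contDiff j)
      (hus.contDiff j) he hpos) ?_
  · have hgj := H1Approx.const P.isCompact_carrier (hgs.contDiff j)
    have huj := H1Approx.const P.isCompact_carrier (hus.contDiff j)
    refine (P.abs_integral_weight_sub_le (hpos k) hgP.memLp huP.memLp hgj.memLp huj.memLp).trans ?_
    have b1 := hA _ (hpos k) _ _ _ (hgP.sub hgj)
    have b2 := hA _ (hpos k) _ _ _ huP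
    have b3 := hA _ (hpos k) _ _ _ hgj
    have b4 := hA _ (hpos k) _ _ _ (huP.sub huj)
    rw [l2norm_sub_comm, l2norm_sub_comm (weakGradient Ω g)] at b1
    rw [l2norm_sub_comm, l2norm_sub_comm (weakGradient Ω u)] at b4
    have c1 := l2norm_le_add_sub hgj.memLp hgP.memLp
    have c2 := l2norm_le_add_sub hgj.memLp_grad hgP.memLp_grad
    have b3' : P.diffuseNorm (e k) (gs j) ≤ A * (ng + dg j) :=
      b3.trans (mul_le_mul_of_nonneg_left (by simp only [ng, dg]; linarith) hA0)
    have s1 := P.diffuseNorm_nonneg (e k) u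
    have s2 := P.diffuseNorm_nonneg (e k) (gs j)
    have s3 := P.diffuseNorm_nonneg (e k) (g - gs j)
    have s4 := P.diffuseNorm_nonneg (e k) (u - us j)
    exact add_le_add (mul_le_mul b1 b2 s1 (s3.trans b1)) (mul_le_mul b3' b4 s4 (s2.trans b3'))
  · exact tendsto_integral_mul
      (fun j => memLp_surfaceMeasure hbdd (hgs.contDiff j).continuous) htg
      (fun j => memLp_surfaceMeasure hbdd (hus.contDiff j).continuous) htu hlg hlu

theorem BoundaryPartition.integral_split (P : BoundaryPartition U Ω c) {ε : ℝ} (hε : 0 < ε)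
    (hg : MemLp g 2 (volume.restrict Ω)) (hu : MemLp u 2 (volume.restrict Ω)) :
    ∫ x in Ω, g x * u x * ‖gradient (phase U ε) x‖ =
      (∫ x in P.carrier, P.weight ε x * (g x * u x)) +
      ∫ x in Ω, (1 - P.cutoff x) * (g x * u x * ‖gradient (phase U ε) x‖) := by
  have hi : Integrable (fun x => g x * u x * ‖gradient (phase U ε) x‖) (volume.restrict Ω) :=
    integrable_mul_norm_gradient_phase hε Measure.restrict_le_self.absolutelyContinuous
      (hg.integrable_mul hu)
  have hc : Integrable (fun x => P.cutoff x * (g x * u x * ‖gradient (phase U ε) x‖))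
      (volume.restrict Ω) :=
    hi.bdd_mul (c := 1) P.continuous_cutoff.aestronglyMeasurable (.of_forall fun x => by
      rw [Real.norm_eq_abs, abs_of_nonneg (P.cutoff_nonneg x)]; exact P.cutoff_le_one x)
  have e1 : ∫ x in P.carrier, P.weight ε x * (g x * u x) =
      ∫ x in Ω, P.cutoff x * (g x * u x * ‖gradient (phase U ε) x‖) := by
    rw [P.setIntegral_carrier P.carrier_subset]
    congr 1
    funext x
    rw [BoundaryPartition.weight]; ring
  have e2 : ∫ x in Ω, (1 - P.cutoff x) * (g x * u x * ‖gradient (phase U ε) x‖) =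
      (∫ x in Ω, g x * u x * ‖gradient (phase U ε) x‖) -
      ∫ x in Ω, P.cutoff x * (g x * u x * ‖gradient (phase U ε) x‖) := by
    rw [← integral_sub hi hc]
    congr 1
    funext x
    ring
  rw [e1, e2]; ring

theorem BoundaryPartition.abs_integral_one_sub_cutoff_mul_le (P : BoundaryPartition U Ω c)
    {ε : ℝ} (hε : 0 < ε)
    (hg : MemLp g 2 (volume.restrict Ω)) (hu : MemLp u 2 (volume.restrict Ω)) :
    |∫ x in Ω, (1 - P.cutoff x) * (g x * u x * ‖gradient (phase U ε) x‖)| ≤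
      ε * ((2 * P.d ^ 2)⁻¹ * (l2norm (volume.restrict Ω) g * l2norm (volume.restrict Ω) u)) := by
  refine (P.norm_integral_one_sub_cutoff_le Measure.restrict_le_self.absolutelyContinuous hε
    (hg.integrable_mul hu)).trans ?_
  have h := integral_norm_mul_norm_le hg hu
  have e : ∫ x in Ω, |(g * u) x| = ∫ x in Ω, ‖g x‖ * ‖u x‖ := by
    simp only [Pi.mul_apply, abs_mul, Real.norm_eq_abs]
  rw [e]
  gcongr

/-- The diffuse boundary integrals converge to the surface integral of the traces. -/
theorem BoundaryPartition.tendsto_integral_boundary (P : BoundaryPartition U Ω c) {k : ℕ∞}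
    (hk : 1 ≤ k) (hn : 1 ≤ n) (hU : HasCkBoundary k U) (hUo : IsOpen U) (hΩ : IsOpen Ω)
    (hbdd : Bornology.IsBounded U) (hne : (frontier U).Nonempty) (hsub : closure U ⊆ Ω)
    (hg : MemH1 Ω g) (hu : MemH1 Ω u)
    {e : ℕ → ℝ} (he : Tendsto e atTop (𝓝 0)) (hpos : ∀ k, 0 < e k) :
    Tendsto (fun k => ∫ x in Ω, g x * u x * ‖gradient (phase U (e k)) x‖) atTop
      (𝓝 (∫ x, trace U g x * trace U u x ∂surfaceMeasure U)) := by
  have h1 := P.tendsto_integral_weight_trace hk hn hU hUo hΩ hbdd hne hsub hg hu he hpos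
  have h2 : Tendsto (fun k =>
      ∫ x in Ω, (1 - P.cutoff x) * (g x * u x * ‖gradient (phase U (e k)) x‖)) atTop (𝓝 0) := by
    have h3 := he.mul_const ((2 * P.d ^ 2)⁻¹ *
      (l2norm (volume.restrict Ω) g * l2norm (volume.restrict Ω) u))
    rw [zero_mul] at h3
    exact squeeze_zero_norm
      (fun k => P.abs_integral_one_sub_cutoff_mul_le (hpos k) hg.1 hu.1) h3
  have h3 := h1.add h2
  rw [add_zero] at h3
  exact h3.congr fun k => (P.integral_split (hpos k) hg.1 hu.1).symm

/-- A bound on the diffuse boundary term, uniform in `ε`, that vanishes as `v → 0` in `L²` with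
bounded gradient. -/
theorem BoundaryPartition.exists_boundary_bound (P : BoundaryPartition U Ω c) (hΩ : IsOpen Ω)
    (hg : MemH1 Ω g) :
    ∃ C : ℝ, 0 ≤ C ∧ ∀ ε ∈ Set.Ioo (0 : ℝ) 1, ∀ v V w, H1Approx P.carrier v V w →
      MemLp v 2 (volume.restrict Ω) → MemLp V 2 (volume.restrict Ω) →
      |∫ x in Ω, g x * v x * ‖gradient (phase U ε) x‖| ≤
        C * (√(l2norm (volume.restrict Ω) v *
          (l2norm (volume.restrict Ω) v + l2norm (volume.restrict Ω) V)) +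
          l2norm (volume.restrict Ω) v) := by
  obtain ⟨A, hA0, hA⟩ := P.exists_diffuseNorm_le
  obtain ⟨B, hB0, hB⟩ := P.exists_diffuseNorm_bound
  obtain ⟨gs, hgs⟩ := hg.exists_h1Approx hΩ P.isCompact_carrier P.carrier_subset
  set ng := A * (l2norm (volume.restrict P.carrier) g +
    l2norm (volume.restrict P.carrier) (weakGradient Ω g)) with hng
  have hng0 : 0 ≤ ng := mul_nonneg hA0 (add_nonneg (l2norm_nonneg _) (l2norm_nonneg _))
  set r := (2 * P.d ^ 2)⁻¹ * l2norm (volume.restrict Ω) g with hr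
  have hr0 : 0 ≤ r := mul_nonneg (by positivity) (l2norm_nonneg _)
  refine ⟨ng * √B + r, by positivity, fun ε hε v V w h hv hV => ?_⟩
  have hle : volume.restrict P.carrier ≤ volume.restrict Ω :=
    Measure.restrict_mono P.carrier_subset le_rfl
  have m1 := l2norm_mono_measure hv hle
  have m2 := l2norm_mono_measure hV hle
  have p1 := l2norm_nonneg (μ := volume.restrict P.carrier) v
  have p2 := l2norm_nonneg (μ := volume.restrict P.carrier) V
  set N := l2norm (volume.restrict Ω) v
  set D := l2norm (volume.restrict Ω) V
  have hN : 0 ≤ N := l2norm_nonneg _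
  have hD : 0 ≤ D := l2norm_nonneg _
  rw [P.integral_split hε.1 hg.1 hv]
  have b1 := P.abs_integral_weight_le hε.1 hgs.memLp h.memLp
  have b2 := P.abs_integral_one_sub_cutoff_mul_le hε.1 hg.1 hv
  have b3 := hA ε hε.1 _ _ _ hgs
  -- The product `N (N + D)` is retained here; it tends to zero with `N` as long as `D` stays
  -- bounded.
  have b4 : P.diffuseNorm ε v ≤ √B * √(N * (N + D)) := by
    rw [← Real.sqrt_mul hB0]
    refine Real.le_sqrt_of_sq_le ((hB ε hε.1 v V w h).trans (mul_le_mul_of_nonneg_left ?_ hB0))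
    exact mul_le_mul m1 (add_le_add m1 m2) (by positivity) hN
  have b5 : P.diffuseNorm ε g * P.diffuseNorm ε v ≤ ng * (√B * √(N * (N + D))) :=
    mul_le_mul b3 b4 (P.diffuseNorm_nonneg _ _) hng0
  have b6 : ε * ((2 * P.d ^ 2)⁻¹ * (l2norm (volume.restrict Ω) g * N)) ≤ r * N := by
    rw [← mul_assoc (2 * P.d ^ 2)⁻¹, ← hr]
    exact mul_le_of_le_one_left (by positivity) hε.2.le
  refine (abs_add_le _ _).trans ((add_le_add (b1.trans b5) (b2.trans b6)).trans ?_)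
  have s0 := Real.sqrt_nonneg (N * (N + D))
  have : 0 ≤ ng * √B * N := by positivity
  nlinarith [mul_nonneg hr0 s0]

end BoundaryTerm

/-! ### Weak limits along ultrafilters -/

section WeakLimits

/-- Bounded families in a Hilbert space converge weakly along ultrafilters. -/
theorem exists_weak_limit {H ι : Type*} [NormedAddCommGroup H] [InnerProductSpace ℝ H]
    [CompleteSpace H] (𝓤 : Ultrafilter ι) {x : ι → H} {R : ℝ} (hx : ∀ᶠ i in 𝓤, ‖x i‖ ≤ R) :
    ∃ y : H, ∀ z : H, Tendsto (fun i => inner ℝ (x i) z) 𝓤 (𝓝 (inner ℝ y z)) := by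
  -- Banach–Alaoglu: in a compact set every ultrafilter converges, so no subsequence has to be
  -- extracted. The Riesz isomorphism turns the limit functional into a vector.
  have hc := WeakDual.isCompact_closedBall (𝕜 := ℝ) (E := H) 0 R
  let F : ι → WeakDual ℝ H := fun i => StrongDual.toWeakDual (InnerProductSpace.toDual ℝ H (x i))
  have hle : ((𝓤.map F : Ultrafilter (WeakDual ℝ H)) : Filter (WeakDual ℝ H)) ≤
      𝓟 (WeakDual.toStrongDual ⁻¹' Metric.closedBall 0 R) := by
    rw [le_principal_iff, Ultrafilter.coe_map, mem_map]
    filter_upwards [hx] with i hi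
    simpa [F] using hi
  obtain ⟨ℓ, -, hℓ⟩ := hc.ultrafilter_le_nhds _ hle
  refine ⟨(InnerProductSpace.toDual ℝ H).symm (WeakDual.toStrongDual ℓ), fun z => ?_⟩
  have ht : Tendsto F 𝓤 (𝓝 ℓ) := hℓ
  have h2 := ((WeakDual.eval_continuous z).tendsto ℓ).comp ht
  rw [InnerProductSpace.toDual_symm_apply]
  exact h2

variable {n : ℕ} {μ : Measure (E n)}

theorem exists_weak_limit_memLp (𝓤 : Ultrafilter ℕ) {W : ℕ → E n → E n} {R : ℝ}
    (hW : ∀ᶠ k in 𝓤, MemLp (W k) 2 μ ∧ l2norm μ (W k) ≤ R) :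
    ∃ G : E n → E n, MemLp G 2 μ ∧ ∀ Z : E n → E n, MemLp Z 2 μ →
      Tendsto (fun k => ∫ x, inner ℝ (W k x) (Z x) ∂μ) 𝓤 (𝓝 (∫ x, inner ℝ (G x) (Z x) ∂μ)) := by
  classical
  -- Square integrability is known only along the ultrafilter; the other indices get the value zero.
  let X : ℕ → Lp (E n) 2 μ := fun k => if hk : MemLp (W k) 2 μ then hk.toLp else 0
  have hX : ∀ᶠ k in 𝓤, ‖X k‖ ≤ R := by
    filter_upwards [hW] with k hk
    simp only [X, dif_pos hk.1, Lp.norm_toLp]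
    exact hk.2
  obtain ⟨Y, hY⟩ := exists_weak_limit 𝓤 hX
  refine ⟨Y, Lp.memLp Y, fun Z hZ => ?_⟩
  have e : inner ℝ Y hZ.toLp = ∫ x, inner ℝ (Y x) (Z x) ∂μ := by
    rw [L2.inner_def]
    refine integral_congr_ae ?_
    filter_upwards [hZ.coeFn_toLp] with x hx
    rw [hx]
  rw [← e]
  refine (hY hZ.toLp).congr' ?_
  filter_upwards [hW] with k hk
  simp only [X, dif_pos hk.1]
  rw [L2.inner_def]
  refine integral_congr_ae ?_
  filter_upwards [hZ.coeFn_toLp, hk.1.coeFn_toLp] with x hx hx'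
  rw [hx, hx']

theorem integrable_inner {W Z : E n → E n} (hW : MemLp W 2 μ) (hZ : MemLp Z 2 μ) :
    Integrable (fun x => inner ℝ (W x) (Z x)) μ :=
  (integrable_norm_mul_norm hW hZ).mono' (hW.1.inner hZ.1)
    (.of_forall fun x => norm_inner_le_norm (W x) (Z x))

theorem memLp_bdd_smul {m : E n → ℝ} {G : E n → E n} {M : ℝ} (hm : AEStronglyMeasurable m μ)
    (hM : ∀ᵐ x ∂μ, |m x| ≤ M) (hG : MemLp G 2 μ) : MemLp (fun x => m x • G x) 2 μ := by
  refine (hG.const_smul M).of_le (hm.smul hG.1) ?_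
  filter_upwards [hM] with x hx
  rw [norm_smul, Pi.smul_apply, norm_smul]
  exact mul_le_mul_of_nonneg_right (hx.trans (le_abs_self M)) (norm_nonneg _)

theorem abs_integral_inner_le {W Z : E n → E n} (hW : MemLp W 2 μ) (hZ : MemLp Z 2 μ) :
    |∫ x, inner ℝ (W x) (Z x) ∂μ| ≤ l2norm μ W * l2norm μ Z := by
  rw [← Real.norm_eq_abs]
  exact (norm_integral_le_of_norm_le (integrable_norm_mul_norm hW hZ)
    (.of_forall fun x => norm_inner_le_norm (W x) (Z x))).trans (integral_norm_mul_norm_le hW hZ)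

/-- Pairing of a weakly convergent sequence with `m k • Z`, where `m k` is bounded and converges
almost everywhere. -/
theorem tendsto_integral_bdd_mul_inner {𝓤 : Filter ℕ} (h𝓤 : 𝓤 ≤ atTop) {W : ℕ → E n → E n}
    {G Z : E n → E n} {R : ℝ} (hW : ∀ᶠ k in 𝓤, MemLp (W k) 2 μ ∧ l2norm μ (W k) ≤ R)
    (hZ : MemLp Z 2 μ)
    (hlim : ∀ Y : E n → E n, MemLp Y 2 μ →
      Tendsto (fun k => ∫ x, inner ℝ (W k x) (Y x) ∂μ) 𝓤 (𝓝 (∫ x, inner ℝ (G x) (Y x) ∂μ)))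
    {m : ℕ → E n → ℝ} {m₀ : E n → ℝ} {M : ℝ} (hm : ∀ k, AEStronglyMeasurable (m k) μ)
    (hm₀ : AEStronglyMeasurable m₀ μ)
    (hM : ∀ k, ∀ᵐ x ∂μ, |m k x| ≤ M) (hM₀ : ∀ᵐ x ∂μ, |m₀ x| ≤ M)
    (hml : ∀ᵐ x ∂μ, Tendsto (fun k => m k x) atTop (𝓝 (m₀ x))) :
    Tendsto (fun k => ∫ x, m k x * inner ℝ (W k x) (Z x) ∂μ) 𝓤
      (𝓝 (∫ x, m₀ x * inner ℝ (G x) (Z x) ∂μ)) := by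
  have hmZ := fun k => memLp_bdd_smul (hm k) (hM k) hZ
  have hm₀Z := memLp_bdd_smul hm₀ hM₀ hZ
  have h1 := hlim _ hm₀Z
  -- The coefficient is moved onto the fixed field: `m k • Z → m₀ • Z` strongly by dominated
  -- convergence, and a weak limit pairs with a strong one.
  have hsq : Tendsto (fun k => l2norm μ ((fun x => m k x • Z x) - fun x => m₀ x • Z x) ^ 2)
      atTop (𝓝 0) := by
    have h0 := tendsto_integral_bdd_mul_mul (μ := μ) (m := fun k x => (m k x - m₀ x) ^ 2)
      (m₀ := fun _ => 0) (M := (2 * M) ^ 2) (f := fun _ x => ‖Z x‖) (g := fun _ x => ‖Z x‖)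
      (f₀ := fun x => ‖Z x‖) (g₀ := fun x => ‖Z x‖) (fun k => ((hm k).sub hm₀).pow 2)
      (fun k => by
        filter_upwards [hM k, hM₀] with x h1 h2
        rw [abs_of_nonneg (sq_nonneg _), ← sq_abs]
        gcongr
        exact (abs_sub _ _).trans (by linarith))
      (by
        filter_upwards [hml] with x hx
        simpa using (hx.sub_const (m₀ x)).pow 2)
      (fun _ => hZ.norm) hZ.norm (fun _ => hZ.norm) hZ.norm (by simp [l2norm]) (by simp [l2norm])
    simp only [zero_mul, integral_zero] at h0
    refine h0.congr fun k => ?_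
    rw [l2norm_sq ((hmZ k).sub hm₀Z)]
    congr 1
    funext x
    rw [Pi.sub_apply, ← sub_smul, norm_smul, mul_pow, Real.norm_eq_abs, sq_abs, sq ‖Z x‖]
  have hst : Tendsto (fun k => l2norm μ ((fun x => m k x • Z x) - fun x => m₀ x • Z x))
      atTop (𝓝 0) := by
    have := hsq.sqrt
    rw [Real.sqrt_zero] at this
    exact this.congr fun k => Real.sqrt_sq (l2norm_nonneg _)
  have h2 : Tendsto (fun k => ∫ x, inner ℝ (W k x)
      (((fun x => m k x • Z x) - fun x => m₀ x • Z x) x) ∂μ) 𝓤 (𝓝 0) := by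
    have h3 := (hst.mono_left h𝓤).const_mul R
    rw [mul_zero] at h3
    refine squeeze_zero_norm' ?_ h3
    filter_upwards [hW] with k hk
    exact (abs_integral_inner_le hk.1 ((hmZ k).sub hm₀Z)).trans
      (mul_le_mul_of_nonneg_right hk.2 (l2norm_nonneg _))
  have h3 := h1.add h2
  simp only [add_zero, inner_smul_right] at h3
  refine h3.congr' ?_
  filter_upwards [hW] with k hk
  have i1 := integrable_inner hk.1 hm₀Z
  have i2 := integrable_inner hk.1 ((hmZ k).sub hm₀Z)
  simp only [inner_smul_right] at i1
  rw [← integral_add i1 i2]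
  congr 1
  funext x
  simp only [Pi.sub_apply, inner_sub_right, inner_smul_right]
  ring

/-- Weak gradients pass to the limit. -/
theorem isWeakGradient_of_tendsto {Ω : Set (E n)} {𝓤 : Filter ℕ} [𝓤.NeBot] (h𝓤 : 𝓤 ≤ atTop)
    {u : E n → ℝ} {v : ℕ → E n → ℝ} {G : E n → E n} {W : ℕ → E n → E n}
    (hu : MemLp u 2 (volume.restrict Ω)) (hv : ∀ k, MemLp (v k) 2 (volume.restrict Ω))
    (hvu : Tendsto (fun k => l2norm (volume.restrict Ω) (v k - u)) atTop (𝓝 0))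
    (hlim : ∀ Y : E n → E n, MemLp Y 2 (volume.restrict Ω) →
      Tendsto (fun k => ∫ x in Ω, inner ℝ (W k x) (Y x)) 𝓤 (𝓝 (∫ x in Ω, inner ℝ (G x) (Y x))))
    (hW : ∀ᶠ k in 𝓤, IsWeakGradient Ω (v k) (W k)) : IsWeakGradient Ω u G := by
  intro φ hφ hφc hφs y
  have hd : MemLp (fun x => fderiv ℝ φ x y) 2 (volume.restrict Ω) := by
    have hc : Continuous fun x => fderiv ℝ φ x y :=
      (hφ.continuous_fderiv (by simp)).clm_apply continuous_const
    exact (hc.memLp_of_hasCompactSupport (hφc.fderiv_apply (𝕜 := ℝ) y)).restrict Ω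
  have h1 := (tendsto_integral_mul hv hu (fun _ => hd) hd hvu (by simp [l2norm])).mono_left h𝓤
  have hY : MemLp (fun x => φ x • y) 2 (volume.restrict Ω) :=
    ((hφ.continuous.smul continuous_const).memLp_of_hasCompactSupport hφc.smul_right).restrict Ω
  have h2 := (hlim _ hY).neg
  have e : ∀ F : E n → E n, ∫ x in Ω, inner ℝ (F x) (φ x • y) = ∫ x in Ω, inner ℝ (F x) y * φ x :=
    fun F => by simp only [inner_smul_right, mul_comm]
  simp only [e] at h2
  refine tendsto_nhds_unique (h1.congr' ?_) h2
  filter_upwards [hW] with k hk using hk φ hφ hφc hφs y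

end WeakLimits

/-- With empty frontier the set would be clopen in a connected space, hence empty or the whole
space, which is not bounded when `n ≥ 1`. -/
theorem frontier_nonempty {n : ℕ} (hn : 1 ≤ n) {U : Set (E n)} (hU : U.Nonempty)
    (hbdd : Bornology.IsBounded U) : (frontier U).Nonempty := by
  rw [Set.nonempty_iff_ne_empty]
  intro h
  have : Nonempty (Fin n) := ⟨⟨0, hn⟩⟩
  rcases isClopen_iff.1 (isClopen_iff_frontier_eq_empty.2 h) with h1 | h1
  · exact hU.ne_empty h1
  · rw [h1] at hbdd
    exact NoncompactSpace.noncompact_univ (X := E n)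
      (Metric.isCompact_of_isClosed_isBounded isClosed_univ hbdd)

theorem isOpen_cuboid {n : ℕ} (a b : Fin n → ℝ) : IsOpen (cuboid a b) := by
  have : cuboid a b = ⋂ i, {x : E n | a i < x i ∧ x i < b i} := by
    ext x; simp [cuboid]
  rw [this]
  refine isOpen_iInter_of_finite fun i => ?_
  have hc : Continuous fun x : E n => x i := by fun_prop
  exact (isOpen_lt continuous_const hc).inter (isOpen_lt hc continuous_const)

/-! ### Diffuse and sharp coefficients -/

section Coefficients

variable {n : ℕ} {Ω U : Set (E n)} {s t : ℝ} {ε : ℝ} {x : E n}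

theorem continuous_diffuseCoeff (U : Set (E n)) (ε s t : ℝ) :
    Continuous (diffuseCoeff U ε (fun _ => s) (fun _ => t)) :=
  continuous_const.add (continuous_const.mul (continuous_phase U ε))

theorem abs_diffuseCoeff_le (U : Set (E n)) (ε s t : ℝ) (x : E n) :
    |diffuseCoeff U ε (fun _ => s) (fun _ => t) x| ≤ |t| + |s - t| := by
  unfold diffuseCoeff
  refine (abs_add_le _ _).trans ?_
  rw [abs_mul]
  gcongr
  exact mul_le_of_le_one_right (abs_nonneg _) (abs_phase_le_one x)

/-- The coefficient is a convex combination of `s` and `t`; this yields coercivity uniformly in `ε`.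
-/
theorem min_le_diffuseCoeff (U : Set (E n)) (ε s t : ℝ) (x : E n) :
    min s t ≤ diffuseCoeff U ε (fun _ => s) (fun _ => t) x := by
  simp only [diffuseCoeff]
  have h0 := phase_nonneg (U := U) (ε := ε) x
  have h1 := phase_le_one (U := U) (ε := ε) x
  nlinarith [mul_nonneg h0 (sub_nonneg.2 (min_le_left s t)),
    mul_nonneg (sub_nonneg.2 h1) (sub_nonneg.2 (min_le_right s t))]

theorem sharpCoeff_eq {s t : E n → ℝ} (hx : x ∈ Ω) (hxf : x ∉ frontier U) :
    sharpCoeff Ω U s t x = t x + (s x - t x) * U.indicator (fun _ => 1) x := by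
  unfold sharpCoeff
  by_cases hU : x ∈ U
  · rw [Set.indicator_of_mem hU, Set.indicator_of_mem hU,
      Set.indicator_of_notMem fun h => h.2 (subset_closure hU)]
    ring
  · have hc : x ∉ closure U := by
      rw [closure_eq_self_union_frontier]
      exact fun h => h.elim hU hxf
    rw [Set.indicator_of_notMem hU, Set.indicator_of_notMem hU, Set.indicator_of_mem (Set.mem_sdiff_of_mem hx hc)]
    ring

theorem abs_sharpCoeff_le (Ω U : Set (E n)) (s t : ℝ) (x : E n) :
    |sharpCoeff Ω U (fun _ => s) (fun _ => t) x| ≤ |s| + |t| := by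
  unfold sharpCoeff
  refine (abs_add_le _ _).trans (add_le_add ?_ ?_)
  · exact norm_indicator_le_norm_self (fun _ => s) x
  · exact norm_indicator_le_norm_self (fun _ => t) x

theorem measurable_sharpCoeff (hΩ : IsOpen Ω) (hU : IsOpen U) (s t : ℝ) :
    Measurable (sharpCoeff Ω U (fun _ => s) (fun _ => t)) :=
  (measurable_const.indicator hU.measurableSet).add
    (measurable_const.indicator (hΩ.measurableSet.diff isClosed_closure.measurableSet))

theorem ae_mem_and_notMem_frontier (hΩ : IsOpen Ω) (hnull : volume (frontier U) = 0) :
    ∀ᵐ x ∂volume.restrict Ω, x ∈ Ω ∧ x ∉ frontier U :=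
  (ae_restrict_mem hΩ.measurableSet).and
    (ae_restrict_of_ae (measure_eq_zero_iff_ae_notMem.1 hnull))

theorem tendsto_diffuseCoeff (hΩ : IsOpen Ω) (hne : (frontier U).Nonempty)
    (hnull : volume (frontier U) = 0) (s t : E n → ℝ) {e : ℕ → ℝ} (he : Tendsto e atTop (𝓝 0))
    (hpos : ∀ k, 0 < e k) :
    ∀ᵐ x ∂volume.restrict Ω, Tendsto (fun k => diffuseCoeff U (e k) s t x) atTop
      (𝓝 (sharpCoeff Ω U s t x)) := by
  filter_upwards [ae_mem_and_notMem_frontier hΩ hnull] with x hx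
  rw [sharpCoeff_eq hx.1 hx.2]
  exact ((tendsto_phase hne hx.2 he hpos).const_mul _).const_add _

end Coefficients

/-! ### Convergence and lower semicontinuity of the energies -/

section Energies

variable {n : ℕ} {Ω U : Set (E n)} {α β γ : ℝ} {h q g u : E n → ℝ} {ε : ℝ} {e : ℕ → ℝ}

/-- The diffuse energy of a function in `H¹(Ω)`, as a real number. -/
noncomputable def diffuseIntegral (Ω U : Set (E n)) (α β γ : ℝ) (h q g : E n → ℝ) (ε : ℝ)
    (u : E n → ℝ) : ℝ :=
  ∫ x in Ω,
    ((1 / 2) * (diffuseCoeff U ε (fun _ => 1) (fun _ => α) x * ‖weakGradient Ω u x‖ ^ 2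
        + diffuseCoeff U ε (fun _ => γ) (fun _ => β) x * u x ^ 2)
      - diffuseCoeff U ε q h x * u x
      + g x * u x * ‖gradient (phase U ε) x‖)

/-- The sharp energy of a function in `H¹(Ω)`, as a real number. -/
noncomputable def sharpIntegral (Ω U : Set (E n)) (α β γ : ℝ) (h q g : E n → ℝ)
    (u : E n → ℝ) : ℝ :=
  (∫ x in Ω,
    ((1 / 2) * (sharpCoeff Ω U (fun _ => 1) (fun _ => α) x * ‖weakGradient Ω u x‖ ^ 2
        + sharpCoeff Ω U (fun _ => γ) (fun _ => β) x * u x ^ 2)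
      - sharpCoeff Ω U q h x * u x))
    + ∫ x, trace U g x * trace U u x ∂(surfaceMeasure U)

theorem integrable_diffuseCoeff_mul {μ : Measure (E n)} {F : E n → ℝ} (hF : Integrable F μ)
    (U : Set (E n)) (ε s t : ℝ) :
    Integrable (fun x => diffuseCoeff U ε (fun _ => s) (fun _ => t) x * F x) μ :=
  hF.bdd_mul (continuous_diffuseCoeff U ε s t).aestronglyMeasurable
    (.of_forall fun x => abs_diffuseCoeff_le U ε s t x)

theorem integrable_sharpCoeff_mul {μ : Measure (E n)} {F : E n → ℝ} (hF : Integrable F μ)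
    (hΩ : IsOpen Ω) (hU : IsOpen U) (s t : ℝ) :
    Integrable (fun x => sharpCoeff Ω U (fun _ => s) (fun _ => t) x * F x) μ :=
  hF.bdd_mul (measurable_sharpCoeff hΩ hU s t).aestronglyMeasurable
    (.of_forall fun x => abs_sharpCoeff_le Ω U s t x)

theorem integrable_phase_mul {μ : Measure (E n)} {F : E n → ℝ} (hF : Integrable F μ)
    (U : Set (E n)) (ε : ℝ) : Integrable (fun x => phase U ε x * F x) μ :=
  hF.bdd_mul (continuous_phase U ε).aestronglyMeasurable (.of_forall fun x => abs_phase_le_one x)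

/-- Here `h` and `q` are only square integrable, so the load coefficient cannot play the part of the
bounded multiplier. The splitting leaves `φ_ε` in that role. -/
theorem integral_diffuseLoad {μ : Measure (E n)} (hh : MemLp h 2 μ) (hq : MemLp q 2 μ)
    (hu : MemLp u 2 μ) (U : Set (E n)) (ε : ℝ) :
    Integrable (fun x => diffuseCoeff U ε q h x * u x) μ ∧
    ∫ x, diffuseCoeff U ε q h x * u x ∂μ =
      (∫ x, h x * u x ∂μ) + ∫ x, phase U ε x * ((q - h) x * u x) ∂μ := by
  have i1 : Integrable (fun x => h x * u x) μ := hh.integrable_mul hu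
  have i2 : Integrable (fun x => phase U ε x * ((q - h) x * u x)) μ :=
    integrable_phase_mul ((hq.sub hh).integrable_mul hu) U ε
  have e : (fun x => diffuseCoeff U ε q h x * u x) =
      fun x => h x * u x + phase U ε x * ((q - h) x * u x) := by
    funext x
    simp only [diffuseCoeff, Pi.sub_apply]
    ring
  rw [e]
  exact ⟨i1.add i2, integral_add i1 i2⟩

theorem diffuseIntegral_eq (hh : MemLp h 2 (volume.restrict Ω)) (hq : MemLp q 2 (volume.restrict Ω))
    (hg : MemLp g 2 (volume.restrict Ω)) (hu : MemH1 Ω u) (hε : 0 < ε) :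
    diffuseIntegral Ω U α β γ h q g ε u =
      1 / 2 * (∫ x in Ω, diffuseCoeff U ε (fun _ => 1) (fun _ => α) x *
        (‖weakGradient Ω u x‖ * ‖weakGradient Ω u x‖)) +
      1 / 2 * (∫ x in Ω, diffuseCoeff U ε (fun _ => γ) (fun _ => β) x * (u x * u x)) -
      (∫ x in Ω, diffuseCoeff U ε q h x * u x) +
      ∫ x in Ω, g x * u x * ‖gradient (phase U ε) x‖ := by
  have i1 := (integrable_diffuseCoeff_mul (integrable_norm_mul_norm hu.memLp_weakGradient
    hu.memLp_weakGradient) U ε 1 α).const_mul (1 / 2)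
  have i2 : Integrable (fun x => 1 / 2 *
      (diffuseCoeff U ε (fun _ => γ) (fun _ => β) x * (u x * u x))) (volume.restrict Ω) :=
    (integrable_diffuseCoeff_mul (hu.1.integrable_mul hu.1) U ε γ β).const_mul (1 / 2)
  have i3 := (integral_diffuseLoad hh hq hu.1 U ε).1
  have i4 : Integrable (fun x => g x * u x * ‖gradient (phase U ε) x‖) (volume.restrict Ω) :=
    integrable_mul_norm_gradient_phase hε Measure.restrict_le_self.absolutelyContinuous
      (hg.integrable_mul hu.1)
  rw [← integral_const_mul, ← integral_const_mul, ← integral_add i1 i2,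
    ← integral_sub (i1.fun_add i2) i3]
  have i5 := (i1.fun_add i2).sub i3
  simp only [Pi.sub_def] at i5
  rw [← integral_add i5 i4, diffuseIntegral]
  congr 1
  funext x
  ring

theorem integral_sharpLoad (hΩ : IsOpen Ω) (hUo : IsOpen U) (hnull : volume (frontier U) = 0)
    (hh : MemLp h 2 (volume.restrict Ω)) (hq : MemLp q 2 (volume.restrict Ω))
    (hu : MemLp u 2 (volume.restrict Ω)) :
    Integrable (fun x => sharpCoeff Ω U q h x * u x) (volume.restrict Ω) ∧
    ∫ x in Ω, sharpCoeff Ω U q h x * u x =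
      (∫ x in Ω, h x * u x) + ∫ x in Ω, U.indicator (fun _ => 1) x * ((q - h) x * u x) := by
  have i1 : Integrable (fun x => h x * u x) (volume.restrict Ω) := hh.integrable_mul hu
  have i2 : Integrable (fun x => U.indicator (fun _ => (1 : ℝ)) x * ((q - h) x * u x))
      (volume.restrict Ω) :=
    ((hq.sub hh).integrable_mul hu).bdd_mul (c := 1)
      (measurable_const.indicator hUo.measurableSet).aestronglyMeasurable
      (.of_forall fun x => (norm_indicator_le_norm_self (fun _ => (1 : ℝ)) x).trans (by simp))
  have e : (fun x => sharpCoeff Ω U q h x * u x) =ᵐ[volume.restrict Ω]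
      fun x => h x * u x + U.indicator (fun _ => (1 : ℝ)) x * ((q - h) x * u x) := by
    filter_upwards [ae_mem_and_notMem_frontier hΩ hnull] with x hx
    rw [sharpCoeff_eq hx.1 hx.2, Pi.sub_apply]
    ring
  exact ⟨(integrable_congr e).2 (i1.add i2), (integral_congr_ae e).trans (integral_add i1 i2)⟩

theorem sharpIntegral_eq (hΩ : IsOpen Ω) (hUo : IsOpen U) (hnull : volume (frontier U) = 0)
    (hh : MemLp h 2 (volume.restrict Ω)) (hq : MemLp q 2 (volume.restrict Ω)) (hu : MemH1 Ω u) :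
    sharpIntegral Ω U α β γ h q g u =
      1 / 2 * (∫ x in Ω, sharpCoeff Ω U (fun _ => 1) (fun _ => α) x *
        (‖weakGradient Ω u x‖ * ‖weakGradient Ω u x‖)) +
      1 / 2 * (∫ x in Ω, sharpCoeff Ω U (fun _ => γ) (fun _ => β) x * (u x * u x)) -
      (∫ x in Ω, sharpCoeff Ω U q h x * u x) +
      ∫ x, trace U g x * trace U u x ∂(surfaceMeasure U) := by
  have i1 := (integrable_sharpCoeff_mul (integrable_norm_mul_norm hu.memLp_weakGradient
    hu.memLp_weakGradient) hΩ hUo 1 α).const_mul (1 / 2)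
  have i2 : Integrable (fun x => 1 / 2 *
      (sharpCoeff Ω U (fun _ => γ) (fun _ => β) x * (u x * u x))) (volume.restrict Ω) :=
    (integrable_sharpCoeff_mul (hu.1.integrable_mul hu.1) hΩ hUo γ β).const_mul (1 / 2)
  have i3 := (integral_sharpLoad hΩ hUo hnull hh hq hu.1).1
  rw [← integral_const_mul, ← integral_const_mul, ← integral_add i1 i2,
    ← integral_sub (i1.fun_add i2) i3, sharpIntegral]
  congr 2
  funext x
  ring

theorem tendsto_integral_diffuseCoeff_mul (hΩ : IsOpen Ω) (hne : (frontier U).Nonempty)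
    (hnull : volume (frontier U) = 0) (he : Tendsto e atTop (𝓝 0)) (hpos : ∀ k, 0 < e k)
    (s t : ℝ) {v w : ℕ → E n → ℝ} {v₀ w₀ : E n → ℝ}
    (hv : ∀ k, MemLp (v k) 2 (volume.restrict Ω)) (hv₀ : MemLp v₀ 2 (volume.restrict Ω))
    (hw : ∀ k, MemLp (w k) 2 (volume.restrict Ω)) (hw₀ : MemLp w₀ 2 (volume.restrict Ω))
    (hvl : Tendsto (fun k => l2norm (volume.restrict Ω) (v k - v₀)) atTop (𝓝 0))
    (hwl : Tendsto (fun k => l2norm (volume.restrict Ω) (w k - w₀)) atTop (𝓝 0)) :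
    Tendsto (fun k => ∫ x in Ω, diffuseCoeff U (e k) (fun _ => s) (fun _ => t) x *
      (v k x * w k x)) atTop
      (𝓝 (∫ x in Ω, sharpCoeff Ω U (fun _ => s) (fun _ => t) x * (v₀ x * w₀ x))) :=
  tendsto_integral_bdd_mul_mul
    (fun k => (continuous_diffuseCoeff U (e k) s t).aestronglyMeasurable)
    (fun k => .of_forall fun x => abs_diffuseCoeff_le U (e k) s t x)
    (tendsto_diffuseCoeff hΩ hne hnull _ _ he hpos) hv hv₀ hw hw₀ hvl hwl

theorem tendsto_integral_load (hΩ : IsOpen Ω) (hUo : IsOpen U) (hne : (frontier U).Nonempty)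
    (hnull : volume (frontier U) = 0) (he : Tendsto e atTop (𝓝 0)) (hpos : ∀ k, 0 < e k)
    (hh : MemLp h 2 (volume.restrict Ω)) (hq : MemLp q 2 (volume.restrict Ω))
    {v : ℕ → E n → ℝ} (hv : ∀ k, MemLp (v k) 2 (volume.restrict Ω))
    (hu : MemLp u 2 (volume.restrict Ω))
    (hvl : Tendsto (fun k => l2norm (volume.restrict Ω) (v k - u)) atTop (𝓝 0)) :
    Tendsto (fun k => ∫ x in Ω, diffuseCoeff U (e k) q h x * v k x) atTop
      (𝓝 (∫ x in Ω, sharpCoeff Ω U q h x * u x)) := by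
  rw [(integral_sharpLoad hΩ hUo hnull hh hq hu).2]
  have h1 := tendsto_integral_mul (fun _ => hh) hh hv hu (by simp [l2norm]) hvl
  have h2 := tendsto_integral_bdd_mul_mul (m := fun k => phase U (e k)) (M := 1)
    (m₀ := U.indicator fun _ => 1)
    (fun k => (continuous_phase U (e k)).aestronglyMeasurable)
    (fun k => .of_forall fun x => abs_phase_le_one x)
    (by
      filter_upwards [ae_mem_and_notMem_frontier hΩ hnull] with x hx
      exact tendsto_phase hne hx.2 he hpos)
    (fun _ => hq.sub hh) (hq.sub hh) hv hu (by simp [l2norm]) hvl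
  exact (h1.add h2).congr fun k => (integral_diffuseLoad hh hq (hv k) U (e k)).2.symm

theorem abs_integral_diffuseLoad_le (hh : MemLp h 2 (volume.restrict Ω))
    (hq : MemLp q 2 (volume.restrict Ω)) (hu : MemLp u 2 (volume.restrict Ω)) :
    |∫ x in Ω, diffuseCoeff U ε q h x * u x| ≤
      (l2norm (volume.restrict Ω) h + l2norm (volume.restrict Ω) (q - h)) *
        l2norm (volume.restrict Ω) u := by
  rw [(integral_diffuseLoad hh hq hu U ε).2, add_mul]
  refine (abs_add_le _ _).trans (add_le_add (abs_integral_mul_le hh hu) ?_)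
  have := abs_integral_bdd_mul_mul_le (M := 1) (m := phase U ε)
    (.of_forall fun x => abs_phase_le_one x) (hq.sub hh) hu
  rwa [one_mul] at this

/-- Convergence of the energies of a fixed function in `H¹(Ω)`. -/
theorem BoundaryPartition.tendsto_diffuseIntegral {c : ℝ} (P : BoundaryPartition U Ω c) {k : ℕ∞}
    (hk : 1 ≤ k) (hn : 1 ≤ n) (hU : HasCkBoundary k U) (hUo : IsOpen U) (hΩ : IsOpen Ω)
    (hbdd : Bornology.IsBounded U) (hne : (frontier U).Nonempty) (hsub : closure U ⊆ Ω)
    (hh : MemLp h 2 (volume.restrict Ω)) (hq : MemLp q 2 (volume.restrict Ω))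
    (hg : MemH1 Ω g) (hu : MemH1 Ω u)
    (he : Tendsto e atTop (𝓝 0)) (hpos : ∀ k, 0 < e k) :
    Tendsto (fun k => diffuseIntegral Ω U α β γ h q g (e k) u) atTop
      (𝓝 (sharpIntegral Ω U α β γ h q g u)) := by
  have hnull := volume_frontier_eq_zero hn P.isFiniteMeasure_surfaceMeasure
  rw [sharpIntegral_eq hΩ hUo hnull hh hq hu]
  have hG := hu.memLp_weakGradient.norm
  have t1 := tendsto_integral_diffuseCoeff_mul hΩ hne hnull he hpos 1 α (fun _ => hG) hG
    (fun _ => hG) hG (by simp [l2norm]) (by simp [l2norm])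
  have t2 := tendsto_integral_diffuseCoeff_mul hΩ hne hnull he hpos γ β (fun _ => hu.1) hu.1
    (fun _ => hu.1) hu.1 (by simp [l2norm]) (by simp [l2norm])
  have t3 := tendsto_integral_load hΩ hUo hne hnull he hpos hh hq (fun _ => hu.1) hu.1
    (by simp [l2norm])
  have t4 := P.tendsto_integral_boundary hk hn hU hUo hΩ hbdd hne hsub hg hu he hpos
  exact ((((t1.const_mul (1 / 2)).add (t2.const_mul (1 / 2))).sub t3).add t4).congr fun k =>
    (diffuseIntegral_eq hh hq hg.1 hu (hpos k)).symm

theorem le_of_sq_le_add_mul {a A C D : ℝ} (ha : 0 < a) (hA : 0 ≤ A) (hC : 0 ≤ C)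
    (h : a * D ^ 2 ≤ A + C * D) : D ≤ 1 + (A + C) / a := by
  have h0 : 0 ≤ (A + C) / a := by positivity
  rcases le_or_gt D 1 with h1 | h1
  · linarith
  · have : D ≤ (A + C) / a := by
      rw [le_div_iff₀ ha]
      nlinarith
    linarith

/-- Energy bounds control the gradient. -/
theorem BoundaryPartition.exists_gradient_bound {c : ℝ} (P : BoundaryPartition U Ω c)
    (hΩ : IsOpen Ω) (hα : 0 < α) (hβ : 0 < β) (hγ : 0 < γ)
    (hh : MemLp h 2 (volume.restrict Ω)) (hq : MemLp q 2 (volume.restrict Ω))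
    (hg : MemH1 Ω g) (L B : ℝ) :
    ∃ R : ℝ, ∀ ε ∈ Set.Ioo (0 : ℝ) 1, ∀ v, MemH1 Ω v → l2norm (volume.restrict Ω) v ≤ B →
      diffuseIntegral Ω U α β γ h q g ε v ≤ L →
      l2norm (volume.restrict Ω) (weakGradient Ω v) ≤ R := by
  obtain ⟨C, hC0, hC⟩ := P.exists_boundary_bound hΩ hg
  set κ := l2norm (volume.restrict Ω) h + l2norm (volume.restrict Ω) (q - h)
  have hκ : 0 ≤ κ := add_nonneg (l2norm_nonneg _) (l2norm_nonneg _)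
  have hm : 0 < min 1 α := lt_min one_pos hα
  refine ⟨1 + (|L| + κ * |B| + C * (2 * |B|) + C) / (1 / 2 * min 1 α),
    fun ε hε v hv hvB hE => ?_⟩
  obtain ⟨w, hw⟩ := hv.exists_h1Approx hΩ P.isCompact_carrier P.carrier_subset
  have hb := hC ε hε v _ w hw hv.1 hv.memLp_weakGradient
  have hl := abs_integral_diffuseLoad_le (U := U) (ε := ε) hh hq hv.1
  rw [diffuseIntegral_eq hh hq hg.1 hv hε.1] at hE
  -- Nonnegativity of the mass term is enough, since the `L²` norm is already bounded by assumption.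
  have hmass : 0 ≤ ∫ x in Ω, diffuseCoeff U ε (fun _ => γ) (fun _ => β) x * (v x * v x) :=
    integral_nonneg fun x => mul_nonneg
      ((lt_min hγ hβ).le.trans (min_le_diffuseCoeff U ε γ β x)) (mul_self_nonneg _)
  have hgrad : min 1 α * l2norm (volume.restrict Ω) (weakGradient Ω v) ^ 2 ≤
      ∫ x in Ω, diffuseCoeff U ε (fun _ => 1) (fun _ => α) x *
        (‖weakGradient Ω v x‖ * ‖weakGradient Ω v x‖) := by
    rw [l2norm_sq hv.memLp_weakGradient, ← integral_const_mul]
    refine integral_mono ((integrable_norm_sq hv.memLp_weakGradient).const_mul _)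
      (integrable_diffuseCoeff_mul (integrable_norm_mul_norm hv.memLp_weakGradient
        hv.memLp_weakGradient) U ε 1 α) fun x => ?_
    simp only [← sq]
    exact mul_le_mul_of_nonneg_right (min_le_diffuseCoeff U ε 1 α x) (by positivity)
  set N := l2norm (volume.restrict Ω) v
  set D := l2norm (volume.restrict Ω) (weakGradient Ω v)
  have hN : 0 ≤ N := l2norm_nonneg _
  have hD : 0 ≤ D := l2norm_nonneg _
  have hNB : N ≤ |B| := hvB.trans (le_abs_self B)
  -- This makes the boundary term at most linear in `D`, so the quadratic gradient term absorbs it.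
  have hs : √(N * (N + D)) ≤ N + D := by
    rw [Real.sqrt_le_left (by positivity), sq]
    exact mul_le_mul_of_nonneg_right (by linarith) (by positivity)
  refine le_of_sq_le_add_mul (by positivity) (by positivity) hC0 ?_
  have b1 : C * (√(N * (N + D)) + N) ≤ C * (2 * |B| + D) :=
    mul_le_mul_of_nonneg_left (by linarith) hC0
  have b2 : κ * N ≤ κ * |B| := mul_le_mul_of_nonneg_left hNB hκ
  have b3 := neg_abs_le (∫ x in Ω, g x * v x * ‖gradient (phase U ε) x‖)
  have b4 := le_abs_self (∫ x in Ω, diffuseCoeff U ε q h x * v x)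
  have b5 := le_abs_self L
  linarith

/-- Convexity of the gradient term. -/
theorem integral_diffuseCoeff_inner_le (hα : 0 < α) {μ : Measure (E n)} {W G : E n → E n}
    (hW : MemLp W 2 μ) (hG : MemLp G 2 μ) :
    2 * (∫ x, diffuseCoeff U ε (fun _ => 1) (fun _ => α) x * inner ℝ (W x) (G x) ∂μ) -
      ∫ x, diffuseCoeff U ε (fun _ => 1) (fun _ => α) x * (‖G x‖ * ‖G x‖) ∂μ ≤
    ∫ x, diffuseCoeff U ε (fun _ => 1) (fun _ => α) x * (‖W x‖ * ‖W x‖) ∂μ := by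
  have i1 := (integrable_diffuseCoeff_mul (integrable_inner hW hG) U ε 1 α).const_mul 2
  have i2 := integrable_diffuseCoeff_mul (integrable_norm_mul_norm hG hG) U ε 1 α
  have i3 := integrable_diffuseCoeff_mul (integrable_norm_mul_norm hW hW) U ε 1 α
  rw [← integral_const_mul, ← integral_sub i1 i2]
  refine integral_mono (i1.sub i2) i3 fun x => ?_
  have h1 : 0 ≤ diffuseCoeff U ε (fun _ => 1) (fun _ => α) x :=
    (lt_min one_pos hα).le.trans (min_le_diffuseCoeff U ε 1 α x)
  have h2 := norm_sub_sq_real (W x) (G x)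
  have h3 := sq_nonneg ‖W x - G x‖
  rw [h2] at h3
  have h4 := mul_nonneg h1 h3
  simp only
  nlinarith

/-- The diffuse boundary term is continuous along `L²`-convergent sequences with bounded
gradients. -/
theorem BoundaryPartition.tendsto_integral_boundary_seq {c : ℝ} (P : BoundaryPartition U Ω c)
    {k : ℕ∞} (hk : 1 ≤ k) (hn : 1 ≤ n) (hU : HasCkBoundary k U) (hUo : IsOpen U) (hΩ : IsOpen Ω)
    (hbdd : Bornology.IsBounded U) (hne : (frontier U).Nonempty) (hsub : closure U ⊆ Ω)
    (hg : MemH1 Ω g) (hu : MemH1 Ω u)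
    (he : Tendsto e atTop (𝓝 0)) (hpos : ∀ k, e k ∈ Set.Ioo (0 : ℝ) 1)
    {𝓤 : Filter ℕ} (h𝓤 : 𝓤 ≤ atTop) {v : ℕ → E n → ℝ}
    (hvu : Tendsto (fun k => l2norm (volume.restrict Ω) (v k - u)) atTop (𝓝 0)) {R : ℝ}
    (hv : ∀ᶠ k in 𝓤, MemH1 Ω (v k) ∧ l2norm (volume.restrict Ω) (weakGradient Ω (v k)) ≤ R) :
    Tendsto (fun k => ∫ x in Ω, g x * v k x * ‖gradient (phase U (e k)) x‖) 𝓤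
      (𝓝 (∫ x, trace U g x * trace U u x ∂surfaceMeasure U)) := by
  obtain ⟨C, hC0, hC⟩ := P.exists_boundary_bound hΩ hg
  have h1 := (P.tendsto_integral_boundary hk hn hU hUo hΩ hbdd hne hsub hg hu he
    fun k => (hpos k).1).mono_left h𝓤
  set R' := R + l2norm (volume.restrict Ω) (weakGradient Ω u)
  have h2 : Tendsto (fun k => ∫ x in Ω, g x * (v k - u) x * ‖gradient (phase U (e k)) x‖) 𝓤
      (𝓝 0) := by
    -- The gradients of `v k - u` are bounded by `R'`, so the bound is driven by the `L²` distance
    -- alone.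
    have h3 : Tendsto (fun k => C * (√(l2norm (volume.restrict Ω) (v k - u) *
        (l2norm (volume.restrict Ω) (v k - u) + R')) + l2norm (volume.restrict Ω) (v k - u)))
        atTop (𝓝 0) := by
      have := ((hvu.mul (hvu.add_const R')).sqrt.add hvu).const_mul C
      simpa using this
    refine squeeze_zero_norm' ?_ (h3.mono_left h𝓤)
    filter_upwards [hv] with k hk
    obtain ⟨w, hw⟩ := hk.1.exists_h1Approx hΩ P.isCompact_carrier P.carrier_subset
    obtain ⟨z, hz⟩ := hu.exists_h1Approx hΩ P.isCompact_carrier P.carrier_subset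
    have hk' := hk.1.memLp_weakGradient
    have hu' := hu.memLp_weakGradient
    refine (hC _ (hpos k) _ _ _ (hw.sub hz) (hk.1.1.sub hu.1) (hk'.sub hu')).trans ?_
    have h4 : l2norm (volume.restrict Ω) (weakGradient Ω (v k) - weakGradient Ω u) ≤ R' :=
      (l2norm_sub_le_add hk' hu').trans (add_le_add_left hk.2 _)
    have h5 := l2norm_nonneg (μ := volume.restrict Ω) (v k - u)
    gcongr
  have h3 := h1.add h2
  rw [add_zero] at h3
  refine h3.congr' ?_
  filter_upwards [hv] with k hk
  have hi := fun {f : E n → ℝ} (hf : MemLp f 2 (volume.restrict Ω)) =>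
    show Integrable (fun x => g x * f x * ‖gradient (phase U (e k)) x‖) (volume.restrict Ω) from
      integrable_mul_norm_gradient_phase (hpos k).1 Measure.restrict_le_self.absolutelyContinuous
        (hg.1.integrable_mul hf)
  rw [← integral_add (hi hu.1) (hi (hk.1.1.sub hu.1))]
  congr 1
  funext x
  rw [Pi.sub_apply]
  ring

/-- Lower semicontinuity: a bound on the diffuse energies along infinitely many indices passes to
the sharp energy of the limit. -/
theorem BoundaryPartition.sharpIntegral_le {c : ℝ} (P : BoundaryPartition U Ω c)
    {k : ℕ∞} (hk : 1 ≤ k) (hn : 1 ≤ n) (hU : HasCkBoundary k U) (hUo : IsOpen U) (hΩ : IsOpen Ω)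
    (hbdd : Bornology.IsBounded U) (hne : (frontier U).Nonempty) (hsub : closure U ⊆ Ω)
    (hα : 0 < α) (hβ : 0 < β) (hγ : 0 < γ)
    (hh : MemLp h 2 (volume.restrict Ω)) (hq : MemLp q 2 (volume.restrict Ω))
    (hg : MemH1 Ω g) (hu : MemLp u 2 (volume.restrict Ω))
    (he : Tendsto e atTop (𝓝 0)) (hpos : ∀ k, e k ∈ Set.Ioo (0 : ℝ) 1)
    {v : ℕ → E n → ℝ} (hv : ∀ k, MemLp (v k) 2 (volume.restrict Ω))
    (hvu : Tendsto (fun k => l2norm (volume.restrict Ω) (v k - u)) atTop (𝓝 0)) {L : ℝ}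
    (hL : ∃ᶠ k in atTop, MemH1 Ω (v k) ∧ diffuseIntegral Ω U α β γ h q g (e k) (v k) ≤ L) :
    MemH1 Ω u ∧ sharpIntegral Ω U α β γ h q g u ≤ L := by
  have hnull := volume_frontier_eq_zero hn P.isFiniteMeasure_surfaceMeasure
  set S : Set ℕ := {k | MemH1 Ω (v k) ∧ diffuseIntegral Ω U α β γ h q g (e k) (v k) ≤ L}
  have hNB : (atTop ⊓ 𝓟 S).NeBot := frequently_mem_iff_neBot.1 hL
  -- The ultrafilter refines `atTop` and contains the indices with energy at most `L`, thus acting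
  -- as a subsequence along which weak limits exist.
  let 𝓤 : Ultrafilter ℕ := Ultrafilter.of (atTop ⊓ 𝓟 S)
  have h𝓤 : (𝓤 : Filter ℕ) ≤ atTop := (Ultrafilter.of_le _).trans inf_le_left
  have hS : ∀ᶠ k in (𝓤 : Filter ℕ), k ∈ S :=
    le_principal_iff.1 ((Ultrafilter.of_le _).trans inf_le_right)
  obtain ⟨R, hR⟩ := P.exists_gradient_bound hΩ hα hβ hγ hh hq hg L
    (l2norm (volume.restrict Ω) u + 1)
  have hbound : ∀ᶠ k in (𝓤 : Filter ℕ), MemH1 Ω (v k) ∧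
      l2norm (volume.restrict Ω) (weakGradient Ω (v k)) ≤ R := by
    have h1 : ∀ᶠ k in (𝓤 : Filter ℕ), l2norm (volume.restrict Ω) (v k - u) < 1 :=
      h𝓤 ((tendsto_order.1 hvu).2 1 one_pos)
    filter_upwards [hS, h1] with k hk h1
    refine ⟨hk.1, hR _ (hpos k) _ hk.1 ?_ hk.2⟩
    have := l2norm_le_add_sub (hv k) hu
    linarith
  have hW : ∀ᶠ k in (𝓤 : Filter ℕ), MemLp (weakGradient Ω (v k)) 2 (volume.restrict Ω) ∧
      l2norm (volume.restrict Ω) (weakGradient Ω (v k)) ≤ R :=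
    hbound.mono fun k hk => ⟨hk.1.memLp_weakGradient, hk.2⟩
  obtain ⟨G, hG, hlim⟩ := exists_weak_limit_memLp 𝓤 hW
  have hwg : IsWeakGradient Ω u G := isWeakGradient_of_tendsto h𝓤 hu hv hvu hlim
    (hbound.mono fun k hk => hk.1.isWeakGradient)
  have huH : MemH1 Ω u := ⟨hu, G, hG, hwg⟩
  have hGe : G =ᵐ[volume.restrict Ω] weakGradient Ω u :=
    hwg.ae_eq hΩ huH.isWeakGradient hG huH.memLp_weakGradient
  refine ⟨huH, ?_⟩
  rw [sharpIntegral_eq hΩ hUo hnull hh hq huH]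
  have hpos' := fun k => (hpos k).1
  have t1 := tendsto_integral_bdd_mul_inner h𝓤 hW hG hlim
    (m := fun k => diffuseCoeff U (e k) (fun _ => 1) (fun _ => α))
    (m₀ := sharpCoeff Ω U (fun _ => 1) (fun _ => α)) (M := |(1 : ℝ)| + (|α| + |1 - α|))
    (fun k => (continuous_diffuseCoeff U (e k) 1 α).aestronglyMeasurable)
    (measurable_sharpCoeff hΩ hUo 1 α).aestronglyMeasurable
    (fun k => .of_forall fun x => (abs_diffuseCoeff_le U (e k) 1 α x).trans
      (le_add_of_nonneg_left (abs_nonneg _)))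
    (.of_forall fun x => (abs_sharpCoeff_le Ω U 1 α x).trans
      (by have := abs_nonneg (1 - α); linarith))
    (tendsto_diffuseCoeff hΩ hne hnull _ _ he hpos')
  have t2 := (tendsto_integral_diffuseCoeff_mul hΩ hne hnull he hpos' 1 α (fun _ => hG.norm)
    hG.norm (fun _ => hG.norm) hG.norm (by simp [l2norm]) (by simp [l2norm])).mono_left h𝓤
  have t3 := (tendsto_integral_diffuseCoeff_mul hΩ hne hnull he hpos' γ β hv hu hv hu hvu
    hvu).mono_left h𝓤
  have t4 := (tendsto_integral_load hΩ hUo hne hnull he hpos' hh hq hv hu hvu).mono_left h𝓤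
  have t5 := P.tendsto_integral_boundary_seq hk hn hU hUo hΩ hbdd hne hsub hg huH he hpos h𝓤 hvu
    hbound
  -- The limit of the convexity lower bound: since the weak limit is `G` itself, `2 D_0 G·G - D_0
  -- |G|²` collapses to `D_0 |∇u|²`, with no loss.
  have e1 : 2 * (∫ x in Ω, sharpCoeff Ω U (fun _ => 1) (fun _ => α) x * inner ℝ (G x) (G x)) -
      ∫ x in Ω, sharpCoeff Ω U (fun _ => 1) (fun _ => α) x * (‖G x‖ * ‖G x‖) =
      ∫ x in Ω, sharpCoeff Ω U (fun _ => 1) (fun _ => α) x *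
        (‖weakGradient Ω u x‖ * ‖weakGradient Ω u x‖) := by
    simp only [real_inner_self_eq_norm_mul_norm]
    rw [two_mul, add_sub_cancel_right]
    refine integral_congr_ae ?_
    filter_upwards [hGe] with x hx
    rw [hx]
  rw [← e1]
  refine le_of_tendsto ((((((t1.const_mul 2).sub t2).const_mul (1 / 2)).add
    (t3.const_mul (1 / 2))).sub t4).add t5) ?_
  filter_upwards [hS] with k hk
  have h1 := hk.2
  rw [diffuseIntegral_eq hh hq hg.1 hk.1 (hpos' k)] at h1
  have h2 := integral_diffuseCoeff_inner_le (U := U) (ε := e k) hα hk.1.memLp_weakGradient hG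
  linarith

end Energies

end DiffuseDomain

theorem theorem1 {n : ℕ} (hn : 1 ≤ n) (a b : Fin n → ℝ)
    (Ω₁ : Set (DiffuseDomain.E n)) (hΩ₁_open : IsOpen Ω₁) (hΩ₁_bdd : Bornology.IsBounded Ω₁)
    (hΩ₁_ne : Ω₁.Nonempty) (hΩ₁_C3 : DiffuseDomain.HasCkBoundary 3 Ω₁)
    (hΩ₁_sub : closure Ω₁ ⊆ DiffuseDomain.cuboid a b)
    (α β γ : ℝ) (hα : 0 < α) (hβ : 0 < β) (hγ : 0 < γ)
    (h q g : DiffuseDomain.E n → ℝ)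
    (hh : MemLp h 2 (volume.restrict (DiffuseDomain.cuboid a b)))
    (hq : MemLp q 2 (volume.restrict (DiffuseDomain.cuboid a b)))
    (hg : DiffuseDomain.MemH1 (DiffuseDomain.cuboid a b) g) :
    DiffuseDomain.GammaConverges
      (DiffuseDomain.diffuseEnergy (DiffuseDomain.cuboid a b) Ω₁ α β γ h q g)
      (DiffuseDomain.sharpEnergy (DiffuseDomain.cuboid a b) Ω₁ α β γ h q g) := by
  have hk : (1 : ℕ∞) ≤ 3 := by norm_num
  have hΩ := DiffuseDomain.isOpen_cuboid a b
  have hne := DiffuseDomain.frontier_nonempty hn hΩ₁_ne hΩ₁_bdd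
  have hcpt : IsCompact (frontier Ω₁) :=
    hΩ₁_bdd.isCompact_closure.of_isClosed_subset isClosed_frontier frontier_subset_closure
  -- Any `c` in `(0, 1)` would do here: this partition serves the localization and the uniform
  -- bounds, while the limit `c → 1` uses partitions of its own.
  obtain ⟨P⟩ := DiffuseDomain.exists_boundaryPartition hk hΩ₁_C3 hΩ₁_open hcpt hne hΩ
    (frontier_subset_closure.trans hΩ₁_sub) (c := 1 / 2) (by norm_num) (by norm_num)
  intro e hpos he
  -- The constant sequence is the recovery sequence.
  refine ⟨fun u v hvu => ?_, fun u => ⟨fun _ => u, tendsto_const_nhds, ?_⟩⟩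
  · by_contra! hlt
    -- A real `L` strictly between the lower limit and the sharp energy bounds infinitely many
    -- energies, which are then finite, so those `v k` are in `H¹`; lower semicontinuity contradicts
    -- the choice of `L`.
    obtain ⟨L, hL1, hL2⟩ := EReal.lt_iff_exists_real_btwn.1 hlt
    have hfreq : ∃ᶠ k in atTop, DiffuseDomain.MemH1 (DiffuseDomain.cuboid a b) (v k) ∧
        DiffuseDomain.diffuseIntegral (DiffuseDomain.cuboid a b) Ω₁ α β γ h q g (e k) (v k) ≤ L := by
      refine (frequently_lt_of_liminf_lt (by isBoundedDefault) hL1).mono fun k hk' => ?_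
      by_cases hm : DiffuseDomain.MemH1 (DiffuseDomain.cuboid a b) (v k)
      · rw [DiffuseDomain.diffuseEnergy, if_pos hm] at hk'
        exact ⟨hm, (EReal.coe_lt_coe_iff.1 hk').le⟩
      · rw [DiffuseDomain.diffuseEnergy, if_neg hm] at hk'
        exact absurd hk' not_top_lt
    have hconv : Tendsto (fun k => DiffuseDomain.l2norm
        (volume.restrict (DiffuseDomain.cuboid a b)) (⇑(v k) - ⇑u)) atTop (𝓝 0) :=
      (tendsto_iff_dist_tendsto_zero.1 hvu).congr fun k => Lp.dist_def _ _
    obtain ⟨hm, hle⟩ := P.sharpIntegral_le hk hn hΩ₁_C3 hΩ₁_open hΩ hΩ₁_bdd hne hΩ₁_sub hα hβ hγ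
      hh hq hg (Lp.memLp u) he hpos (fun k => Lp.memLp (v k)) hconv hfreq
    rw [DiffuseDomain.sharpEnergy, if_pos hm] at hL2
    exact absurd (EReal.coe_lt_coe_iff.1 hL2) (not_lt.2 hle)
  · by_cases hm : DiffuseDomain.MemH1 (DiffuseDomain.cuboid a b) u
    · have ht := P.tendsto_diffuseIntegral (α := α) (β := β) (γ := γ) hk hn hΩ₁_C3 hΩ₁_open hΩ
        hΩ₁_bdd hne hΩ₁_sub hh hq hg hm he fun k => (hpos k).1
      simp only [DiffuseDomain.diffuseEnergy, DiffuseDomain.sharpEnergy, if_pos hm]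
      exact (EReal.tendsto_coe.2 ht).limsup_eq.le
    · rw [DiffuseDomain.sharpEnergy, if_neg hm]
      exact le_top
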